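/- Let $\mathbf{k}$ be an algebraically closed field of characteristic $p>0$ and let $\mathcal{C}$ be a (symmetric) tensor category over $\mathbf{k}$: a symmetric rigid monoidal $\mathbf{k}$-linear abelian category with bilinear tensor product, with $\mathrm{End}(\mathbb{1})=\mathbf{k}$ and all objects of finite length. For an object $X$ with braiding $c=c_{X,X}$ let $\Lambda^2X\subseteq X\otimes X$ be the image and $\Gamma^2X\subseteq X\otimes X$ the kernel of $1-c$; let $TX=\bigoplus_n X^{\otimes n}$, and let $\mathrm{Sym}X$ and $\wedge X$ be the quotients of $TX$ by the ideals generated by $\Lambda^2X$ and $\Gamma^2X$. With $X$ primitive, $TX$ is a graded bialgebra and these quotients are graded Hopf algebras, where for $\mathrm{Sym}$ homogeneous factors are interchanged by the braiding of $\mathcal{C}$, and for $\wedge$ by the braiding times $(-1)^{ij}$ on factors of (total) degrees $i$ and $j$ (Koszul sign rule). Let $0\to X\to Y\to Z\to0$ be an exact sequence in $\mathcal{C}$. Filter $Y^{\otimes n}$ by $F^i(Y^{\otimes n})$, the sum of the subobjects that are tensor products of $n$ factors with $X$ in at least $i$ positions and $Y$ in the others, and give $\mathrm{Sym}^nY$ and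 $\wedge^nY$ the induced (image) filtrations. Let $\mathrm{gr}\,\mathrm{Sym}Y$ and $\mathrm{gr}\wedge Y$ be the associated bigraded objects, with component $F^i/F^{i+1}$ of $\mathrm{Sym}^{i+j}Y$, respectively $\wedge^{i+j}Y$, in bidegree $(i,j)$. Let $R_0$ be the image of $\mathrm{Sym}X\to\mathrm{Sym}Y$, let $R_1$ be the image of $\wedge X\to\wedge Y$, and let $R_2$ be the pushout of the quotient maps $TY\to\wedge Y$ and $TY\to TZ$, with their induced graded Hopf algebra structures. Then $\mathrm{gr}\,\mathrm{Sym}Y$ and $\mathrm{gr}\wedge Y$, with the structures induced from $\mathrm{Sym}Y$ and $\wedge Y$, are bigraded Hopf algebras (the second one with the Koszul sign rule for the total degree), and there are isomorphisms of bigraded Hopf algebras $$\mathrm{gr}\,\mathrm{Sym}Y\cong R_0\otimes\mathrm{Sym}Z,\qquad \mathrm{gr}\wedge Y\cong R_1\otimes R_2,$$ where the $(i,j)$ component of a tensor product $A\otimes B$ is $A[i]\otimes B[j]$. Moreover each $R\in\{R_0,\mathrm{Sym}Z,R_1,R_2\}$ satisfies $R[0]=\mathbb{1}$ (via the unit), $R[1]=X$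 for $R\in\{R_0,R_1\}$ and $R[1]=Z$ for $R\in\{\mathrm{Sym}Z,R_2\}$ (via the canonical map), and $R[i]=0$ implies $R[i+1]=0$ for all $i\geq 0$. -/

import Mathlib

open CategoryTheory CategoryTheory.Limits CategoryTheory.MonoidalCategory

universe v u

/-- Pairs of bidegrees with given sum. -/
instance hasAntidiagonalNatProd : Finset.HasAntidiagonal (ℕ × ℕ) where
  antidiagonal n := (Finset.Iic n ×ˢ Finset.Iic n).filter fun p => p.1 + p.2 = n
  mem_antidiagonal := by
    intro n a
    simp only [Finset.mem_filter, Finset.mem_product, Finset.mem_Iic, and_iff_right_iff_imp]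
    rintro rfl
    exact ⟨⟨Nat.le_add_right _ _, Nat.le_add_right _ _⟩,
      ⟨Nat.le_add_left _ _, Nat.le_add_left _ _⟩⟩

noncomputable section

section TensorCategory

/-- A (symmetric) tensor category over `k`: a symmetric rigid monoidal `k`-linear abelian category
(with `k`-bilinear tensor product) in which `End(𝟙) = k` and all objects have finite length. The
structure is in the instance arguments, the two remaining conditions are the fields. -/
structure IsTensorCategory (k : Type*) [Field k] (C : Type u) [Category.{v} C] [Abelian C]
    [Linear k C] [MonoidalCategory C] [MonoidalPreadditive C] [MonoidalLinear k C]
    [SymmetricCategory C] [RigidCategory C] : Prop where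
  end_unit : Function.Bijective fun a : k => a • 𝟙 (𝟙_ C)
  finite_length : ∀ X : C, IsArtinianObject X ∧ IsNoetherianObject X

end TensorCategory

section Graded

variable {C : Type u} [Category.{v} C] [Preadditive C] [MonoidalCategory C]
variable {ι : Type} [AddCommMonoid ι]

/-- The structure maps of an `ι`-graded bialgebra `⨁ᵢ A i` with components `A i` in `C`, given by
their matrix components. (A graded map out of or into `⨁ A i` is the same as the family of its
components; all components of mismatched degree vanish, see `IsHopf`.) -/
structure GradedBialgData (A : ι → C) where
  mul : ∀ i j k, A i ⊗ A j ⟶ A k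
  comul : ∀ k i j, A k ⟶ A i ⊗ A j
  one : ∀ i, 𝟙_ C ⟶ A i
  counit : ∀ i, A i ⟶ 𝟙_ C

namespace GradedBialgData

variable {A B : ι → C}

/-- `H` is a graded Hopf algebra. The interchange of homogeneous factors of degrees `i`, `j` is
the braiding of `C` times `ε ^ (deg i * deg j)`: `ε = 1` is the plain braiding and `ε = -1`
is the Koszul sign rule. -/
structure IsHopf [BraidedCategory C] [Finset.HasAntidiagonal ι] (ε : ℤ) (deg : ι → ℕ)
    (H : GradedBialgData A) : Prop where
  mul_deg : ∀ i j k, i + j ≠ k → H.mul i j k = 0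
  comul_deg : ∀ k i j, i + j ≠ k → H.comul k i j = 0
  one_deg : ∀ i, i ≠ 0 → H.one i = 0
  counit_deg : ∀ i, i ≠ 0 → H.counit i = 0
  mul_assoc : ∀ i j k n, H.mul i j (i + j) ▷ A k ≫ H.mul (i + j) k n =
    (α_ _ _ _).hom ≫ A i ◁ H.mul j k (j + k) ≫ H.mul i (j + k) n
  one_mul : ∀ i, H.one 0 ▷ A i ≫ H.mul 0 i i = (λ_ (A i)).hom
  mul_one : ∀ i, A i ◁ H.one 0 ≫ H.mul i 0 i = (ρ_ (A i)).hom
  comul_assoc : ∀ n i j k, H.comul n (i + j) k ≫ H.comul (i + j) i j ▷ A k ≫ (α_ _ _ _).hom =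
    H.comul n i (j + k) ≫ A i ◁ H.comul (j + k) j k
  counit_comul : ∀ i, H.comul i 0 i ≫ H.counit 0 ▷ A i = (λ_ (A i)).inv
  comul_counit : ∀ i, H.comul i i 0 ≫ A i ◁ H.counit 0 = (ρ_ (A i)).inv
  mul_comul : ∀ i j k l, H.mul i j (i + j) ≫ H.comul (i + j) k l =
    ∑ p ∈ Finset.HasAntidiagonal.antidiagonal i, ∑ q ∈ Finset.HasAntidiagonal.antidiagonal j,
      (ε ^ (deg p.2 * deg q.1)) •
        ((H.comul i p.1 p.2 ⊗ₘ H.comul j q.1 q.2) ≫ tensorμ _ _ _ _ ≫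
          (H.mul p.1 q.1 k ⊗ₘ H.mul p.2 q.2 l))
  one_comul : H.one 0 ≫ H.comul 0 0 0 = (λ_ (𝟙_ C)).inv ≫ (H.one 0 ⊗ₘ H.one 0)
  mul_counit : H.mul 0 0 0 ≫ H.counit 0 = (H.counit 0 ⊗ₘ H.counit 0) ≫ (λ_ (𝟙_ C)).hom
  one_counit : H.one 0 ≫ H.counit 0 = 𝟙 _
  antipode : ∃ s : ∀ i, A i ⟶ A i, ∀ i,
    (∑ p ∈ Finset.HasAntidiagonal.antidiagonal i,
      H.comul i p.1 p.2 ≫ (s p.1 ▷ A p.2) ≫ H.mul p.1 p.2 i = H.counit i ≫ H.one i) ∧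
    (∑ p ∈ Finset.HasAntidiagonal.antidiagonal i,
      H.comul i p.1 p.2 ≫ (A p.1 ◁ s p.2) ≫ H.mul p.1 p.2 i = H.counit i ≫ H.one i)

/-- The degree-preserving family `f` respects the (co)multiplications and (co)units. Between Hopf
algebras this makes it a morphism of graded Hopf algebras. -/
structure IsHom (H : GradedBialgData A) (K : GradedBialgData B) (f : ∀ i, A i ⟶ B i) : Prop where
  mul : ∀ i j k, H.mul i j k ≫ f k = (f i ⊗ₘ f j) ≫ K.mul i j k
  comul : ∀ k i j, H.comul k i j ≫ (f i ⊗ₘ f j) = f k ≫ K.comul k i j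
  one : ∀ i, H.one i ≫ f i = K.one i
  counit : ∀ i, f i ≫ K.counit i = H.counit i

/-- The tensor product of two `ℕ`-graded bialgebras as an `ℕ × ℕ`-graded bialgebra with component
`A i ⊗ B j` in bidegree `(i, j)`, where factors of degrees `i`, `j` are interchanged by the
braiding of `C` times `ε ^ (i * j)`. -/
def tensor {A B : ℕ → C} [BraidedCategory C] (ε : ℤ) (H : GradedBialgData A)
    (K : GradedBialgData B) : GradedBialgData fun a : ℕ × ℕ => A a.1 ⊗ B a.2 where
  mul a b c := (ε ^ (a.2 * b.1)) •
    (tensorμ (A a.1) (B a.2) (A b.1) (B b.2) ≫ (H.mul a.1 b.1 c.1 ⊗ₘ K.mul a.2 b.2 c.2))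
  comul c a b := (ε ^ (b.1 * a.2)) •
    ((H.comul c.1 a.1 b.1 ⊗ₘ K.comul c.2 a.2 b.2) ≫ tensorμ (A a.1) (A b.1) (B a.2) (B b.2))
  one a := (λ_ (𝟙_ C)).inv ≫ (H.one a.1 ⊗ₘ K.one a.2)
  counit a := (H.counit a.1 ⊗ₘ K.counit a.2) ≫ (λ_ (𝟙_ C)).hom

end GradedBialgData

/-- `R[0] = 𝟙` (through the unit of the algebra), `R[1] = V` (through the given map `j`), and
`R[i] = 0` implies `R[i+1] = 0`. -/
structure HasStandardStart {R : ℕ → C} (H : GradedBialgData R) {V : C} (j : V ⟶ R 1) : Prop where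
  zero : IsIso (H.one 0)
  one : IsIso j
  succ : ∀ i, IsZero (R i) → IsZero (R (i + 1))

end Graded

section TensorAlgebra

variable {C : Type u} [Category.{v} C] [MonoidalCategory C]

/-- The tensor power `X^{⊗n}`. -/
def tpow (X : C) : ℕ → C
  | 0 => 𝟙_ C
  | n + 1 => tpow X n ⊗ X

/-- `f^{⊗n}`. -/
def tpowMap {X Y : C} (f : X ⟶ Y) : ∀ n, tpow X n ⟶ tpow Y n
  | 0 => 𝟙 (𝟙_ C)
  | n + 1 => tpowMap f n ⊗ₘ f

/-- The identification `X = X^{⊗1}`. -/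
def toTpowOne (X : C) : X ⟶ tpow X 1 := (λ_ X).inv

/-- The identification `X ⊗ X = X^{⊗2}`. -/
def toTpowTwo (X : C) : X ⊗ X ⟶ tpow X 2 := (λ_ X).inv ▷ X

/-- Concatenation `X^{⊗i} ⊗ X^{⊗j} = X^{⊗(i+j)}`. -/
def tconcat (X : C) (i : ℕ) : ∀ j, tpow X i ⊗ tpow X j ⟶ tpow X (i + j)
  | 0 => (ρ_ (tpow X i)).hom
  | j + 1 => (α_ (tpow X i) (tpow X j) X).inv ≫ tconcat X i j ▷ X

theorem tconcat_natural {X Y : C} (f : X ⟶ Y) (i : ℕ) : ∀ j,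
    tconcat X i j ≫ tpowMap f (i + j) = (tpowMap f i ⊗ₘ tpowMap f j) ≫ tconcat Y i j
  | 0 => by simp [tconcat, tpowMap, tpow, MonoidalCategory.tensorHom_def]
  | j + 1 => by
    have ih := tconcat_natural f i j
    change ((α_ (tpow X i) (tpow X j) X).inv ≫ tconcat X i j ▷ X) ≫ (tpowMap f (i + j) ⊗ₘ f) =
      (tpowMap f i ⊗ₘ (tpowMap f j ⊗ₘ f)) ≫
        (α_ (tpow Y i) (tpow Y j) Y).inv ≫ tconcat Y i j ▷ Y
    rw [associator_inv_naturality_assoc, Category.assoc, ← tensorHom_id, ← tensorHom_id,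
      tensorHom_comp_tensorHom, tensorHom_comp_tensorHom, ih, Category.id_comp, Category.comp_id]

variable [Preadditive C]

/-- The multiplication of the tensor algebra: concatenation if `i + j = k`, and zero otherwise. -/
def tmul (X : C) (i j k : ℕ) : tpow X i ⊗ tpow X j ⟶ tpow X k :=
  if h : i + j = k then tconcat X i j ≫ eqToHom (congrArg (tpow X) h) else 0

/-- The comultiplication of the tensor algebra: the multiplicative extension of
`x ↦ x ⊗ 1 + 1 ⊗ x`. If `Δ(w) = ∑ w' ⊗ w''` then
`Δ(w x) = ∑ w' ⊗ w'' x + ∑ ε ^ |w''| w' x ⊗ w''`. -/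
def tcomul [BraidedCategory C] (ε : ℤ) (X : C) : ∀ k i j, tpow X k ⟶ tpow X i ⊗ tpow X j
  | 0, 0, 0 => (λ_ (𝟙_ C)).inv
  | 0, _ + 1, _ => 0
  | 0, 0, _ + 1 => 0
  | _ + 1, 0, 0 => 0
  | k + 1, 0, j + 1 => (tcomul ε X k 0 j ▷ X) ≫ (α_ _ _ _).hom
  | k + 1, i + 1, 0 => (tcomul ε X k i 0 ▷ X) ≫ (α_ _ _ _).hom ≫
      (tpow X i ◁ (β_ (tpow X 0) X).hom) ≫ (α_ _ _ _).inv
  | k + 1, i + 1, j + 1 =>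
      ((tcomul ε X k (i + 1) j ▷ X) ≫ (α_ (tpow X (i + 1)) (tpow X j) X).hom :
        tpow X (k + 1) ⟶ tpow X (i + 1) ⊗ tpow X (j + 1)) +
      (ε ^ (j + 1)) • ((tcomul ε X k i (j + 1) ▷ X) ≫ (α_ _ _ _).hom ≫
        (tpow X i ◁ (β_ (tpow X (j + 1)) X).hom) ≫ (α_ (tpow X i) X (tpow X (j + 1))).inv :
        tpow X (k + 1) ⟶ tpow X (i + 1) ⊗ tpow X (j + 1))

/-- The tensor algebra `TX` with its bialgebra structure, for the sign rule `ε`. -/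
def tensorAlgebraData [BraidedCategory C] (ε : ℤ) (X : C) : GradedBialgData (tpow X) where
  mul := tmul X
  comul := tcomul ε X
  one
    | 0 => 𝟙 (𝟙_ C)
    | _ + 1 => 0
  counit
    | 0 => 𝟙 (𝟙_ C)
    | _ + 1 => 0

theorem tmul_natural {X Y : C} [MonoidalPreadditive C] (f : X ⟶ Y) (i j k : ℕ) :
    tmul X i j k ≫ tpowMap f k = (tpowMap f i ⊗ₘ tpowMap f j) ≫ tmul Y i j k := by
  unfold tmul
  split_ifs with h
  · subst h
    simp [tconcat_natural]
  · simp

end TensorAlgebra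

section Quadratic

variable {C : Type u} [Category.{v} C] [Abelian C]

theorem imageSubobject_le_kernelSubobject {A B D : C} (f : A ⟶ B) (g : B ⟶ D) (h : f ≫ g = 0) :
    imageSubobject f ≤ kernelSubobject g :=
  imageSubobject_le f (factorThruKernelSubobject g f h) (by simp)

variable [MonoidalCategory C]

/-- For `κ : K ⟶ X ⊗ X`, the map `X^{⊗i} ⊗ K ⊗ X^{⊗j} ⟶ X^{⊗n}`, where `i + 2 + j = n`
(zero otherwise). -/
def relMap {X K : C} (κ : K ⟶ X ⊗ X) (i j n : ℕ) : (tpow X i ⊗ K) ⊗ tpow X j ⟶ tpow X n :=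
  ((tpow X i ◁ (κ ≫ toTpowTwo X) ≫ tmul X i 2 (i + 2)) ▷ tpow X j) ≫ tmul X (i + 2) j n

/-- The degree `n` part `∑ X^{⊗i} ⊗ K ⊗ X^{⊗j}` of the ideal of `TX` generated by the image of
`κ : K ⟶ X ⊗ X`. -/
def quadIdeal {X K : C} (κ : K ⟶ X ⊗ X) : ∀ n, Subobject (tpow X n)
  | 0 => ⊥
  | 1 => ⊥
  | n + 2 => (Finset.HasAntidiagonal.antidiagonal n).sup fun p => imageSubobject (relMap κ p.1 p.2 (n + 2))

/-- The degree `n` part of the quotient of `TX` by the ideal generated by `κ`. -/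
def quadAlg {X K : C} (κ : K ⟶ X ⊗ X) (n : ℕ) : C := cokernel (quadIdeal κ n).arrow

/-- The projection of `TX` to its quadratic quotient. -/
def quadπ {X K : C} (κ : K ⟶ X ⊗ X) (n : ℕ) : tpow X n ⟶ quadAlg κ n :=
  cokernel.π (quadIdeal κ n).arrow

theorem quadIdeal_arrow_comp {X K : C} (κ : K ⟶ X ⊗ X) {n : ℕ} {D : C} (g : tpow X n ⟶ D)
    (h : ∀ i j, relMap κ i j n ≫ g = 0) : (quadIdeal κ n).arrow ≫ g = 0 := by
  have hle : quadIdeal κ n ≤ kernelSubobject g := by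
    match n with
    | 0 => exact bot_le
    | 1 => exact bot_le
    | n + 2 => exact Finset.sup_le fun p _ => imageSubobject_le_kernelSubobject _ _ (h _ _)
  rw [← Subobject.ofLE_arrow hle, Category.assoc, kernelSubobject_arrow_comp, comp_zero]

theorem relMap_comp_quadπ {X K : C} [MonoidalPreadditive C] (κ : K ⟶ X ⊗ X) (i j n : ℕ) :
    relMap κ i j n ≫ quadπ κ n = 0 := by
  by_cases hn : i + 2 + j = n
  · obtain ⟨m, rfl, hm⟩ : ∃ m, n = m + 2 ∧ i + j = m := ⟨i + j, by omega, rfl⟩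
    have hle : imageSubobject (relMap κ i j (m + 2)) ≤ quadIdeal κ (m + 2) :=
      Finset.le_sup (f := fun p : ℕ × ℕ => imageSubobject (relMap κ p.1 p.2 (m + 2)))
        (Finset.HasAntidiagonal.mem_antidiagonal.2 hm : (i, j) ∈ _)
    have h0 : (imageSubobject (relMap κ i j (m + 2))).arrow ≫ quadπ κ (m + 2) = 0 := by
      have h1 : (quadIdeal κ (m + 2)).arrow ≫ quadπ κ (m + 2) = 0 := cokernel.condition _
      rw [← Subobject.ofLE_arrow hle, Category.assoc, h1, comp_zero]
    rw [← imageSubobject_arrow_comp (relMap κ i j (m + 2)), Category.assoc, h0, comp_zero]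
  · simp [relMap, tmul, hn]

theorem relMap_natural {X Y K L : C} [MonoidalPreadditive C] (κ : K ⟶ X ⊗ X) (l : L ⟶ Y ⊗ Y)
    (f : X ⟶ Y) (k : K ⟶ L) (hk : k ≫ l = κ ≫ (f ⊗ₘ f)) (i j n : ℕ) :
    relMap κ i j n ≫ tpowMap f n =
      ((tpowMap f i ⊗ₘ k) ⊗ₘ tpowMap f j) ≫ relMap l i j n := by
  have h2 : toTpowTwo X ≫ tpowMap f 2 = (f ⊗ₘ f) ≫ toTpowTwo Y := by
    change (λ_ X).inv ▷ X ≫ ((𝟙 (𝟙_ C) ⊗ₘ f) ⊗ₘ f) = (f ⊗ₘ f) ≫ (λ_ Y).inv ▷ Y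
    rw [← tensorHom_id, ← tensorHom_id, tensorHom_comp_tensorHom, tensorHom_comp_tensorHom]
    simp
  have h3 : (tpow X i ◁ (κ ≫ toTpowTwo X) ≫ tmul X i 2 (i + 2)) ≫ tpowMap f (i + 2) =
      (tpowMap f i ⊗ₘ k) ≫ (tpow Y i ◁ (l ≫ toTpowTwo Y) ≫ tmul Y i 2 (i + 2)) := by
    rw [Category.assoc, tmul_natural, ← id_tensorHom, ← id_tensorHom,
      tensorHom_comp_tensorHom_assoc, tensorHom_comp_tensorHom_assoc, Category.assoc, h2,
      ← Category.assoc k, hk]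
    simp
  unfold relMap
  rw [Category.assoc, tmul_natural, ← tensorHom_id, ← tensorHom_id,
    tensorHom_comp_tensorHom_assoc, tensorHom_comp_tensorHom_assoc, h3]
  simp

/-- The map of quadratic algebras induced by `f : X ⟶ Y` if `f ⊗ f` maps relations to
relations. -/
def quadMap {X Y K L : C} [MonoidalPreadditive C] (κ : K ⟶ X ⊗ X) (l : L ⟶ Y ⊗ Y)
    (f : X ⟶ Y) (h : ∃ k : K ⟶ L, k ≫ l = κ ≫ (f ⊗ₘ f)) (n : ℕ) :
    quadAlg κ n ⟶ quadAlg l n :=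
  cokernel.desc _ (tpowMap f n ≫ quadπ l n) <| quadIdeal_arrow_comp κ _ fun i j => by
    obtain ⟨k, hk⟩ := h
    rw [← Category.assoc, relMap_natural κ l f k hk, Category.assoc, relMap_comp_quadπ, comp_zero]

variable [BraidedCategory C]

/-- `1 - c` on `X ⊗ X`. -/
def oneSubBraid (X : C) : X ⊗ X ⟶ X ⊗ X := 𝟙 _ - (β_ X X).hom

theorem oneSubBraid_natural {X Y : C} (f : X ⟶ Y) :
    oneSubBraid X ≫ (f ⊗ₘ f) = (f ⊗ₘ f) ≫ oneSubBraid Y := by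
  simp [oneSubBraid, Preadditive.sub_comp, Preadditive.comp_sub]

/-- `Λ²X ⟶ X ⊗ X`: the image of `1 - c`, as a subobject of `X ⊗ X`. -/
def lambdaTwoι (X : C) : image (oneSubBraid X) ⟶ X ⊗ X := image.ι (oneSubBraid X)

/-- `Γ²X ⟶ X ⊗ X`: the kernel of the projection of `X ⊗ X` to the image `∧²X` of `1 - c`. -/
def gammaTwoι (X : C) : kernel (factorThruImage (oneSubBraid X)) ⟶ X ⊗ X :=
  kernel.ι (factorThruImage (oneSubBraid X))

/-- `Symⁿ X`. -/
abbrev symPow (X : C) (n : ℕ) : C := quadAlg (lambdaTwoι X) n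

/-- The projection `X^{⊗n} ⟶ Symⁿ X`. -/
abbrev symπ (X : C) (n : ℕ) : tpow X n ⟶ symPow X n := quadπ (lambdaTwoι X) n

/-- `∧ⁿ X`. -/
abbrev extPow (X : C) (n : ℕ) : C := quadAlg (gammaTwoι X) n

/-- The projection `X^{⊗n} ⟶ ∧ⁿ X`. -/
abbrev extπ (X : C) (n : ℕ) : tpow X n ⟶ extPow X n := quadπ (gammaTwoι X) n

theorem lambdaTwoι_natural {X Y : C} (f : X ⟶ Y) :
    ∃ k, k ≫ lambdaTwoι Y = lambdaTwoι X ≫ (f ⊗ₘ f) :=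
  ⟨image.map (Arrow.homMk (f ⊗ₘ f) (f ⊗ₘ f) (oneSubBraid_natural f).symm :
    Arrow.mk (oneSubBraid X) ⟶ Arrow.mk (oneSubBraid Y)), image.map_ι _⟩

theorem gammaTwoι_natural {X Y : C} (f : X ⟶ Y) :
    ∃ k, k ≫ gammaTwoι Y = gammaTwoι X ≫ (f ⊗ₘ f) := by
  refine ⟨kernel.lift _ (gammaTwoι X ≫ (f ⊗ₘ f)) ?_, kernel.lift_ι _ _ _⟩
  rw [← cancel_mono (image.ι (oneSubBraid Y)), Category.assoc, Category.assoc, image.fac,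
    ← oneSubBraid_natural, zero_comp]
  have h0 : gammaTwoι X ≫ oneSubBraid X = 0 := by
    have h1 : gammaTwoι X ≫ factorThruImage (oneSubBraid X) ≫ image.ι (oneSubBraid X) = 0 := by
      rw [gammaTwoι, kernel.condition_assoc, zero_comp]
    rwa [image.fac] at h1
  rw [← Category.assoc, h0, zero_comp]

variable [MonoidalPreadditive C]

/-- `Symⁿ f`. -/
def symMap {X Y : C} (f : X ⟶ Y) (n : ℕ) : symPow X n ⟶ symPow Y n :=
  quadMap _ _ f (lambdaTwoι_natural f) n

/-- `∧ⁿ f`. -/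
def extMap {X Y : C} (f : X ⟶ Y) (n : ℕ) : extPow X n ⟶ extPow Y n :=
  quadMap _ _ f (gammaTwoι_natural f) n

end Quadratic

section Filtration

variable {C : Type u} [Category.{v} C] [MonoidalCategory C]

/-- The letter `X` (for `true`) or `Y` (for `false`). -/
def letter (X Y : C) : Bool → C
  | true => X
  | false => Y

/-- `f : X ⟶ Y` or the identity of `Y`. -/
def letterMap {X Y : C} (f : X ⟶ Y) : ∀ b, letter X Y b ⟶ Y
  | true => f
  | false => 𝟙 Y

/-- The tensor product of `n` factors, with `X` at the positions in `s` and `Y` elsewhere. -/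
def word (X Y : C) (s : Finset ℕ) : ℕ → C
  | 0 => 𝟙_ C
  | n + 1 => word X Y s n ⊗ letter X Y (decide (n ∈ s))

/-- The map `word X Y s n ⟶ Y^{⊗n}` induced by `f : X ⟶ Y`. -/
def wordMap {X Y : C} (f : X ⟶ Y) (s : Finset ℕ) : ∀ n, word X Y s n ⟶ tpow Y n
  | 0 => 𝟙 (𝟙_ C)
  | n + 1 => wordMap f s n ⊗ₘ letterMap f (decide (n ∈ s))

variable [Abelian C]

/-- The subobject of `Y^{⊗n}` spanned by the tensors with at least `i` factors from `X`. -/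
def tpowFilt {X Y : C} (f : X ⟶ Y) (i n : ℕ) : Subobject (tpow Y n) :=
  ((Finset.range n).powerset.filter fun s => i ≤ s.card).sup fun s => imageSubobject (wordMap f s n)

variable {X Y : C} (f : X ⟶ Y) {P : ℕ → C} (π : ∀ n, tpow Y n ⟶ P n)

/-- The filtration induced on a quotient `P n` of `Y^{⊗n}`. -/
def quotFilt (i n : ℕ) : Subobject (P n) := imageSubobject ((tpowFilt f i n).arrow ≫ π n)

theorem tpowFilt_succ_le (i n : ℕ) : tpowFilt f (i + 1) n ≤ tpowFilt f i n :=
  Finset.sup_mono fun s hs => by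
    rw [Finset.mem_filter] at hs ⊢
    exact ⟨hs.1, by omega⟩

theorem quotFilt_succ_le (i n : ℕ) : quotFilt f π (i + 1) n ≤ quotFilt f π i n := by
  have h : (Subobject.ofLE _ _ (tpowFilt_succ_le f i n) ≫
      factorThruImageSubobject ((tpowFilt f i n).arrow ≫ π n)) ≫
      (imageSubobject ((tpowFilt f i n).arrow ≫ π n)).arrow =
      (tpowFilt f (i + 1) n).arrow ≫ π n := by simp
  exact imageSubobject_le _ _ h

/-- The associated bigraded object: its component of bidegree `(i, j)` is the piece
`Fⁱ / Fⁱ⁺¹` of `P (i + j)`, i.e. the one coming from tensors with `i` factors in `X` and `j`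
factors in `Y / X`. -/
def grObj (a : ℕ × ℕ) : C :=
  cokernel (Subobject.ofLE _ _ (quotFilt_succ_le f π a.1 (a.1 + a.2)))

/-- The projection `Fⁱ ⟶ Fⁱ / Fⁱ⁺¹`. -/
def grProj (a : ℕ × ℕ) : (quotFilt f π a.1 (a.1 + a.2) : C) ⟶ grObj f π a := cokernel.π _

/-- The quotient `P (i + j) / Fⁱ⁺¹`. -/
def quotMod (a : ℕ × ℕ) : C := cokernel (quotFilt f π (a.1 + 1) (a.1 + a.2)).arrow

/-- The projection `P (i + j) ⟶ P (i + j) / Fⁱ⁺¹`. -/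
def quotModProj (a : ℕ × ℕ) : P (a.1 + a.2) ⟶ quotMod f π a := cokernel.π _

/-- The inclusion `Fⁱ / Fⁱ⁺¹ ⟶ P (i + j) / Fⁱ⁺¹`. -/
def grIncl (a : ℕ × ℕ) : grObj f π a ⟶ quotMod f π a :=
  cokernel.desc _ ((quotFilt f π a.1 (a.1 + a.2)).arrow ≫ quotModProj f π a) (by
    rw [← Category.assoc, Subobject.ofLE_arrow]
    exact cokernel.condition _)

/-- `G` is the structure induced on the associated graded object by the structure `H` on the
filtered object `P`: the (co)multiplication of `G` is obtained from that of `H` by restricting to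
`Fⁱ` and passing to quotients by `Fⁱ⁺¹`. As `grProj` is epi and `grIncl` is mono this determines
`G`, once its components of mismatched degree vanish. -/
structure IsInducedOnGr (H : GradedBialgData P) (G : GradedBialgData (grObj f π)) : Prop where
  mul : ∀ a b c : ℕ × ℕ, a + b = c →
    (grProj f π a ⊗ₘ grProj f π b) ≫ G.mul a b c ≫ grIncl f π c =
      ((quotFilt f π a.1 (a.1 + a.2)).arrow ⊗ₘ (quotFilt f π b.1 (b.1 + b.2)).arrow) ≫
        H.mul (a.1 + a.2) (b.1 + b.2) (c.1 + c.2) ≫ quotModProj f π c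
  comul : ∀ c a b : ℕ × ℕ, a + b = c →
    grProj f π c ≫ G.comul c a b ≫ (grIncl f π a ⊗ₘ grIncl f π b) =
      (quotFilt f π c.1 (c.1 + c.2)).arrow ≫ H.comul (c.1 + c.2) (a.1 + a.2) (b.1 + b.2) ≫
        (quotModProj f π a ⊗ₘ quotModProj f π b)
  one : ∀ a : ℕ × ℕ, G.one a ≫ grIncl f π a = H.one (a.1 + a.2) ≫ quotModProj f π a
  counit : ∀ a : ℕ × ℕ,
    grProj f π a ≫ G.counit a = (quotFilt f π a.1 (a.1 + a.2)).arrow ≫ H.counit (a.1 + a.2)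

end Filtration

section Factors

variable {C : Type u} [Category.{v} C] [Abelian C] [MonoidalCategory C] [BraidedCategory C]
  [MonoidalPreadditive C]

/-- The image of `Sym X ⟶ Sym Y`. -/
abbrev symImage {X Y : C} (f : X ⟶ Y) (n : ℕ) : C := image (symMap f n)

/-- The image of `∧X ⟶ ∧Y`. -/
abbrev extImage {X Y : C} (f : X ⟶ Y) (n : ℕ) : C := image (extMap f n)

/-- The pushout of `TY ⟶ ∧Y` and `TY ⟶ TZ`. -/
abbrev extPushout {Y Z : C} (g : Y ⟶ Z) (n : ℕ) : C := pushout (extπ Y n) (tpowMap g n)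

end Factors

end

set_option linter.unusedSectionVars false

noncomputable section

/-! ### Exactness of the tensor product and transposition of vanishing conditions -/

section RigidExact

variable {C : Type u} [Category.{v} C] [Abelian C] [MonoidalCategory C] [RigidCategory C]

/-! Let `P` be `Sym Y` with sign `ε = 1`, or `∧Y` with sign `ε = -1`. Each is the quotient of `TY`
by quadratic relations `κ`, and two properties of `κ` carry most of the argument. First, `κ` is
killed by `1 + εc`, so the relations are primitive, the ideal is a biideal and `P` is a connected
graded bialgebra, hence Hopf (`exists_quadAlg_isHom`, `IsBialg.isHopf`). Second, `1 - εc` factors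
through `κ`, so `P` is commutative up to `ε`.

The filtration satisfies `Fᵃ Fᵇ ⊆ Fᵃ⁺ᵇ` and `Δ(Fᶜ) ⊆ ∑ Fᵘ ⊗ Fᵛ` over `u + v = c` (`tpowFilt_tmul`,
`tpowFilt_tcomul`). The piece `Fⁱ/Fⁱ⁺¹` is at once a quotient of `Fⁱ`, from which it takes its
product, and a subobject of `P/Fⁱ⁺¹`, from which it takes its coproduct (`exists_gr`).

The bigraded object `gr P` is generated by bidegrees `(1,0)` and `(0,1)`. Its part `gr(i,0)` is the
image of `X^{⊗i}` in `P i`, because `Fⁱ⁺¹(P i) = 0`; its part `gr(0,j)` is `P j / F¹`.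
Multiplication `gr(i,0) ⊗ gr(0,j) ⟶ gr(i,j)` is epi, since generators can be sorted by commutativity
(`gr_epi_mul_edges`). It is mono, since the component of `Δ` in bidegrees `(i,0)`, `(0,j)` sends
`xy` back to `x ⊗ y` (`mul_comul_edges_self`). So it is an isomorphism, with no count of lengths or
choice of bases, and it respects all structure (`tensor_isHom`).

It remains to identify `P / F¹`. The kernel of `TY ⟶ TZ` is `F¹`, so `P / F¹` is the pushout of `P`
and `TZ` over `TY`. For `∧` this is `R₂`. For `Sym` it is `Sym Z`, because `Λ²Y ⟶ Λ²Z` is epi. The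
statements on low degrees hold because there are no relations below degree two and degree one
generates.

There are no elements to compute with. Identities are tested on maps out of, or into, tensor
products, using exactness of `⊗` and the adjunctions given by duals. Multiplicativity of `Δ` is
proved only for right factors in degree zero or among the generators, and extended by associativity
(`mulComul_assoc`); this is done once for the tensor algebra and once for `gr P`. -/

theorem preservesLimits_tensorLeft (X : C) :
    PreservesLimitsOfSize.{0, 0} (tensorLeft X) :=
  (tensorLeftAdjunction X (HasRightDual.rightDual X)).rightAdjoint_preservesLimits

theorem preservesColimits_tensorLeft (X : C) :
    PreservesColimitsOfSize.{0, 0} (tensorLeft X) :=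
  (tensorLeftAdjunction (HasLeftDual.leftDual X) X).leftAdjoint_preservesColimits

theorem preservesLimits_tensorRight (X : C) :
    PreservesLimitsOfSize.{0, 0} (tensorRight X) :=
  (tensorRightAdjunction (HasLeftDual.leftDual X) X).rightAdjoint_preservesLimits

theorem preservesColimits_tensorRight (X : C) :
    PreservesColimitsOfSize.{0, 0} (tensorRight X) :=
  (tensorRightAdjunction X (HasRightDual.rightDual X)).leftAdjoint_preservesColimits

instance whiskerLeft_mono (X : C) {A B : C} (f : A ⟶ B) [Mono f] : Mono (X ◁ f) :=
  have := preservesLimits_tensorLeft X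
  inferInstanceAs (Mono ((tensorLeft X).map f))

instance whiskerLeft_epi (X : C) {A B : C} (f : A ⟶ B) [Epi f] : Epi (X ◁ f) :=
  have := preservesColimits_tensorLeft X
  inferInstanceAs (Epi ((tensorLeft X).map f))

instance whiskerRight_mono (X : C) {A B : C} (f : A ⟶ B) [Mono f] : Mono (f ▷ X) :=
  have := preservesLimits_tensorRight X
  inferInstanceAs (Mono ((tensorRight X).map f))

instance whiskerRight_epi (X : C) {A B : C} (f : A ⟶ B) [Epi f] : Epi (f ▷ X) :=
  have := preservesColimits_tensorRight X
  inferInstanceAs (Epi ((tensorRight X).map f))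

instance tensorHom_mono {A B A' B' : C} (f : A ⟶ B) (g : A' ⟶ B') [Mono f] [Mono g] :
    Mono (f ⊗ₘ g) := by
  rw [MonoidalCategory.tensorHom_def]; infer_instance

instance tensorHom_epi {A B A' B' : C} (f : A ⟶ B) (g : A' ⟶ B') [Epi f] [Epi g] :
    Epi (f ⊗ₘ g) := by
  rw [MonoidalCategory.tensorHom_def]; infer_instance

/-- Testing the vanishing of a map out of `M ⊗ A` after precomposition with `M ◁ x` amounts to
testing the vanishing of a map out of `A`. -/
theorem exists_whiskerLeft_test [MonoidalPreadditive C] {M A D : C} (h : M ⊗ A ⟶ D) :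
    ∃ (D' : C) (h' : A ⟶ D'), ∀ {E : C} (x : E ⟶ A), M ◁ x ≫ h = 0 ↔ x ≫ h' = 0 := by
  refine ⟨HasLeftDual.leftDual M ⊗ D, tensorLeftHomEquiv _ (HasLeftDual.leftDual M) M _ h, fun x => ?_⟩
  have h0 : ∀ E : C, (tensorLeftHomEquiv E (HasLeftDual.leftDual M) M D).symm 0 = 0 := fun E => by
    simp [tensorLeftHomEquiv]
  have h1 := tensorLeftHomEquiv_symm_naturality (Y := HasLeftDual.leftDual M) (Y' := M) x (tensorLeftHomEquiv _ (HasLeftDual.leftDual M) M _ h)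
  rw [Equiv.symm_apply_apply] at h1
  rw [← h1, ← h0, Equiv.apply_eq_iff_eq]

theorem exists_whiskerRight_test [MonoidalPreadditive C] {M A D : C} (h : A ⊗ M ⟶ D) :
    ∃ (D' : C) (h' : A ⟶ D'), ∀ {E : C} (x : E ⟶ A), x ▷ M ≫ h = 0 ↔ x ≫ h' = 0 := by
  refine ⟨D ⊗ (HasRightDual.rightDual M), tensorRightHomEquiv _ M (HasRightDual.rightDual M) _ h, fun x => ?_⟩
  have h0 : ∀ E : C, (tensorRightHomEquiv E M (HasRightDual.rightDual M) D).symm 0 = 0 := fun E => by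
    simp [tensorRightHomEquiv]
  have h1 := tensorRightHomEquiv_symm_naturality (Y := M) (Y' := HasRightDual.rightDual M) x (tensorRightHomEquiv _ M (HasRightDual.rightDual M) _ h)
  rw [Equiv.symm_apply_apply] at h1
  rw [← h1, ← h0, Equiv.apply_eq_iff_eq]

end RigidExact

/-! ### Descent and lifting along tensor products of maps -/

section AbelianLemmas

variable {C : Type u} [Category.{v} C] [Abelian C]

/-- Diagonal filling of a square with an epimorphism on the left and a monomorphism on the
right. -/
theorem exists_diagonal {A B D E : C} (e : A ⟶ B) (m : D ⟶ E) [Epi e] [Mono m] (x : A ⟶ D)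
    (y : B ⟶ E) (h : x ≫ m = e ≫ y) : ∃ l : B ⟶ D, e ≫ l = x ∧ l ≫ m = y :=
  have sq : CommSq x e m y := ⟨h⟩
  have := strongEpi_of_epi e
  ⟨sq.lift, sq.fac_left, sq.fac_right⟩

/-- A map out of a subobject extends to the ambient object after enlarging its target. -/
theorem exists_extension {A B D : C} (a : A ⟶ B) [Mono a] (h : A ⟶ D) :
    ∃ (D' : C) (z : D ⟶ D') (h' : B ⟶ D'), Mono z ∧ h ≫ z = a ≫ h' :=
  ⟨pushout h a, pushout.inl _ _, pushout.inr _ _, inferInstance, pushout.condition⟩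

theorem exists_desc_of_exact {A B D E : C} (i : E ⟶ A) (q : A ⟶ B) [Epi q] (w : i ≫ q = 0)
    (hex : (ShortComplex.mk i q w).Exact) (h : A ⟶ D) (hk : i ≫ h = 0) :
    ∃ h' : B ⟶ D, q ≫ h' = h :=
  ⟨hex.desc h hk, hex.g_desc h hk⟩

variable [MonoidalCategory C] [RigidCategory C] [MonoidalPreadditive C]

/-- Descent along a tensor product of two epimorphisms. -/
theorem exists_desc_tensor {A B A' B' D K K' : C} (q : A ⟶ B) (q' : A' ⟶ B') [Epi q] [Epi q']
    (i : K ⟶ A) (i' : K' ⟶ A')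
    (hd : ∀ {D : C} (h : A ⟶ D), i ≫ h = 0 → ∃ h', q ≫ h' = h)
    (hd' : ∀ {D : C} (h : A' ⟶ D), i' ≫ h = 0 → ∃ h', q' ≫ h' = h)
    (h : A ⊗ A' ⟶ D) (h1 : i ▷ A' ≫ h = 0) (h2 : A ◁ i' ≫ h = 0) :
    ∃ h' : B ⊗ B' ⟶ D, (q ⊗ₘ q') ≫ h' = h := by
  -- One factor at a time: transposing `A'` to the target turns vanishing on `i ▷ A'` into vanishing
  -- on `i`, so `hd` applies.
  obtain ⟨h3, h3h⟩ : ∃ h3 : B ⊗ A' ⟶ D, q ▷ A' ≫ h3 = h := by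
    obtain ⟨g, hg⟩ := hd (tensorRightHomEquiv A A' (HasRightDual.rightDual A') D h) (by
      have := tensorRightHomEquiv_symm_naturality (Y := A')
        (Y' := HasRightDual.rightDual A') i (tensorRightHomEquiv _ A' (HasRightDual.rightDual A') _ h)
      rw [Equiv.symm_apply_apply, h1, Equiv.symm_apply_eq] at this
      rw [this]
      simp [tensorRightHomEquiv])
    refine ⟨(tensorRightHomEquiv _ _ _ _).symm g, ?_⟩
    rw [← tensorRightHomEquiv_symm_naturality, hg, Equiv.symm_apply_apply]
  have h4 : B ◁ i' ≫ h3 = 0 := by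
    rw [← cancel_epi (q ▷ _), ← whisker_exchange_assoc, h3h, h2, comp_zero]
  obtain ⟨g, hg⟩ := hd' (tensorLeftHomEquiv A' (HasLeftDual.leftDual B) B D h3) (by
    have := tensorLeftHomEquiv_symm_naturality (Y := HasLeftDual.leftDual B)
      (Y' := B) i' (tensorLeftHomEquiv _ (HasLeftDual.leftDual B) B _ h3)
    rw [Equiv.symm_apply_apply, h4, Equiv.symm_apply_eq] at this
    rw [this]
    simp [tensorLeftHomEquiv])
  refine ⟨(tensorLeftHomEquiv _ _ _ _).symm g, ?_⟩
  rw [MonoidalCategory.tensorHom_def, Category.assoc, ← tensorLeftHomEquiv_symm_naturality, hg,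
    Equiv.symm_apply_apply, h3h]

/-- A map into `Q ⊗ Q'` that dies in `S ⊗ Q'` and in `Q ⊗ S'` comes from the tensor product of
the kernels of `Q ⟶ S` and `Q' ⟶ S'`. -/
theorem exists_lift_tensor {E G Q S G' Q' S' : C} (i : G ⟶ Q) (r : Q ⟶ S) (i' : G' ⟶ Q')
    (r' : Q' ⟶ S') [Mono i] [Mono i']
    (hl : ∀ {E : C} (h : E ⟶ Q), h ≫ r = 0 → ∃ h', h' ≫ i = h)
    (hl' : ∀ {E : C} (h : E ⟶ Q'), h ≫ r' = 0 → ∃ h', h' ≫ i' = h)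
    (h : E ⟶ Q ⊗ Q') (h1 : h ≫ r ▷ Q' = 0) (h2 : h ≫ Q ◁ r' = 0) :
    ∃ h' : E ⟶ G ⊗ G', h' ≫ (i ⊗ₘ i') = h := by
  obtain ⟨h3, h3h⟩ : ∃ h3 : E ⟶ G ⊗ Q', h3 ≫ i ▷ Q' = h := by
    obtain ⟨g, hg⟩ := hl ((tensorRightHomEquiv E (HasLeftDual.leftDual Q') Q' Q).symm h) (by
      have := tensorRightHomEquiv_naturality (X := E) (Y := HasLeftDual.leftDual Q') (Y' := Q')
        ((tensorRightHomEquiv E (HasLeftDual.leftDual Q') Q' Q).symm h) r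
      rw [Equiv.apply_symm_apply, h1, ← Equiv.eq_symm_apply] at this
      rw [this]
      simp [tensorRightHomEquiv])
    refine ⟨tensorRightHomEquiv _ _ _ _ g, ?_⟩
    rw [← tensorRightHomEquiv_naturality, hg, Equiv.apply_symm_apply]
  -- The second condition concerns `Q ⊗ Q'`; it passes to `G ⊗ Q'` because `i ▷ _` is mono.
  have h4 : h3 ≫ G ◁ r' = 0 := by
    rw [← cancel_mono (i ▷ _), Category.assoc, whisker_exchange, reassoc_of% h3h, h2, zero_comp]
  obtain ⟨g, hg⟩ := hl' ((tensorLeftHomEquiv E G (HasRightDual.rightDual G) Q').symm h3) (by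
    have := tensorLeftHomEquiv_naturality (X := E) (Y := G) (Y' := HasRightDual.rightDual G)
      ((tensorLeftHomEquiv E G (HasRightDual.rightDual G) Q').symm h3) r'
    rw [Equiv.apply_symm_apply, h4, ← Equiv.eq_symm_apply] at this
    rw [this]
    simp [tensorLeftHomEquiv])
  refine ⟨tensorLeftHomEquiv _ _ _ _ g, ?_⟩
  rw [MonoidalCategory.tensorHom_def', ← Category.assoc, ← tensorLeftHomEquiv_naturality, hg,
    Equiv.apply_symm_apply, h3h]

end AbelianLemmas

section MonoidalPreadditive

variable {C : Type u} [Category.{v} C] [Preadditive C] [MonoidalCategory C] [MonoidalPreadditive C]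

theorem whiskerLeft_zsmul (X : C) {A B : C} (n : ℤ) (f : A ⟶ B) : X ◁ (n • f) = n • X ◁ f :=
  (tensorLeft X).map_zsmul

theorem zsmul_whiskerRight (X : C) {A B : C} (n : ℤ) (f : A ⟶ B) : (n • f) ▷ X = n • f ▷ X :=
  (tensorRight X).map_zsmul

end MonoidalPreadditive

/-! ### Graded algebras and coalgebras, and their transfer along epimorphisms and monomorphisms -/

namespace GradedBialgData

variable {C : Type u} [Category.{v} C] [Abelian C] [MonoidalCategory C] [MonoidalPreadditive C]
variable {ι : Type} [AddCommMonoid ι] {A B : ι → C}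

/-- The axioms of a graded algebra. -/
structure IsAlg (H : GradedBialgData A) : Prop where
  mul_deg : ∀ i j k, i + j ≠ k → H.mul i j k = 0
  one_deg : ∀ i, i ≠ 0 → H.one i = 0
  mul_assoc : ∀ i j k n, H.mul i j (i + j) ▷ A k ≫ H.mul (i + j) k n =
    (α_ _ _ _).hom ≫ A i ◁ H.mul j k (j + k) ≫ H.mul i (j + k) n
  one_mul : ∀ i, H.one 0 ▷ A i ≫ H.mul 0 i i = (λ_ (A i)).hom
  mul_one : ∀ i, A i ◁ H.one 0 ≫ H.mul i 0 i = (ρ_ (A i)).hom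

/-- The axioms of a graded coalgebra. -/
structure IsCoalg (H : GradedBialgData A) : Prop where
  comul_deg : ∀ k i j, i + j ≠ k → H.comul k i j = 0
  counit_deg : ∀ i, i ≠ 0 → H.counit i = 0
  comul_assoc : ∀ n i j k, H.comul n (i + j) k ≫ H.comul (i + j) i j ▷ A k ≫ (α_ _ _ _).hom =
    H.comul n i (j + k) ≫ A i ◁ H.comul (j + k) j k
  counit_comul : ∀ i, H.comul i 0 i ≫ H.counit 0 ▷ A i = (λ_ (A i)).inv
  comul_counit : ∀ i, H.comul i i 0 ≫ A i ◁ H.counit 0 = (ρ_ (A i)).inv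

variable {H : GradedBialgData A} {K : GradedBialgData B}

/-- The degrees of partial products are variables tied by equations, so the law applies to degrees
that are equal without being definitionally so. -/
theorem IsAlg.assoc (h : H.IsAlg) {i j k a b n : ι} (ha : i + j = a) (hb : j + k = b) :
    H.mul i j a ▷ A k ≫ H.mul a k n = (α_ _ _ _).hom ≫ A i ◁ H.mul j k b ≫ H.mul i b n := by
  subst ha hb
  exact h.mul_assoc i j k n

theorem IsAlg.assoc_inv (h : H.IsAlg) {i j k a b n : ι} (ha : i + j = a) (hb : j + k = b) :
    A i ◁ H.mul j k b ≫ H.mul i b n = (α_ _ _ _).inv ≫ H.mul i j a ▷ A k ≫ H.mul a k n := by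
  rw [h.assoc ha hb, Iso.inv_hom_id_assoc]

theorem IsCoalg.coassoc (h : H.IsCoalg) {i j k a b n : ι} (ha : i + j = a) (hb : j + k = b) :
    H.comul n a k ≫ H.comul a i j ▷ A k ≫ (α_ _ _ _).hom =
      H.comul n i b ≫ A i ◁ H.comul b j k := by
  subst ha hb
  exact h.comul_assoc n i j k

section Transfer

variable [RigidCategory C]

/-- Each axiom for `K` may be tested after a tensor product of maps `q i`, still epi by rigidity,
where it becomes the axiom for `H`. The three companion lemmas use the same cancellation, on the
other side for monomorphisms. -/
theorem IsAlg.of_epi (h : H.IsAlg) (q : ∀ i, A i ⟶ B i) [∀ i, Epi (q i)]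
    (hmul : ∀ i j k, H.mul i j k ≫ q k = (q i ⊗ₘ q j) ≫ K.mul i j k)
    (hone : ∀ i, H.one i ≫ q i = K.one i) : K.IsAlg where
  mul_deg i j k hk := by
    rw [← cancel_epi (q i ⊗ₘ q j), ← hmul, h.mul_deg _ _ _ hk, zero_comp, comp_zero]
  one_deg i hi := by rw [← hone, h.one_deg _ hi, zero_comp]
  mul_assoc i j k n := by
    rw [← cancel_epi ((q i ⊗ₘ q j) ⊗ₘ q k)]
    have h1 : ((q i ⊗ₘ q j) ⊗ₘ q k) ≫ K.mul i j (i + j) ▷ B k ≫ K.mul (i + j) k n =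
        H.mul i j (i + j) ▷ A k ≫ H.mul (i + j) k n ≫ q n := by
      rw [hmul, ← tensorHom_id, ← tensorHom_id, tensorHom_comp_tensorHom_assoc,
        tensorHom_comp_tensorHom_assoc, hmul, Category.id_comp, Category.comp_id]
    have h2 : (q i ⊗ₘ (q j ⊗ₘ q k)) ≫ B i ◁ K.mul j k (j + k) ≫ K.mul i (j + k) n =
        A i ◁ H.mul j k (j + k) ≫ H.mul i (j + k) n ≫ q n := by
      rw [hmul, ← id_tensorHom, ← id_tensorHom, tensorHom_comp_tensorHom_assoc,
        tensorHom_comp_tensorHom_assoc, hmul, Category.id_comp, Category.comp_id]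
    rw [h1, associator_naturality_assoc, h2, reassoc_of% h.mul_assoc i j k n]
  one_mul i := by
    rw [← cancel_epi (𝟙_ C ◁ q i), ← hone 0, comp_whiskerRight, Category.assoc,
      leftUnitor_naturality, ← h.one_mul, Category.assoc, hmul,
      MonoidalCategory.tensorHom_def', Category.assoc, whisker_exchange_assoc]
  mul_one i := by
    rw [← cancel_epi (q i ▷ 𝟙_ C), ← hone 0, whiskerLeft_comp, Category.assoc,
      rightUnitor_naturality, ← h.mul_one, Category.assoc, hmul,
      MonoidalCategory.tensorHom_def, Category.assoc, ← whisker_exchange_assoc]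

theorem IsAlg.of_mono (h : K.IsAlg) (m : ∀ i, A i ⟶ B i) [∀ i, Mono (m i)]
    (hmul : ∀ i j k, H.mul i j k ≫ m k = (m i ⊗ₘ m j) ≫ K.mul i j k)
    (hone : ∀ i, H.one i ≫ m i = K.one i) : H.IsAlg where
  mul_deg i j k hk := by
    rw [← cancel_mono (m k), hmul, h.mul_deg _ _ _ hk, zero_comp, comp_zero]
  one_deg i hi := by rw [← cancel_mono (m i), hone, h.one_deg _ hi, zero_comp]
  mul_assoc i j k n := by
    rw [← cancel_mono (m n)]
    have h1 : ((m i ⊗ₘ m j) ⊗ₘ m k) ≫ K.mul i j (i + j) ▷ B k ≫ K.mul (i + j) k n =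
        H.mul i j (i + j) ▷ A k ≫ H.mul (i + j) k n ≫ m n := by
      rw [hmul, ← tensorHom_id, ← tensorHom_id, tensorHom_comp_tensorHom_assoc,
        tensorHom_comp_tensorHom_assoc, hmul, Category.id_comp, Category.comp_id]
    have h2 : (m i ⊗ₘ (m j ⊗ₘ m k)) ≫ B i ◁ K.mul j k (j + k) ≫ K.mul i (j + k) n =
        A i ◁ H.mul j k (j + k) ≫ H.mul i (j + k) n ≫ m n := by
      rw [hmul, ← id_tensorHom, ← id_tensorHom, tensorHom_comp_tensorHom_assoc,
        tensorHom_comp_tensorHom_assoc, hmul, Category.id_comp, Category.comp_id]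
    simp only [Category.assoc]
    rw [← h1, ← h2, h.mul_assoc, associator_naturality_assoc]
  one_mul i := by
    rw [← cancel_mono (m i), Category.assoc, hmul, MonoidalCategory.tensorHom_def,
      Category.assoc, ← comp_whiskerRight_assoc, hone, ← whisker_exchange_assoc, h.one_mul,
      leftUnitor_naturality]
  mul_one i := by
    rw [← cancel_mono (m i), Category.assoc, hmul, MonoidalCategory.tensorHom_def',
      Category.assoc, ← whiskerLeft_comp_assoc, hone, whisker_exchange_assoc, h.mul_one,
      rightUnitor_naturality]

theorem IsCoalg.of_epi (h : H.IsCoalg) (q : ∀ i, A i ⟶ B i) [∀ i, Epi (q i)]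
    (hcomul : ∀ k i j, H.comul k i j ≫ (q i ⊗ₘ q j) = q k ≫ K.comul k i j)
    (hcounit : ∀ i, q i ≫ K.counit i = H.counit i) : K.IsCoalg where
  comul_deg k i j hk := by
    rw [← cancel_epi (q k), ← hcomul, h.comul_deg _ _ _ hk, zero_comp, comp_zero]
  counit_deg i hi := by rw [← cancel_epi (q i), hcounit, h.counit_deg _ hi, comp_zero]
  comul_assoc n i j k := by
    rw [← cancel_epi (q n)]
    have h1 : q n ≫ K.comul n (i + j) k ≫ K.comul (i + j) i j ▷ B k =
        H.comul n (i + j) k ≫ H.comul (i + j) i j ▷ A k ≫ ((q i ⊗ₘ q j) ⊗ₘ q k) := by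
      rw [← reassoc_of% hcomul, ← tensorHom_id, ← tensorHom_id, tensorHom_comp_tensorHom,
        tensorHom_comp_tensorHom, hcomul, Category.id_comp, Category.comp_id]
    have h2 : q n ≫ K.comul n i (j + k) ≫ B i ◁ K.comul (j + k) j k =
        H.comul n i (j + k) ≫ A i ◁ H.comul (j + k) j k ≫ (q i ⊗ₘ (q j ⊗ₘ q k)) := by
      rw [← reassoc_of% hcomul, ← id_tensorHom, ← id_tensorHom, tensorHom_comp_tensorHom,
        tensorHom_comp_tensorHom, hcomul, Category.id_comp, Category.comp_id]
    rw [reassoc_of% h1, h2, associator_naturality, reassoc_of% h.comul_assoc n i j k]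
  counit_comul i := by
    rw [← cancel_epi (q i), ← reassoc_of% hcomul, MonoidalCategory.tensorHom_def',
      Category.assoc, ← comp_whiskerRight, hcounit, whisker_exchange, reassoc_of% h.counit_comul i,
      leftUnitor_inv_naturality]
  comul_counit i := by
    rw [← cancel_epi (q i), ← reassoc_of% hcomul, MonoidalCategory.tensorHom_def,
      Category.assoc, ← whiskerLeft_comp, hcounit, ← whisker_exchange,
      reassoc_of% h.comul_counit i, rightUnitor_inv_naturality]

theorem IsCoalg.of_mono (h : K.IsCoalg) (m : ∀ i, A i ⟶ B i) [∀ i, Mono (m i)]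
    (hcomul : ∀ k i j, H.comul k i j ≫ (m i ⊗ₘ m j) = m k ≫ K.comul k i j)
    (hcounit : ∀ i, m i ≫ K.counit i = H.counit i) : H.IsCoalg where
  comul_deg k i j hk := by
    rw [← cancel_mono (m i ⊗ₘ m j), hcomul, h.comul_deg _ _ _ hk, zero_comp, comp_zero]
  counit_deg i hi := by rw [← hcounit, h.counit_deg _ hi, comp_zero]
  comul_assoc n i j k := by
    rw [← cancel_mono (m i ⊗ₘ (m j ⊗ₘ m k))]
    have h1 : m n ≫ K.comul n (i + j) k ≫ K.comul (i + j) i j ▷ B k =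
        H.comul n (i + j) k ≫ H.comul (i + j) i j ▷ A k ≫ ((m i ⊗ₘ m j) ⊗ₘ m k) := by
      rw [← reassoc_of% hcomul, ← tensorHom_id, ← tensorHom_id, tensorHom_comp_tensorHom,
        tensorHom_comp_tensorHom, hcomul, Category.id_comp, Category.comp_id]
    have h2 : m n ≫ K.comul n i (j + k) ≫ B i ◁ K.comul (j + k) j k =
        H.comul n i (j + k) ≫ A i ◁ H.comul (j + k) j k ≫ (m i ⊗ₘ (m j ⊗ₘ m k)) := by
      rw [← reassoc_of% hcomul, ← id_tensorHom, ← id_tensorHom, tensorHom_comp_tensorHom,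
        tensorHom_comp_tensorHom, hcomul, Category.id_comp, Category.comp_id]
    simp only [Category.assoc]
    rw [← h2, ← h.comul_assoc, ← associator_naturality, reassoc_of% h1]
  counit_comul i := by
    rw [← cancel_mono (𝟙_ C ◁ m i), Category.assoc, ← whisker_exchange, ← hcounit 0,
      comp_whiskerRight, ← leftUnitor_inv_naturality, ← h.counit_comul, ← reassoc_of% hcomul,
      MonoidalCategory.tensorHom_def', Category.assoc, whisker_exchange_assoc]
  comul_counit i := by
    rw [← cancel_mono (m i ▷ 𝟙_ C), Category.assoc, whisker_exchange, ← hcounit 0,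
      whiskerLeft_comp, ← rightUnitor_inv_naturality, ← h.comul_counit, ← reassoc_of% hcomul,
      MonoidalCategory.tensorHom_def, Category.assoc, ← whisker_exchange_assoc]

end Transfer

end GradedBialgData

/-! ### The interchange of four factors when some are units -/

section TensorMu

variable {C : Type u} [Category.{v} C] [MonoidalCategory C] [BraidedCategory C]

/-- Used to multiply a coproduct by `x ⊗ 1`: the interchange swaps only the two middle factors, so a
single braiding is left. For `1 ⊗ x` nothing is left to braid, as in `tensorμ_unit_left`. -/
theorem tensorμ_unit_right (X₁ X₂ Y : C) :
    (X₁ ⊗ X₂) ◁ (ρ_ Y).inv ≫ tensorμ X₁ X₂ Y (𝟙_ C) ≫ (X₁ ⊗ Y) ◁ (ρ_ X₂).hom =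
      (α_ X₁ X₂ Y).hom ≫ X₁ ◁ (β_ X₂ Y).hom ≫ (α_ X₁ Y X₂).inv := by
  simp only [tensorμ]
  monoidal

theorem tensorμ_unit_left (X₁ X₂ Y : C) :
    (X₁ ⊗ X₂) ◁ (λ_ Y).inv ≫ tensorμ X₁ X₂ (𝟙_ C) Y ≫ (ρ_ X₁).hom ▷ (X₂ ⊗ Y) =
      (α_ X₁ X₂ Y).hom := by
  simp only [tensorμ, braiding_tensorUnit_right]
  monoidal

theorem tensorμ_unit_unit (X₁ X₂ : C) :
    (X₁ ⊗ X₂) ◁ (λ_ (𝟙_ C)).inv ≫ tensorμ X₁ X₂ (𝟙_ C) (𝟙_ C) ≫ ((ρ_ X₁).hom ⊗ₘ (ρ_ X₂).hom) =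
      (ρ_ (X₁ ⊗ X₂)).hom := by
  simp only [tensorμ, braiding_tensorUnit_right]
  monoidal

end TensorMu

/-! ### Multiplicativity of the coproduct and associativity -/

namespace GradedBialgData

variable {C : Type u} [Category.{v} C] [Abelian C] [MonoidalCategory C] [MonoidalPreadditive C]
  [BraidedCategory C]
variable {ι : Type} [AddCommMonoid ι] {A B : ι → C}

/-- The product of homogeneous components of two tensors in `A ⊗ A`, with signs. -/
def pairMul (ε : ℤ) (deg : ι → ℕ) (H : GradedBialgData A) (i i' j j' k k' : ι) :
    (A i ⊗ A i') ⊗ (A j ⊗ A j') ⟶ A k ⊗ A k' :=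
  (ε ^ (deg i' * deg j)) • (tensorμ _ _ _ _ ≫ (H.mul i j k ⊗ₘ H.mul i' j' k'))

/-- Compatibility of the comultiplication with the products of elements of degrees `i`, `j`. -/
def MulComul [Finset.HasAntidiagonal ι] (ε : ℤ) (deg : ι → ℕ) (H : GradedBialgData A)
    (i j n : ι) : Prop :=
  ∀ k l, H.mul i j n ≫ H.comul n k l =
    ∑ p ∈ Finset.HasAntidiagonal.antidiagonal i, ∑ q ∈ Finset.HasAntidiagonal.antidiagonal j,
      (H.comul i p.1 p.2 ⊗ₘ H.comul j q.1 q.2) ≫ H.pairMul ε deg p.1 p.2 q.1 q.2 k l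

/-- The axioms of a graded bialgebra, with the sign rule given by `ε` and `deg`. -/
structure IsBialg [Finset.HasAntidiagonal ι] (ε : ℤ) (deg : ι → ℕ) (H : GradedBialgData A) :
    Prop extends H.IsAlg, H.IsCoalg where
  mul_comul : ∀ i j n, i + j = n → H.MulComul ε deg i j n
  one_comul : H.one 0 ≫ H.comul 0 0 0 = (λ_ (𝟙_ C)).inv ≫ (H.one 0 ⊗ₘ H.one 0)
  mul_counit : H.mul 0 0 0 ≫ H.counit 0 = (H.counit 0 ⊗ₘ H.counit 0) ≫ (λ_ (𝟙_ C)).hom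
  one_counit : H.one 0 ≫ H.counit 0 = 𝟙 _

variable {ε : ℤ} {deg : ι → ℕ} {H : GradedBialgData A} {K : GradedBialgData B}

theorem IsAlg.pairMul_eq_zero (h : H.IsAlg) {i i' j j' k k' : ι} (hk : i + j ≠ k ∨ i' + j' ≠ k') :
    H.pairMul ε deg i i' j j' k k' = 0 := by
  rcases hk with hk | hk <;> simp [pairMul, h.mul_deg _ _ _ hk]

/-- This is associativity of `A ⊗ A` with the sign rule. In both bracketings the exponent of `ε` is
`deg i' deg j + deg i' deg k + deg j' deg k`, by additivity of `deg`; the rest is coherence of the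
interchange. -/
theorem IsAlg.pairMul_assoc (h : H.IsAlg) (hdeg : ∀ i j, deg (i + j) = deg i + deg j)
    {i i' j j' k k' a a' b b' u u' : ι} (ha : i + j = a) (ha' : i' + j' = a') (hb : j + k = b)
    (hb' : j' + k' = b') :
    H.pairMul ε deg i i' j j' a a' ▷ (A k ⊗ A k') ≫ H.pairMul ε deg a a' k k' u u' =
      (α_ _ _ _).hom ≫ (A i ⊗ A i') ◁ H.pairMul ε deg j j' k k' b b' ≫
        H.pairMul ε deg i i' b b' u u' := by
  have hs : ε ^ (deg a' * deg k) * ε ^ (deg i' * deg j) =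
      ε ^ (deg i' * deg b) * ε ^ (deg j' * deg k) := by
    rw [← ha', ← hb, hdeg, hdeg]; ring
  have h1 : (tensorμ (A i) (A i') (A j) (A j') ≫ (H.mul i j a ⊗ₘ H.mul i' j' a')) ▷ (A k ⊗ A k') ≫
        tensorμ (A a) (A a') (A k) (A k') ≫ (H.mul a k u ⊗ₘ H.mul a' k' u') =
      tensorμ (A i) (A i') (A j) (A j') ▷ (A k ⊗ A k') ≫ tensorμ _ _ _ _ ≫
        ((H.mul i j a ▷ A k ≫ H.mul a k u) ⊗ₘ (H.mul i' j' a' ▷ A k' ≫ H.mul a' k' u')) := by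
    rw [comp_whiskerRight, Category.assoc, tensorμ_natural_left_assoc, tensorHom_comp_tensorHom]
  have h2 : (A i ⊗ A i') ◁ (tensorμ (A j) (A j') (A k) (A k') ≫ (H.mul j k b ⊗ₘ H.mul j' k' b')) ≫
        tensorμ (A i) (A i') (A b) (A b') ≫ (H.mul i b u ⊗ₘ H.mul i' b' u') =
      (A i ⊗ A i') ◁ tensorμ (A j) (A j') (A k) (A k') ≫ tensorμ _ _ _ _ ≫
        ((A i ◁ H.mul j k b ≫ H.mul i b u) ⊗ₘ (A i' ◁ H.mul j' k' b' ≫ H.mul i' b' u')) := by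
    rw [whiskerLeft_comp, Category.assoc, tensorμ_natural_right_assoc, tensorHom_comp_tensorHom]
  simp only [pairMul, zsmul_whiskerRight, whiskerLeft_zsmul, Preadditive.comp_zsmul,
    Preadditive.zsmul_comp, smul_smul, h1, h2]
  rw [h.assoc ha hb, h.assoc ha' hb', ← tensorHom_comp_tensorHom, ← reassoc_of% tensor_associativity,
    hs]

variable [Finset.HasAntidiagonal ι]

theorem mem_antidiagonal_add {i j : ι} {p q : ι × ι}
    (hp : p ∈ Finset.HasAntidiagonal.antidiagonal i)
    (hq : q ∈ Finset.HasAntidiagonal.antidiagonal j) : (p.1 + q.1) + (p.2 + q.2) = i + j := by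
  rw [Finset.HasAntidiagonal.mem_antidiagonal] at hp hq
  rw [← hp, ← hq, add_add_add_comm]

/-- If the comultiplication is compatible with products in three of the four cases of the
associativity law, it is so in the fourth, on products. -/
theorem IsAlg.mulComul_assoc (h : H.IsAlg) (hdeg : ∀ i j, deg (i + j) = deg i + deg j)
    {i j k m w n : ι} (hm : i + j = m) (hw : j + k = w)
    (h1 : H.MulComul ε deg i j m) (h2 : H.MulComul ε deg m k n) (h3 : H.MulComul ε deg j k w)
    (u v : ι) :
    A i ◁ H.mul j k w ≫ H.mul i w n ≫ H.comul n u v = A i ◁ H.mul j k w ≫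
      ∑ p ∈ Finset.HasAntidiagonal.antidiagonal i, ∑ r ∈ Finset.HasAntidiagonal.antidiagonal w,
        (H.comul i p.1 p.2 ⊗ₘ H.comul w r.1 r.2) ≫ H.pairMul ε deg p.1 p.2 r.1 r.2 u v := by
  have hL : A i ◁ H.mul j k w ≫ H.mul i w n ≫ H.comul n u v = (α_ _ _ _).inv ≫
      ∑ s ∈ Finset.HasAntidiagonal.antidiagonal k, ∑ p ∈ Finset.HasAntidiagonal.antidiagonal i,
        ∑ q ∈ Finset.HasAntidiagonal.antidiagonal j,
        ((H.comul i p.1 p.2 ⊗ₘ H.comul j q.1 q.2) ⊗ₘ H.comul k s.1 s.2) ≫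
          H.pairMul ε deg p.1 p.2 q.1 q.2 (p.1 + q.1) (p.2 + q.2) ▷ _ ≫
          H.pairMul ε deg (p.1 + q.1) (p.2 + q.2) s.1 s.2 u v := by
    rw [← Category.assoc, h.assoc_inv hm hw]
    simp only [Category.assoc]
    rw [h2 u v]
    simp only [Preadditive.comp_sum]
    rw [Finset.sum_comm]
    refine Finset.sum_congr rfl fun s _ => ?_
    have : ∀ r : ι × ι, H.mul i j m ▷ A k ≫ (H.comul m r.1 r.2 ⊗ₘ H.comul k s.1 s.2) ≫
        H.pairMul ε deg r.1 r.2 s.1 s.2 u v =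
        ∑ p ∈ Finset.HasAntidiagonal.antidiagonal i, ∑ q ∈ Finset.HasAntidiagonal.antidiagonal j,
        ((H.comul i p.1 p.2 ⊗ₘ H.comul j q.1 q.2) ⊗ₘ H.comul k s.1 s.2) ≫
          H.pairMul ε deg p.1 p.2 q.1 q.2 r.1 r.2 ▷ _ ≫
          H.pairMul ε deg r.1 r.2 s.1 s.2 u v := by
      intro r
      rw [← tensorHom_id, tensorHom_comp_tensorHom_assoc, h1 r.1 r.2]
      simp only [sum_tensor, Preadditive.sum_comp, Category.id_comp]
      refine Finset.sum_congr rfl fun p _ => Finset.sum_congr rfl fun q _ => ?_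
      rw [← tensorHom_id, tensorHom_comp_tensorHom_assoc, Category.comp_id]
    simp only [this, Preadditive.comp_sum]
    rw [Finset.sum_comm]
    refine Finset.sum_congr rfl fun p hp => ?_
    rw [Finset.sum_comm]
    refine Finset.sum_congr rfl fun q hq => ?_
    -- The intermediate bidegree `r` is forced: for any other `r` the first product vanishes.
    rw [Finset.sum_eq_single (p.1 + q.1, p.2 + q.2)]
    · intro r _ hr
      rw [h.pairMul_eq_zero (i := p.1) (i' := p.2) (j := q.1) (j' := q.2)]
      · simp
      · by_contra! hc
        exact hr (Prod.ext hc.1.symm hc.2.symm)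
    · intro hr
      rw [Finset.HasAntidiagonal.mem_antidiagonal] at hr
      exact absurd ((mem_antidiagonal_add hp hq).trans hm) hr
  rw [hL]
  simp only [Preadditive.comp_sum]
  rw [Finset.sum_comm]
  refine Finset.sum_congr rfl fun p hp => ?_
  have : ∀ r : ι × ι, A i ◁ H.mul j k w ≫ (H.comul i p.1 p.2 ⊗ₘ H.comul w r.1 r.2) ≫
      H.pairMul ε deg p.1 p.2 r.1 r.2 u v =
      ∑ q ∈ Finset.HasAntidiagonal.antidiagonal j, ∑ s ∈ Finset.HasAntidiagonal.antidiagonal k,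
        (H.comul i p.1 p.2 ⊗ₘ (H.comul j q.1 q.2 ⊗ₘ H.comul k s.1 s.2)) ≫
          _ ◁ H.pairMul ε deg q.1 q.2 s.1 s.2 r.1 r.2 ≫
          H.pairMul ε deg p.1 p.2 r.1 r.2 u v := by
    intro r
    rw [← id_tensorHom, tensorHom_comp_tensorHom_assoc, h3 r.1 r.2]
    simp only [tensor_sum, Preadditive.sum_comp, Category.id_comp]
    refine Finset.sum_congr rfl fun q _ => Finset.sum_congr rfl fun s _ => ?_
    rw [← id_tensorHom, tensorHom_comp_tensorHom_assoc, Category.comp_id]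
  simp only [this]
  rw [Finset.sum_comm, Finset.sum_comm (s := Finset.HasAntidiagonal.antidiagonal w)]
  refine Finset.sum_congr rfl fun q hq => ?_
  rw [Finset.sum_comm (s := Finset.HasAntidiagonal.antidiagonal w)]
  refine Finset.sum_congr rfl fun s hs => ?_
  rw [Finset.sum_eq_single (q.1 + s.1, q.2 + s.2)]
  -- Both sides are now sums over the same splittings of `i`, `j`, `k`, and corresponding terms
  -- differ only by the bracketing of a triple product in `A ⊗ A`.
  · rw [h.pairMul_assoc hdeg rfl rfl rfl rfl, ← associator_inv_naturality_assoc,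
      Iso.inv_hom_id_assoc]
  · intro r _ hr
    rw [h.pairMul_eq_zero (i := q.1) (i' := q.2) (j := s.1) (j' := s.2)]
    · simp
    · by_contra! hc
      exact hr (Prod.ext hc.1.symm hc.2.symm)
  · intro hr
    rw [Finset.HasAntidiagonal.mem_antidiagonal] at hr
    exact absurd ((mem_antidiagonal_add hq hs).trans hw) hr

end GradedBialgData

/-! ### Primitive generators, quotients, and the antipode of a connected bialgebra -/

namespace GradedBialgData

variable {C : Type u} [Category.{v} C] [Abelian C] [MonoidalCategory C] [MonoidalPreadditive C]
  [BraidedCategory C]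
variable {ι : Type} [AddCommMonoid ι] {A B : ι → C}
variable {ε : ℤ} {deg : ι → ℕ} {H : GradedBialgData A} {K : GradedBialgData B}

/-- Connectedness makes the counit in degree zero inverse to the unit, so the counit law can be
solved for this component: it is `x ↦ x ⊗ 1`. -/
theorem IsCoalg.comul_right_zero (hc : H.IsCoalg) (hconn : H.counit 0 ≫ H.one 0 = 𝟙 _) (i : ι) :
    H.comul i i 0 = (ρ_ _).inv ≫ A i ◁ H.one 0 := by
  rw [← hc.comul_counit, Category.assoc, ← whiskerLeft_comp, hconn, whiskerLeft_id,
    Category.comp_id]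

theorem IsCoalg.comul_left_zero (hc : H.IsCoalg) (hconn : H.counit 0 ≫ H.one 0 = 𝟙 _) (i : ι) :
    H.comul i 0 i = (λ_ _).inv ≫ H.one 0 ▷ A i := by
  rw [← hc.counit_comul, Category.assoc, ← comp_whiskerRight, hconn, id_whiskerRight,
    Category.comp_id]

/-- The summand `w' x ⊗ w''` of the comultiplication of `w x`, for a primitive `x`. -/
def leftTerm (ε : ℤ) (deg : ι → ℕ) (H : GradedBialgData A) (i e p k l : ι) :
    A i ⊗ A e ⟶ A k ⊗ A l :=
  (ε ^ (deg l * deg e)) • (H.comul i p l ▷ A e ≫ (α_ _ _ _).hom ≫ A p ◁ (β_ (A l) (A e)).hom ≫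
    (α_ _ _ _).inv ≫ H.mul p e k ▷ A l)

/-- The summand `w' ⊗ w'' x` of the comultiplication of `w x`, for a primitive `x`. -/
def rightTerm (H : GradedBialgData A) (i e p k l : ι) : A i ⊗ A e ⟶ A k ⊗ A l :=
  H.comul i k p ▷ A e ≫ (α_ _ _ _).hom ≫ A k ◁ H.mul p e l

theorem IsAlg.comul_one_pairMul_left (h : H.IsAlg) (i e p k l : ι) :
    (H.comul i p l ⊗ₘ ((ρ_ _).inv ≫ A e ◁ H.one 0)) ≫ H.pairMul ε deg p l e 0 k l =
      H.leftTerm ε deg i e p k l := by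
  have h1 : (A p ⊗ A l) ◁ ((ρ_ (A e)).inv ≫ A e ◁ H.one 0) ≫ tensorμ (A p) (A l) (A e) (A 0) ≫
      (H.mul p e k ⊗ₘ H.mul l 0 l) = (α_ _ _ _).hom ≫ A p ◁ (β_ (A l) (A e)).hom ≫
    (α_ _ _ _).inv ≫ H.mul p e k ▷ A l := by
    rw [whiskerLeft_comp, Category.assoc, ← id_tensorHom (A e) (H.one 0),
      tensorμ_natural_right_assoc, tensorHom_comp_tensorHom, h.mul_one, whiskerLeft_id,
      Category.id_comp, MonoidalCategory.tensorHom_def']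
    rw [reassoc_of% tensorμ_unit_right]
  rw [pairMul, leftTerm, Preadditive.comp_zsmul, MonoidalCategory.tensorHom_def, Category.assoc,
    h1]

theorem IsAlg.comul_one_pairMul_right (h : H.IsAlg) (i e p k l : ι) (hdeg : deg 0 = 0) :
    (H.comul i k p ⊗ₘ ((λ_ _).inv ≫ H.one 0 ▷ A e)) ≫ H.pairMul ε deg k p 0 e k l =
      H.rightTerm i e p k l := by
  have h1 : (A k ⊗ A p) ◁ ((λ_ (A e)).inv ≫ H.one 0 ▷ A e) ≫ tensorμ (A k) (A p) (A 0) (A e) ≫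
      (H.mul k 0 k ⊗ₘ H.mul p e l) = (α_ _ _ _).hom ≫ A k ◁ H.mul p e l := by
    rw [whiskerLeft_comp, Category.assoc, ← tensorHom_id (H.one 0) (A e),
      tensorμ_natural_right_assoc, tensorHom_comp_tensorHom, h.mul_one, whiskerLeft_id,
      Category.id_comp, MonoidalCategory.tensorHom_def]
    rw [reassoc_of% tensorμ_unit_left]
  rw [pairMul, rightTerm, hdeg, mul_zero, pow_zero, one_smul, MonoidalCategory.tensorHom_def,
    Category.assoc, h1]

variable [Finset.HasAntidiagonal ι]

/-- By `hAD` the degree `e` has no proper splitting, so `Δ x = x ⊗ 1 + 1 ⊗ x` for `x` of degree `e`.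
The two summands multiply `Δ w` into the left and right terms. -/
theorem IsAlg.sum_pairMul_of_primitive [IsCancelAdd ι] (h : H.IsAlg) (hc : H.IsCoalg)
    (hconn : H.counit 0 ≫ H.one 0 = 𝟙 _) (hdeg : deg 0 = 0) {e : ι} (he : e ≠ 0)
    (hAD : ∀ q, q ∈ Finset.HasAntidiagonal.antidiagonal e ↔ q = (e, 0) ∨ q = (0, e)) (i k l : ι) :
    ∑ p ∈ Finset.HasAntidiagonal.antidiagonal i, ∑ q ∈ Finset.HasAntidiagonal.antidiagonal e,
      (H.comul i p.1 p.2 ⊗ₘ H.comul e q.1 q.2) ≫ H.pairMul ε deg p.1 p.2 q.1 q.2 k l =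
      ∑ p ∈ Finset.HasAntidiagonal.antidiagonal i, H.leftTerm ε deg i e p.1 k l +
      ∑ p ∈ Finset.HasAntidiagonal.antidiagonal i, H.rightTerm i e p.2 k l := by
  classical
  have hAD' : Finset.HasAntidiagonal.antidiagonal e = {(e, 0), (0, e)} := by
    ext q; rw [hAD]; simp
  rw [← Finset.sum_add_distrib, hAD']
  refine Finset.sum_congr rfl fun p hp => ?_
  rw [Finset.HasAntidiagonal.mem_antidiagonal] at hp
  rw [Finset.sum_pair (fun h => he (congrArg Prod.fst h)), hc.comul_right_zero hconn,
    hc.comul_left_zero hconn]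
  congr 1
  -- When `p.2 ≠ l`, the product on one side and the coproduct component on the other both have
  -- mismatched degrees, so both terms vanish. Cancellation in `ι` is needed for the second.
  · by_cases hl : p.2 = l
    · subst hl
      rw [h.comul_one_pairMul_left]
    · rw [h.pairMul_eq_zero (Or.inr (by simpa using hl)), leftTerm, hc.comul_deg i p.1 l]
      · simp
      · rw [← hp]; exact fun h => hl (add_left_cancel h).symm
  · by_cases hk : p.1 = k
    · subst hk
      rw [h.comul_one_pairMul_right _ _ _ _ _ hdeg]
    · rw [h.pairMul_eq_zero (Or.inl (by simpa using hk)), rightTerm, hc.comul_deg i k p.2]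
      · simp
      · rw [← hp]; exact fun h => hk (add_right_cancel h).symm

theorem IsAlg.mulComul_of_primitive [IsCancelAdd ι] (h : H.IsAlg) (hc : H.IsCoalg)
    (hconn : H.counit 0 ≫ H.one 0 = 𝟙 _) (hdeg : deg 0 = 0) {e : ι} (he : e ≠ 0)
    (hAD : ∀ q, q ∈ Finset.HasAntidiagonal.antidiagonal e ↔ q = (e, 0) ∨ q = (0, e)) {i n : ι}
    (hd : ∀ k l, H.mul i e n ≫ H.comul n k l =
      ∑ p ∈ Finset.HasAntidiagonal.antidiagonal i, H.leftTerm ε deg i e p.1 k l +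
      ∑ p ∈ Finset.HasAntidiagonal.antidiagonal i, H.rightTerm i e p.2 k l) :
    H.MulComul ε deg i e n := fun k l =>
  (hd k l).trans (h.sum_pairMul_of_primitive hc hconn hdeg he hAD i k l).symm

/-- An epimorphic unit lets the second factor be replaced by `1`, where `Δ 1 = 1 ⊗ 1` gives the
claim. -/
theorem IsAlg.mulComul_zero (h : H.IsAlg) (hc : H.IsCoalg) [Epi (H.one 0)]
    [RigidCategory C]
    (hone : H.one 0 ≫ H.comul 0 0 0 = (λ_ (𝟙_ C)).inv ≫ (H.one 0 ⊗ₘ H.one 0)) (hdeg : deg 0 = 0)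
    (hAD : ∀ q, q ∈ Finset.HasAntidiagonal.antidiagonal (0 : ι) ↔ q = (0, 0)) (i : ι) :
    H.MulComul ε deg i 0 i := by
  classical
  intro k l
  have hAD' : Finset.HasAntidiagonal.antidiagonal (0 : ι) = {(0, 0)} := by
    ext q; rw [hAD]; simp
  rw [hAD', ← cancel_epi (A i ◁ H.one 0), ← Category.assoc, h.mul_one]
  simp only [Finset.sum_singleton]
  have h1 : A i ◁ H.one 0 ≫ (H.comul i k l ⊗ₘ H.comul 0 0 0) ≫ H.pairMul ε deg k l 0 0 k l =
      (ρ_ _).hom ≫ H.comul i k l := by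
    rw [← id_tensorHom, tensorHom_comp_tensorHom_assoc, hone, Category.id_comp, pairMul, hdeg,
      mul_zero, pow_zero, one_smul, MonoidalCategory.tensorHom_def, whiskerLeft_comp,
      Category.assoc, Category.assoc, tensorμ_natural_right_assoc, tensorHom_comp_tensorHom,
      h.mul_one, h.mul_one, tensorμ_unit_unit, rightUnitor_naturality]
  rw [Finset.sum_eq_single (k, l), h1]
  · intro p _ hp
    rw [h.pairMul_eq_zero, comp_zero]
    by_contra! hc
    exact hp (Prod.ext (by simpa using hc.1) (by simpa using hc.2))
  · intro hp
    rw [Finset.HasAntidiagonal.mem_antidiagonal] at hp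
    simp [hc.comul_deg _ _ _ hp]

theorem IsBialg.of_epi [RigidCategory C] (h : H.IsBialg ε deg) (q : ∀ i, A i ⟶ B i)
    [∀ i, Epi (q i)] (hq : H.IsHom K q) : K.IsBialg ε deg where
  __ := h.toIsAlg.of_epi q hq.mul hq.one
  __ := h.toIsCoalg.of_epi q hq.comul hq.counit
  mul_comul i j n hn k l := by
    rw [← cancel_epi (q i ⊗ₘ q j), ← reassoc_of% hq.mul, ← hq.comul,
      reassoc_of% h.mul_comul i j n hn k l]
    simp only [Preadditive.sum_comp, Preadditive.comp_sum]
    refine Finset.sum_congr rfl fun r _ => Finset.sum_congr rfl fun s _ => ?_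
    rw [tensorHom_comp_tensorHom_assoc, ← hq.comul, ← hq.comul, ← tensorHom_comp_tensorHom_assoc]
    simp only [pairMul, Preadditive.comp_zsmul, Preadditive.zsmul_comp, Category.assoc,
      tensorHom_comp_tensorHom, hq.mul, tensorμ_natural_assoc]
  one_comul := by
    rw [← hq.one, Category.assoc, ← hq.comul, reassoc_of% h.one_comul, tensorHom_comp_tensorHom]
  mul_counit := by
    rw [← cancel_epi (q 0 ⊗ₘ q 0), ← reassoc_of% hq.mul, hq.counit, h.mul_counit,
      tensorHom_comp_tensorHom_assoc, hq.counit]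
  one_counit := by rw [← hq.one, Category.assoc, hq.counit, h.one_counit]

section Antipode

/-- The convolution product of two families of endomorphisms. -/
def conv (H : GradedBialgData A) (f g : ∀ i, A i ⟶ A i) (i : ι) : A i ⟶ A i :=
  ∑ p ∈ Finset.HasAntidiagonal.antidiagonal i,
    H.comul i p.1 p.2 ≫ (f p.1 ⊗ₘ g p.2) ≫ H.mul p.1 p.2 i

theorem conv_assoc (h : H.IsAlg) (hc : H.IsCoalg) (f g r : ∀ i, A i ⟶ A i) (i : ι) :
    H.conv (H.conv f g) r i = H.conv f (H.conv g r) i := by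
  have hl : H.conv (H.conv f g) r i = ∑ p ∈ Finset.HasAntidiagonal.antidiagonal i,
      ∑ q ∈ Finset.HasAntidiagonal.antidiagonal p.1, H.comul i p.1 p.2 ≫
        H.comul p.1 q.1 q.2 ▷ A p.2 ≫ ((f q.1 ⊗ₘ g q.2) ⊗ₘ r p.2) ≫
        H.mul q.1 q.2 p.1 ▷ A p.2 ≫ H.mul p.1 p.2 i := by
    refine Finset.sum_congr rfl fun p _ => ?_
    simp only [conv, sum_tensor, Preadditive.sum_comp, Preadditive.comp_sum]
    refine Finset.sum_congr rfl fun q _ => ?_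
    rw [← tensorHom_id, ← tensorHom_id, tensorHom_comp_tensorHom_assoc,
      tensorHom_comp_tensorHom_assoc, Category.comp_id, Category.id_comp, Category.assoc]
  have hr : H.conv f (H.conv g r) i = ∑ p ∈ Finset.HasAntidiagonal.antidiagonal i,
      ∑ q ∈ Finset.HasAntidiagonal.antidiagonal p.2, H.comul i p.1 p.2 ≫
        A p.1 ◁ H.comul p.2 q.1 q.2 ≫ (f p.1 ⊗ₘ (g q.1 ⊗ₘ r q.2)) ≫
        A p.1 ◁ H.mul q.1 q.2 p.2 ≫ H.mul p.1 p.2 i := by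
    refine Finset.sum_congr rfl fun p _ => ?_
    simp only [conv, tensor_sum, Preadditive.sum_comp, Preadditive.comp_sum]
    refine Finset.sum_congr rfl fun q _ => ?_
    rw [← id_tensorHom, ← id_tensorHom, tensorHom_comp_tensorHom_assoc,
      tensorHom_comp_tensorHom_assoc, Category.comp_id, Category.id_comp, Category.assoc]
  rw [hl, hr, Finset.sum_sigma', Finset.sum_sigma']
  -- Both sums run over triples of degrees with sum `i`; the bijection regroups `((c, d), b)` as
  -- `(c, (d, b))`.
  refine Finset.sum_nbij' (fun x => ⟨(x.2.1, x.2.2 + x.1.2), (x.2.2, x.1.2)⟩)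
    (fun x => ⟨(x.1.1 + x.2.1, x.2.2), (x.1.1, x.2.1)⟩) ?_ ?_ ?_ ?_ ?_
  · rintro ⟨⟨a, b⟩, ⟨c, d⟩⟩ hx
    simp only [Finset.mem_sigma, Finset.HasAntidiagonal.mem_antidiagonal] at hx ⊢
    exact ⟨by rw [← add_assoc, hx.2, hx.1], trivial⟩
  · rintro ⟨⟨a, b⟩, ⟨c, d⟩⟩ hx
    simp only [Finset.mem_sigma, Finset.HasAntidiagonal.mem_antidiagonal] at hx ⊢
    exact ⟨by rw [add_assoc, hx.2, hx.1], trivial⟩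
  · rintro ⟨⟨a, b⟩, ⟨c, d⟩⟩ hx
    simp only [Finset.mem_sigma, Finset.HasAntidiagonal.mem_antidiagonal] at hx ⊢
    rw [hx.2]
  · rintro ⟨⟨a, b⟩, ⟨c, d⟩⟩ hx
    simp only [Finset.mem_sigma, Finset.HasAntidiagonal.mem_antidiagonal] at hx ⊢
    rw [hx.2]
  · rintro ⟨⟨a, b⟩, ⟨c, d⟩⟩ hx
    simp only [Finset.mem_sigma, Finset.HasAntidiagonal.mem_antidiagonal] at hx ⊢
    rw [h.assoc hx.2 rfl, associator_naturality_assoc, reassoc_of% hc.coassoc hx.2 rfl]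

theorem conv_unit (h : H.IsAlg) (hc : H.IsCoalg) (f : ∀ i, A i ⟶ A i) (i : ι) :
    H.conv f (fun i => H.counit i ≫ H.one i) i = f i := by
  rw [conv, Finset.sum_eq_single (i, 0)]
  · dsimp only
    rw [MonoidalCategory.tensorHom_def', whiskerLeft_comp]
    simp only [Category.assoc]
    rw [reassoc_of% hc.comul_counit i, whisker_exchange_assoc, h.mul_one,
      rightUnitor_naturality, Iso.inv_hom_id_assoc]
  · intro p hp hpi
    have : p.2 ≠ 0 := fun h0 => hpi (Prod.ext (by
      rw [Finset.HasAntidiagonal.mem_antidiagonal, h0, add_zero] at hp; exact hp) h0)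
    simp [hc.counit_deg _ this]
  · simp

theorem unit_conv (h : H.IsAlg) (hc : H.IsCoalg) (f : ∀ i, A i ⟶ A i) (i : ι) :
    H.conv (fun i => H.counit i ≫ H.one i) f i = f i := by
  rw [conv, Finset.sum_eq_single (0, i)]
  · dsimp only
    rw [MonoidalCategory.tensorHom_def, comp_whiskerRight]
    simp only [Category.assoc]
    rw [reassoc_of% hc.counit_comul i, ← whisker_exchange_assoc, h.one_mul,
      leftUnitor_naturality, Iso.inv_hom_id_assoc]
  · intro p hp hpi
    have : p.1 ≠ 0 := fun h0 => hpi (Prod.ext h0 (by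
      rw [Finset.HasAntidiagonal.mem_antidiagonal, h0, zero_add] at hp; exact hp))
    simp [hc.counit_deg _ this]
  · simp

/-- A left inverse of `f` for the convolution product, if `f 0 = 𝟙`. -/
def convInv (H : GradedBialgData A) (deg : ι → ℕ) (f : ∀ i, A i ⟶ A i) (i : ι) : A i ⟶ A i :=
  H.counit i ≫ H.one i - ∑ p ∈ Finset.HasAntidiagonal.antidiagonal i,
    if deg p.1 < deg i then
      H.comul i p.1 p.2 ≫ (convInv H deg f p.1 ⊗ₘ f p.2) ≫ H.mul p.1 p.2 i else 0
termination_by deg i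

theorem convInv_conv (h : H.IsAlg) (hc : H.IsCoalg) (hconn : H.counit 0 ≫ H.one 0 = 𝟙 _)
    (hdeg : ∀ i j, deg (i + j) = deg i + deg j) (hdeg0 : ∀ i, deg i = 0 → i = 0)
    (f : ∀ i, A i ⟶ A i) (hf : f 0 = 𝟙 _) (i : ι) :
    H.conv (H.convInv deg f) f i = H.counit i ≫ H.one i := by
  classical
  have hi : (i, (0 : ι)) ∈ Finset.HasAntidiagonal.antidiagonal i := by simp
  -- Only the splitting `(i, 0)` fails the guard in `convInv`, because `deg` vanishes only at zero.
  -- That omitted term is `convInv` at `i` itself, as `f 0 = 𝟙`.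
  have hlt : ∀ p ∈ (Finset.HasAntidiagonal.antidiagonal i).erase (i, 0), deg p.1 < deg i := by
    intro p hp
    rw [Finset.mem_erase, Finset.HasAntidiagonal.mem_antidiagonal] at hp
    have h2 : deg p.2 ≠ 0 := fun h0 => hp.1 (Prod.ext (by
      rw [← hp.2, hdeg0 _ h0, add_zero]) (hdeg0 _ h0))
    rw [← hp.2, hdeg]
    omega
  have h1 : H.comul i i 0 ≫ (H.convInv deg f i ⊗ₘ f 0) ≫ H.mul i 0 i = H.convInv deg f i := by
    rw [hf, tensorHom_id, hc.comul_right_zero hconn, Category.assoc, whisker_exchange_assoc,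
      h.mul_one, rightUnitor_naturality, Iso.inv_hom_id_assoc]
  rw [conv, ← Finset.add_sum_erase _ _ hi]
  dsimp only
  rw [h1, convInv, ← Finset.add_sum_erase _ _ hi]
  dsimp only
  rw [if_neg (lt_irrefl _), zero_add, Finset.sum_congr rfl fun p hp => if_pos (hlt p hp),
    sub_add_cancel]

theorem convInv_zero (hconn : H.counit 0 ≫ H.one 0 = 𝟙 _)
    (hdeg0 : deg 0 = 0) (f : ∀ i, A i ⟶ A i) : H.convInv deg f 0 = 𝟙 _ := by
  rw [convInv, Finset.sum_eq_zero, hconn, sub_zero]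
  intro p _
  rw [if_neg (by omega)]

/-- A connected graded bialgebra is a graded Hopf algebra. -/
theorem IsBialg.isHopf (h : H.IsBialg ε deg) (hconn : H.counit 0 ≫ H.one 0 = 𝟙 _)
    (hdeg : ∀ i j, deg (i + j) = deg i + deg j) (hdeg0 : ∀ i, deg i = 0 → i = 0) :
    H.IsHopf ε deg where
  __ := h
  mul_comul i j k l := by
    simpa only [pairMul, Preadditive.comp_zsmul] using h.mul_comul i j _ rfl k l
  antipode := by
    have h00 : deg 0 = 0 := by simpa using hdeg 0 0
    -- Only left inverses are constructed. With `s * id = 1` and `t * s = 1` one gets `t = t * (s *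
    -- id) = (t * s) * id = id`, so `s` is also a right inverse of `id`.
    set s := H.convInv deg fun i => 𝟙 (A i) with hs
    set t := H.convInv deg s with ht
    have hs0 : s 0 = 𝟙 _ := convInv_zero hconn h00 _
    have h1 : H.conv s (fun i => 𝟙 (A i)) = fun i => H.counit i ≫ H.one i :=
      funext fun i => convInv_conv h.toIsAlg h.toIsCoalg hconn hdeg hdeg0 _ rfl i
    have h2 : H.conv t s = fun i => H.counit i ≫ H.one i :=
      funext fun i => convInv_conv h.toIsAlg h.toIsCoalg hconn hdeg hdeg0 _ hs0 i
    have h3 : t = fun i => 𝟙 (A i) := by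
      funext i
      rw [← conv_unit h.toIsAlg h.toIsCoalg t i, ← h1, ← conv_assoc h.toIsAlg h.toIsCoalg, h2,
        unit_conv h.toIsAlg h.toIsCoalg]
    refine ⟨s, fun i => ⟨?_, ?_⟩⟩
    · have := congrFun h1 i
      simpa only [conv, tensorHom_id] using this
    · have := congrFun h2 i
      rw [h3] at this
      simpa only [conv, id_tensorHom] using this

end Antipode

end GradedBialgData

/-! ### Morphisms, images and quotients of graded bialgebras -/

namespace GradedBialgData

variable {C : Type u} [Category.{v} C] [Abelian C] [MonoidalCategory C] [MonoidalPreadditive C]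
variable {ι : Type} [AddCommMonoid ι] {A B D : ι → C}
variable {H : GradedBialgData A} {K : GradedBialgData B} {L : GradedBialgData D}

theorem IsHom.comp {f : ∀ i, A i ⟶ B i} {g : ∀ i, B i ⟶ D i} (hf : H.IsHom K f)
    (hg : K.IsHom L g) : H.IsHom L (fun i => f i ≫ g i) where
  mul i j k := by rw [reassoc_of% hf.mul, hg.mul, tensorHom_comp_tensorHom_assoc]
  comul k i j := by
    rw [← tensorHom_comp_tensorHom, reassoc_of% hf.comul, hg.comul, Category.assoc]
  one i := by rw [reassoc_of% hf.one, hg.one]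
  counit i := by rw [Category.assoc, hg.counit, hf.counit]

theorem IsHom.of_iso {e : ∀ i, A i ≅ B i} (h : K.IsHom H (fun i => (e i).inv)) :
    H.IsHom K (fun i => (e i).hom) where
  mul i j k := by
    rw [← cancel_mono (e k).inv, Category.assoc, Category.assoc, h.mul,
      tensorHom_comp_tensorHom_assoc]
    simp
  comul k i j := by
    rw [← cancel_epi (e k).inv, ← reassoc_of% h.comul, tensorHom_comp_tensorHom]
    simp
  one i := by rw [← h.one]; simp
  counit i := by rw [← h.counit]; simp

variable [RigidCategory C]

theorem IsHom.of_epi {q : ∀ i, A i ⟶ B i} [∀ i, Epi (q i)] {f : ∀ i, B i ⟶ D i}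
    {g : ∀ i, A i ⟶ D i} (hg : H.IsHom L g) (hq : H.IsHom K q) (hfg : ∀ i, q i ≫ f i = g i) :
    K.IsHom L f where
  mul i j k := by
    rw [← cancel_epi (q i ⊗ₘ q j), ← reassoc_of% hq.mul, hfg, hg.mul,
      tensorHom_comp_tensorHom_assoc, hfg, hfg]
  comul k i j := by
    rw [← cancel_epi (q k), ← reassoc_of% hq.comul, tensorHom_comp_tensorHom, hfg, hfg,
      hg.comul, reassoc_of% hfg]
  one i := by rw [← hq.one, Category.assoc, hfg, hg.one]
  counit i := by rw [← cancel_epi (q i), reassoc_of% hfg, hg.counit, hq.counit]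

/-- The image of a morphism of graded bialgebras. -/
theorem IsHom.exists_image {e : ∀ i, A i ⟶ B i} {m : ∀ i, B i ⟶ D i} [∀ i, Epi (e i)]
    [∀ i, Mono (m i)] (h : H.IsHom L (fun i => e i ≫ m i)) :
    ∃ K : GradedBialgData B, H.IsHom K e ∧ K.IsHom L m := by
  have hmul : ∀ i j k, ∃ l, (e i ⊗ₘ e j) ≫ l = H.mul i j k ≫ e k ∧
      l ≫ m k = (m i ⊗ₘ m j) ≫ L.mul i j k := fun i j k =>
    exists_diagonal _ _ _ _ (by
      rw [Category.assoc, h.mul, tensorHom_comp_tensorHom_assoc])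
  have hcomul : ∀ k i j, ∃ l, e k ≫ l = H.comul k i j ≫ (e i ⊗ₘ e j) ∧
      l ≫ (m i ⊗ₘ m j) = m k ≫ L.comul k i j := fun k i j =>
    exists_diagonal _ _ _ _ (by
      rw [Category.assoc, tensorHom_comp_tensorHom, h.comul, Category.assoc])
  choose μ h1 h2 using hmul
  choose Δ h3 h4 using hcomul
  exact ⟨⟨μ, Δ, fun i => H.one i ≫ e i, fun i => m i ≫ L.counit i⟩,
    ⟨fun i j k => (h1 i j k).symm, fun k i j => (h3 k i j).symm, fun i => rfl,
      fun i => by rw [← h.counit, Category.assoc]⟩,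
    ⟨h2, h4, fun i => by rw [← h.one, Category.assoc], fun i => rfl⟩⟩

/-- The quotient of a graded bialgebra by a biideal. -/
theorem exists_quotient (H : GradedBialgData A) (q : ∀ i, A i ⟶ B i) [∀ i, Epi (q i)]
    (κ : ∀ i, D i ⟶ A i)
    (hd : ∀ i {E : C} (h : A i ⟶ E), κ i ≫ h = 0 → ∃ h', q i ≫ h' = h)
    (hmul : ∀ i j k, κ i ▷ A j ≫ H.mul i j k ≫ q k = 0)
    (hmul' : ∀ i j k, A i ◁ κ j ≫ H.mul i j k ≫ q k = 0)
    (hcomul : (∀ i j k, κ i ▷ A j ≫ H.mul i j k ≫ q k = 0) →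
      (∀ μ : ∀ i j k, B i ⊗ B j ⟶ B k, (∀ i j k, (q i ⊗ₘ q j) ≫ μ i j k = H.mul i j k ≫ q k) →
      ∀ k i j, κ k ≫ H.comul k i j ≫ (q i ⊗ₘ q j) = 0))
    (hcounit : ∀ i, κ i ≫ H.counit i = 0) :
    ∃ K : GradedBialgData B, H.IsHom K q := by
  have hm : ∀ i j k, ∃ l, (q i ⊗ₘ q j) ≫ l = H.mul i j k ≫ q k := fun i j k =>
    exists_desc_tensor _ _ (κ i) (κ j) (hd i) (hd j) _ (hmul i j k) (hmul' i j k)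
  choose μ h1 using hm
  -- The product `μ` of the quotient comes first: checking that coproducts of ideal elements die
  -- uses products computed in the quotient.
  have hc : ∀ k i j, ∃ l, q k ≫ l = H.comul k i j ≫ (q i ⊗ₘ q j) := fun k i j =>
    hd k _ (hcomul hmul μ h1 k i j)
  choose Δ h2 using hc
  choose η h3 using fun i => hd i _ (hcounit i)
  exact ⟨⟨μ, Δ, fun i => H.one i ≫ q i, η⟩, fun i j k => (h1 i j k).symm,
    fun k i j => (h2 k i j).symm, fun i => rfl, h3⟩

end GradedBialgData

/-! ### Appending a letter to one factor of a coproduct -/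

section Insertion

variable {C : Type u} [Category.{v} C] [MonoidalCategory C]
  {T A B D E F : C} (X : C)

/-- For `Δ w = ∑ w' ⊗ w''`, the map `w ⊗ x ↦ ∑ w' ⊗ w'' x`. -/
def insR (d : T ⟶ A ⊗ D) : T ⊗ X ⟶ A ⊗ (D ⊗ X) := d ▷ X ≫ (α_ _ _ _).hom

variable {X} in
-- The hypothesis `h` is coassociativity for one choice of components. This lemma, `insL_insR` and
-- `insL_insL` show that it persists when a new letter enters the third, second or first tensor
-- factor; they form the inductive step for `tcomul_coassoc`.
theorem insR_insR {d : T ⟶ A ⊗ D} {d' : A ⟶ E ⊗ F} {e : T ⟶ E ⊗ B} {e' : B ⟶ F ⊗ D}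
    (h : d ≫ d' ▷ D ≫ (α_ _ _ _).hom = e ≫ E ◁ e') :
    insR X d ≫ d' ▷ (D ⊗ X) ≫ (α_ _ _ _).hom = insR X e ≫ E ◁ insR X e' := by
  have h1 : insR X d ≫ d' ▷ (D ⊗ X) ≫ (α_ _ _ _).hom =
      (d ≫ d' ▷ D ≫ (α_ _ _ _).hom) ▷ X ≫ (α_ _ _ _).hom ≫ E ◁ (α_ _ _ _).hom := by
    simp only [insR]; monoidal
  rw [h1, h]
  simp only [insR]; monoidal

variable [BraidedCategory C]

/-- For `Δ w = ∑ w' ⊗ w''`, the map `w ⊗ x ↦ ∑ w' x ⊗ w''`. -/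
def insL (d : T ⟶ A ⊗ D) : T ⊗ X ⟶ (A ⊗ X) ⊗ D :=
  d ▷ X ≫ (α_ _ _ _).hom ≫ A ◁ (β_ D X).hom ≫ (α_ _ _ _).inv

variable {X}

theorem insL_insR {d : T ⟶ A ⊗ D} {d' : A ⟶ E ⊗ F} {e : T ⟶ E ⊗ B} {e' : B ⟶ F ⊗ D}
    (h : d ≫ d' ▷ D ≫ (α_ _ _ _).hom = e ≫ E ◁ e') :
    insL X d ≫ insR X d' ▷ D ≫ (α_ _ _ _).hom = insR X e ≫ E ◁ insL X e' := by
  have h1 : insL X d ≫ insR X d' ▷ D ≫ (α_ _ _ _).hom =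
      d ▷ X ≫ (α_ _ _ _).hom ≫ (A ◁ (β_ D X).hom ≫ d' ▷ (X ⊗ D)) ≫ (α_ _ _ _).inv ≫
        (α_ _ _ _).hom ▷ D ≫ (α_ _ _ _).hom := by
    simp only [insR, insL]; monoidal
  have h2 : insL X d ≫ insR X d' ▷ D ≫ (α_ _ _ _).hom =
      (d ≫ d' ▷ D ≫ (α_ _ _ _).hom) ▷ X ≫ (α_ _ _ _).hom ≫ E ◁ ((α_ _ _ _).hom ≫
        F ◁ (β_ D X).hom ≫ (α_ _ _ _).inv) := by
    rw [h1, whisker_exchange]; monoidal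
  rw [h2, h]
  simp only [insR, insL]; monoidal

theorem insL_insL {d : T ⟶ A ⊗ D} {d' : A ⟶ E ⊗ F} {e : T ⟶ E ⊗ B} {e' : B ⟶ F ⊗ D}
    (h : d ≫ d' ▷ D ≫ (α_ _ _ _).hom = e ≫ E ◁ e') :
    insL X d ≫ insL X d' ▷ D ≫ (α_ _ _ _).hom = insL X e ≫ (E ⊗ X) ◁ e' := by
  have h1 : insL X d ≫ insL X d' ▷ D ≫ (α_ _ _ _).hom =
      d ▷ X ≫ (α_ _ _ _).hom ≫ (A ◁ (β_ D X).hom ≫ d' ▷ (X ⊗ D)) ≫ (α_ _ _ _).hom ≫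
        E ◁ ((α_ _ _ _).inv ≫ (β_ F X).hom ▷ D ≫ (α_ _ _ _).hom) ≫ (α_ _ _ _).inv := by
    simp only [insL]; monoidal
  have h2 : insL X d ≫ insL X d' ▷ D ≫ (α_ _ _ _).hom =
      (d ≫ d' ▷ D ≫ (α_ _ _ _).hom) ▷ X ≫ (α_ _ _ _).hom ≫ E ◁ (β_ (F ⊗ D) X).hom ≫
        (α_ _ _ _).inv := by
    -- Hexagon axiom: moving the letter past `D` and then past `F` is moving it past `F ⊗ D`.
    rw [h1, whisker_exchange, BraidedCategory.braiding_tensor_left_hom]; monoidal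
  have h3 : (e ≫ E ◁ e') ▷ X ≫ (α_ _ _ _).hom ≫ E ◁ (β_ (F ⊗ D) X).hom ≫ (α_ _ _ _).inv =
      e ▷ X ≫ (α_ _ _ _).hom ≫ E ◁ (e' ▷ X ≫ (β_ (F ⊗ D) X).hom) ≫ (α_ _ _ _).inv := by
    monoidal
  rw [h2, h, h3, BraidedCategory.braiding_naturality_left, insL]
  monoidal

end Insertion

section SignedInsertion

variable {C : Type u} [Category.{v} C] [Preadditive C] [MonoidalCategory C]
  [MonoidalPreadditive C] [BraidedCategory C] {T A B D E F X : C}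

theorem zsmul_insL_insR {d : T ⟶ A ⊗ D} {d' : A ⟶ E ⊗ F} {e : T ⟶ E ⊗ B} {e' : B ⟶ F ⊗ D}
    (h : d ≫ d' ▷ D ≫ (α_ _ _ _).hom = e ≫ E ◁ e') (m : ℤ) :
    (m • insL X d) ≫ insR X d' ▷ D ≫ (α_ _ _ _).hom = insR X e ≫ E ◁ (m • insL X e') := by
  rw [Preadditive.zsmul_comp, whiskerLeft_zsmul, Preadditive.comp_zsmul, insL_insR h]

theorem zsmul_insL_insL {d : T ⟶ A ⊗ D} {d' : A ⟶ E ⊗ F} {e : T ⟶ E ⊗ B} {e' : B ⟶ F ⊗ D}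
    (h : d ≫ d' ▷ D ≫ (α_ _ _ _).hom = e ≫ E ◁ e') {m n r : ℤ} (hr : n * m = r) :
    (m • insL X d) ≫ (n • insL X d') ▷ D ≫ (α_ _ _ _).hom =
      (r • insL X e) ≫ (E ⊗ X) ◁ e' := by
  rw [Preadditive.zsmul_comp, zsmul_whiskerRight, Preadditive.zsmul_comp, Preadditive.comp_zsmul,
    Preadditive.zsmul_comp, smul_smul, mul_comm, hr, insL_insL h]

end SignedInsertion

/-! ### The tensor algebra as a graded algebra, and coassociativity -/

section TensorAlgebra

variable {C : Type u} [Category.{v} C] [Abelian C] [MonoidalCategory C] [MonoidalPreadditive C]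
variable {X Y : C}

theorem tmul_zero (X : C) (i : ℕ) : tmul X i 0 i = (ρ_ (tpow X i)).hom := by
  simp only [tmul, Nat.add_zero, dif_pos]
  exact Category.comp_id _

theorem tmul_succ (X : C) (i j k : ℕ) : tmul X i (j + 1) (k + 1) =
    (α_ (tpow X i) (tpow X j) X).inv ≫ tmul X i j k ▷ X := by
  by_cases h : i + j = k
  · subst h
    have h1 : tmul X i j (i + j) = tconcat X i j := by
      rw [tmul, dif_pos rfl, eqToHom_refl, Category.comp_id]
    rw [h1, tmul, dif_pos (by omega)]
    exact Category.comp_id _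
  · rw [tmul, dif_neg (by omega), tmul, dif_neg h, MonoidalPreadditive.zero_whiskerRight]
    exact comp_zero.symm

theorem tmul_deg (X : C) (i j k : ℕ) (h : i + j ≠ k) : tmul X i j k = 0 := dif_neg h

theorem tmul_assoc (X : C) {i j k a b n : ℕ} (ha : i + j = a) (hb : j + k = b) :
    tmul X i j a ▷ tpow X k ≫ tmul X a k n =
      (α_ _ _ _).hom ≫ tpow X i ◁ tmul X j k b ≫ tmul X i b n := by
  -- Words grow on the right, so the last factor is the one to induct on.
  induction k generalizing b n with
  | zero =>
    obtain rfl : j = b := by omega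
    by_cases hn : a = n
    · subst hn
      rw [tmul_zero, tmul_zero]
      change _ ▷ 𝟙_ C ≫ _ = _
      rw [rightUnitor_naturality, rightUnitor_tensor_hom_assoc]
      rfl
    · rw [tmul_deg X a 0 n (by omega), tmul_deg X i j n (by omega)]
      simp
  | succ k ih =>
    obtain ⟨b, rfl⟩ : ∃ b', b = b' + 1 := ⟨j + k, by omega⟩
    cases n with
    | zero => rw [tmul_deg X a _ 0 (by omega), tmul_deg X i _ 0 (by omega)]; simp
    | succ n =>
      rw [tmul_succ, tmul_succ, tmul_succ]
      have := congrArg (fun f => f ▷ X) (ih (n := n) (b := b) (by omega))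
      simp only [comp_whiskerRight] at this
      change _ ▷ (tpow X k ⊗ X) ≫ _ = _
      simp only [whiskerRight_tensor, Category.assoc, Iso.hom_inv_id_assoc,
        whiskerLeft_comp, this, tpow]
      monoidal

theorem one_tmul (X : C) (i : ℕ) : tmul X 0 i i = (λ_ (tpow X i)).hom := by
  induction i with
  | zero => rw [tmul_zero]; exact unitors_equal.symm
  | succ i ih =>
    rw [tmul_succ, ih]
    exact (leftUnitor_tensor_hom _ _).symm

/-- Right multiplication by a generator. -/
theorem tmul_one_eq (X : C) (i : ℕ) :
    tmul X i 1 (i + 1) = (α_ (tpow X i) (𝟙_ C) X).inv ≫ (ρ_ (tpow X i)).hom ▷ X := by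
  rw [tmul_succ, tmul_zero]; rfl

/-- Together with `cancel_epi` this allows statements about words of length `i + 1` to be tested on
products of a word and a letter. -/
instance isIso_tmul_one (X : C) (i : ℕ) : IsIso (tmul X i 1 (i + 1)) := by
  rw [tmul_one_eq]
  exact IsIso.comp_isIso' (inferInstanceAs (IsIso (α_ (tpow X i) (𝟙_ C) X).symm.hom))
    (inferInstanceAs (IsIso ((ρ_ (tpow X i)).hom ▷ X)))

variable [BraidedCategory C] (ε : ℤ)

theorem tensorAlgebraData_isAlg (X : C) : (tensorAlgebraData ε X).IsAlg where
  mul_deg := tmul_deg X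
  one_deg i hi := by
    cases i with
    | zero => exact absurd rfl hi
    | succ i => rfl
  mul_assoc i j k n := tmul_assoc X rfl rfl
  one_mul i := by
    change 𝟙 (𝟙_ C) ▷ _ ≫ tmul X 0 i i = _
    rw [one_tmul, id_whiskerRight]
    exact Category.id_comp _
  mul_one i := by
    change _ ◁ 𝟙 (𝟙_ C) ≫ tmul X i 0 i = _
    rw [tmul_zero, whiskerLeft_id]
    exact Category.id_comp _

/-- The summand `w' ⊗ w'' x` of `Δ(w x)`. -/
def tcomulR (X : C) (n i j : ℕ) : tpow X (n + 1) ⟶ tpow X i ⊗ tpow X (j + 1) :=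
  insR X (tcomul ε X n i j)

/-- The summand `w' x ⊗ w''` of `Δ(w x)`. -/
def tcomulL (X : C) (n i j : ℕ) : tpow X (n + 1) ⟶ tpow X (i + 1) ⊗ tpow X j :=
  (ε ^ j) • insL X (tcomul ε X n i j)

theorem tcomul_succ_zero_zero (X : C) (n : ℕ) : tcomul ε X (n + 1) 0 0 = 0 := rfl

theorem tcomul_succ_zero_succ (X : C) (n j : ℕ) :
    tcomul ε X (n + 1) 0 (j + 1) = tcomulR ε X n 0 j := rfl

theorem tcomul_succ_succ_zero (X : C) (n i : ℕ) :
    tcomul ε X (n + 1) (i + 1) 0 = tcomulL ε X n i 0 := by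
  rw [tcomulL, pow_zero, one_smul]; rfl

theorem tcomul_succ_succ_succ (X : C) (n i j : ℕ) :
    tcomul ε X (n + 1) (i + 1) (j + 1) = tcomulR ε X n (i + 1) j + tcomulL ε X n i (j + 1) := rfl

variable {ε}

theorem tcomulR_eq_zero {n i j : ℕ} (h : tcomul ε X n i j = 0) : tcomulR ε X n i j = 0 := by
  rw [tcomulR, h, insR, MonoidalPreadditive.zero_whiskerRight]; exact zero_comp

theorem tcomulL_eq_zero {n i j : ℕ} (h : tcomul ε X n i j = 0) : tcomulL ε X n i j = 0 := by
  rw [tcomulL, h, insL, MonoidalPreadditive.zero_whiskerRight, zero_comp]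
  exact smul_zero (A := tpow X (n + 1) ⟶ tpow X (i + 1) ⊗ tpow X j) _

theorem tcomul_deg (X : C) (n i j : ℕ) (h : i + j ≠ n) : tcomul ε X n i j = 0 := by
  induction n generalizing i j with
  | zero =>
    cases i with
    | succ i => cases j <;> rfl
    | zero =>
      cases j with
      | zero => exact absurd rfl h
      | succ j => rfl
  | succ n ih =>
    cases i with
    | zero =>
      cases j with
      | zero => rfl
      | succ j => rw [tcomul_succ_zero_succ, tcomulR_eq_zero (ih _ _ (by omega))]
    | succ i =>
      cases j with
      | zero => rw [tcomul_succ_succ_zero, tcomulL_eq_zero (ih _ _ (by omega))]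
      | succ j =>
        rw [tcomul_succ_succ_succ, tcomulR_eq_zero (ih _ _ (by omega)),
          tcomulL_eq_zero (ih _ _ (by omega)), add_zero]

section Coassoc

variable {n i j k a b : ℕ}

theorem tcomulR_tcomul (h : tcomul ε X n a k ≫ tcomul ε X a i j ▷ tpow X k ≫ (α_ _ _ _).hom =
      tcomul ε X n i b ≫ tpow X i ◁ tcomul ε X b j k) :
    tcomulR ε X n a k ≫ tcomul ε X a i j ▷ tpow X (k + 1) ≫ (α_ _ _ _).hom =
      tcomulR ε X n i b ≫ tpow X i ◁ tcomulR ε X b j k :=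
  insR_insR h

theorem tcomulL_tcomulR (h : tcomul ε X n a k ≫ tcomul ε X a i j ▷ tpow X k ≫ (α_ _ _ _).hom =
      tcomul ε X n i b ≫ tpow X i ◁ tcomul ε X b j k) :
    tcomulL ε X n a k ≫ tcomulR ε X a i j ▷ tpow X k ≫ (α_ _ _ _).hom =
      tcomulR ε X n i b ≫ tpow X i ◁ tcomulL ε X b j k :=
  zsmul_insL_insR h _

theorem tcomulL_tcomulL (hb : j + k = b)
    (h : tcomul ε X n a k ≫ tcomul ε X a i j ▷ tpow X k ≫ (α_ _ _ _).hom =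
      tcomul ε X n i b ≫ tpow X i ◁ tcomul ε X b j k) :
    tcomulL ε X n a k ≫ tcomulL ε X a i j ▷ tpow X k ≫ (α_ _ _ _).hom =
      tcomulL ε X n i b ≫ tpow X (i + 1) ◁ tcomul ε X b j k :=
  zsmul_insL_insL h (by rw [← pow_add, hb])

/-- In the iterated coproduct of a word, the last letter lands in the third, second or first factor;
`hR`, `hM` and `hL` match these summands on the two sides. A factor of degree zero cannot receive a
letter, which is why eight cases occur, with at most three summands each. -/
theorem tcomul_coassoc (ha : i + j = a) (hb : j + k = b) :
    tcomul ε X n a k ≫ tcomul ε X a i j ▷ tpow X k ≫ (α_ _ _ _).hom =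
      tcomul ε X n i b ≫ tpow X i ◁ tcomul ε X b j k := by
  induction n generalizing i j k a b with
  | zero =>
    by_cases h : i = 0 ∧ j = 0 ∧ k = 0
    · obtain ⟨rfl, rfl, rfl⟩ := h
      subst ha hb
      change (λ_ (𝟙_ C)).inv ≫ (λ_ (𝟙_ C)).inv ▷ 𝟙_ C ≫ (α_ _ _ _).hom =
        (λ_ (𝟙_ C)).inv ≫ 𝟙_ C ◁ (λ_ (𝟙_ C)).inv
      monoidal
    · rw [tcomul_deg X 0 a k (by omega), tcomul_deg X 0 i b (by omega), zero_comp, zero_comp]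
  | succ n ih =>
    have hR : ∀ {i j k a b}, i + j = a → j + k = b →
        tcomulR ε X n a k ≫ tcomul ε X a i j ▷ tpow X (k + 1) ≫ (α_ _ _ _).hom =
        tcomulR ε X n i b ≫ tpow X i ◁ tcomulR ε X b j k :=
      fun ha hb => tcomulR_tcomul (ih ha hb)
    have hM : ∀ {i j k a b}, i + j = a → j + k = b →
        tcomulL ε X n a k ≫ tcomulR ε X a i j ▷ tpow X k ≫ (α_ _ _ _).hom =
        tcomulR ε X n i b ≫ tpow X i ◁ tcomulL ε X b j k :=
      fun ha hb => tcomulL_tcomulR (ih ha hb)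
    have hL : ∀ {i j k a b}, i + j = a → j + k = b →
        tcomulL ε X n a k ≫ tcomulL ε X a i j ▷ tpow X k ≫ (α_ _ _ _).hom =
        tcomulL ε X n i b ≫ tpow X (i + 1) ◁ tcomul ε X b j k :=
      fun ha hb => tcomulL_tcomulL hb (ih ha hb)
    rcases i with _ | i <;> rcases j with _ | j <;> rcases k with _ | k
    · obtain rfl : a = 0 := by omega
      obtain rfl : b = 0 := by omega
      rw [tcomul_succ_zero_zero, zero_comp, zero_comp]
    · obtain rfl : a = 0 := by omega
      obtain ⟨b, rfl⟩ : ∃ b', b = b' + 1 := ⟨b - 1, by omega⟩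
      simp only [tcomul_succ_zero_succ]
      exact hR (by omega) (by omega)
    · obtain ⟨a, rfl⟩ : ∃ b', a = b' + 1 := ⟨a - 1, by omega⟩
      obtain ⟨b, rfl⟩ : ∃ b', b = b' + 1 := ⟨b - 1, by omega⟩
      simp only [tcomul_succ_zero_succ, tcomul_succ_succ_zero]
      exact hM (by omega) (by omega)
    · obtain ⟨a, rfl⟩ : ∃ b', a = b' + 1 := ⟨a - 1, by omega⟩
      obtain ⟨b, rfl⟩ : ∃ b', b = b' + 1 := ⟨b - 1, by omega⟩
      simp only [tcomul_succ_zero_succ, tcomul_succ_succ_succ, Preadditive.add_comp,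
        MonoidalPreadditive.whiskerLeft_add, Preadditive.comp_add]
      rw [← hR (a := a + 1) (by omega) (by omega), ← hM (a := a) (by omega) (by omega)]
      rfl
    · obtain ⟨a, rfl⟩ : ∃ b', a = b' + 1 := ⟨a - 1, by omega⟩
      obtain rfl : b = 0 := by omega
      simp only [tcomul_succ_succ_zero]
      exact hL (by omega) (by omega)
    · obtain ⟨a, rfl⟩ : ∃ b', a = b' + 1 := ⟨a - 1, by omega⟩
      obtain ⟨b, rfl⟩ : ∃ b', b = b' + 1 := ⟨b - 1, by omega⟩
      rw [tcomul_succ_succ_succ, Preadditive.add_comp, hR (b := b) (by omega) (by omega)]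
      rw [tcomul_succ_succ_zero, hL (b := b + 1) (by omega) (by omega)]
      rw [tcomul_succ_succ_succ, Preadditive.add_comp]
      rfl
    · obtain ⟨a, rfl⟩ : ∃ b', a = b' + 1 := ⟨a - 1, by omega⟩
      obtain ⟨b, rfl⟩ : ∃ b', b = b' + 1 := ⟨b - 1, by omega⟩
      rw [tcomul_succ_succ_zero, tcomul_succ_succ_succ, tcomul_succ_succ_succ,
        MonoidalPreadditive.add_whiskerRight, Preadditive.add_comp, Preadditive.comp_add,
        hM (b := b) (by omega) (by omega), hL (b := b + 1) (by omega) (by omega),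
        Preadditive.add_comp, tcomul_succ_succ_zero]
    · obtain ⟨a, rfl⟩ : ∃ b', a = b' + 1 := ⟨a - 1, by omega⟩
      obtain ⟨b, rfl⟩ : ∃ b', b = b' + 1 := ⟨b - 1, by omega⟩
      rw [tcomul_succ_succ_succ, Preadditive.add_comp, hR (b := b) (by omega) (by omega),
        tcomul_succ_succ_succ, MonoidalPreadditive.add_whiskerRight, Preadditive.add_comp,
        Preadditive.comp_add, hM (b := b) (by omega) (by omega),
        hL (b := b + 1) (by omega) (by omega), tcomul_succ_succ_succ ε X n,
        Preadditive.add_comp, tcomul_succ_succ_succ, MonoidalPreadditive.whiskerLeft_add,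
        Preadditive.comp_add, Preadditive.comp_add]
      abel

end Coassoc

end TensorAlgebra

/-! ### Naturality of the insertion maps -/

section InsertionNaturality

variable {C : Type u} [Category.{v} C] [MonoidalCategory C] {T A D T' A' D' X X' : C}

theorem insR_natural_right (d : T ⟶ A ⊗ D) (x : X' ⟶ X) :
    d ▷ X' ≫ (α_ _ _ _).hom ≫ A ◁ (D ◁ x) = T ◁ x ≫ insR X d := by
  rw [insR, whisker_exchange_assoc, associator_naturality_right]

theorem insR_natural {d : T ⟶ A ⊗ D} {d' : T' ⟶ A' ⊗ D'} {t : T ⟶ T'} {a : A ⟶ A'} {b : D ⟶ D'}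
    (x : X ⟶ X') (h : t ≫ d' = d ≫ (a ⊗ₘ b)) :
    (t ⊗ₘ x) ≫ insR X' d' = insR X d ≫ (a ⊗ₘ (b ⊗ₘ x)) := by
  rw [insR, insR, Category.assoc, ← associator_naturality, ← tensorHom_id, ← tensorHom_id,
    tensorHom_comp_tensorHom_assoc, h, tensorHom_comp_tensorHom_assoc, Category.comp_id,
    Category.id_comp]

variable [BraidedCategory C]

theorem insL_natural_right (d : T ⟶ A ⊗ D) (x : X' ⟶ X) :
    d ▷ X' ≫ (α_ _ _ _).hom ≫ A ◁ (β_ D X').hom ≫ (α_ _ _ _).inv ≫ (A ◁ x) ▷ D =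
      T ◁ x ≫ insL X d := by
  rw [insL, whisker_exchange_assoc, associator_naturality_right_assoc, ← whiskerLeft_comp_assoc,
    BraidedCategory.braiding_naturality_right, whiskerLeft_comp_assoc,
    ← associator_inv_naturality_middle]

theorem insL_natural {d : T ⟶ A ⊗ D} {d' : T' ⟶ A' ⊗ D'} {t : T ⟶ T'} {a : A ⟶ A'} {b : D ⟶ D'}
    (x : X ⟶ X') (h : t ≫ d' = d ≫ (a ⊗ₘ b)) :
    (t ⊗ₘ x) ≫ insL X' d' = insL X d ≫ ((a ⊗ₘ x) ⊗ₘ b) := by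
  rw [insL, insL, Category.assoc, Category.assoc, Category.assoc, ← associator_inv_naturality,
    ← tensorHom_id, ← tensorHom_id,
    tensorHom_comp_tensorHom_assoc, h, Category.comp_id, ← Category.id_comp x,
    ← tensorHom_comp_tensorHom_assoc, associator_naturality_assoc, ← id_tensorHom,
    ← id_tensorHom, tensorHom_comp_tensorHom_assoc, tensorHom_comp_tensorHom_assoc,
    BraidedCategory.braiding_naturality]
  simp only [Category.id_comp, Category.comp_id]

end InsertionNaturality

/-! ### The bialgebra structure of the tensor algebra -/

section TensorAlgebra

variable {C : Type u} [Category.{v} C] [Abelian C] [MonoidalCategory C] [MonoidalPreadditive C]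
  [BraidedCategory C]
variable {X Y : C} {ε : ℤ}

theorem tcomul_zero_left (n : ℕ) : tcomul ε X n 0 n = (λ_ (tpow X n)).inv := by
  induction n with
  | zero => rfl
  | succ n ih =>
    rw [tcomul_succ_zero_succ, tcomulR, ih]
    exact (leftUnitor_tensor_inv _ _).symm

theorem tcomul_zero_right (n : ℕ) : tcomul ε X n n 0 = (ρ_ (tpow X n)).inv := by
  induction n with
  | zero => exact unitors_inv_equal
  | succ n ih =>
    rw [tcomul_succ_succ_zero, tcomulL, ih, pow_zero, one_smul]
    change (ρ_ (tpow X n)).inv ▷ X ≫ (α_ _ (𝟙_ C) _).hom ≫ _ ◁ (β_ (𝟙_ C) X).hom ≫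
      (α_ _ _ (𝟙_ C)).inv = (ρ_ (tpow X n ⊗ X)).inv
    rw [braiding_tensorUnit_left]
    monoidal

theorem tensorAlgebraData_isCoalg (X : C) : (tensorAlgebraData ε X).IsCoalg where
  comul_deg n i j h := tcomul_deg X n i j h
  counit_deg i hi := by
    cases i with
    | zero => exact absurd rfl hi
    | succ i => rfl
  comul_assoc n i j k := tcomul_coassoc rfl rfl
  counit_comul i := by
    change tcomul ε X i 0 i ≫ 𝟙 (𝟙_ C) ▷ _ = _
    rw [tcomul_zero_left, id_whiskerRight]
    exact Category.comp_id _
  comul_counit i := by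
    change tcomul ε X i i 0 ≫ tpow X i ◁ 𝟙 (tpow X 0) = _
    rw [whiskerLeft_id, tcomul_zero_right]
    exact Category.comp_id _

theorem tmul_one_eq_whiskerLeft (X : C) (i : ℕ) :
    tmul X i 1 (i + 1) = tpow X i ◁ (λ_ X).hom := by
  rw [tmul_one_eq]
  exact triangle_assoc_comp_right _ _

theorem tensorAlgebraData_leftTerm (i p l : ℕ) :
    (tensorAlgebraData ε X).leftTerm ε id i 1 p (p + 1) l =
      tmul X i 1 (i + 1) ≫ tcomulL ε X i p l := by
  rw [tmul_one_eq_whiskerLeft, tcomulL]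
  have h := insL_natural_right (tcomul ε X i p l) (λ_ X).hom
  rw [GradedBialgData.leftTerm]
  change ε ^ (l * 1) • (_ ≫ _ ≫ _ ≫ _ ≫ tmul X p 1 (p + 1) ▷ _) = _
  rw [tmul_one_eq_whiskerLeft, mul_one]
  exact (congrArg _ h).trans (Preadditive.comp_zsmul _ _ _).symm

theorem tensorAlgebraData_rightTerm (i p k : ℕ) :
    (tensorAlgebraData ε X).rightTerm i 1 p k (p + 1) =
      tmul X i 1 (i + 1) ≫ tcomulR ε X i k p := by
  rw [tmul_one_eq_whiskerLeft, tcomulR]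
  have h := insR_natural_right (tcomul ε X i k p) (λ_ X).hom
  rw [GradedBialgData.rightTerm]
  change _ ≫ _ ≫ _ ◁ tmul X p 1 (p + 1) = _
  rw [tmul_one_eq_whiskerLeft]
  exact h

theorem tensorAlgebraData_sum_leftTerm_zero (i l : ℕ) :
    ∑ p ∈ Finset.HasAntidiagonal.antidiagonal i,
      (tensorAlgebraData ε X).leftTerm ε id i 1 p.1 0 l = 0 :=
  Finset.sum_eq_zero fun p _ => by
    rw [GradedBialgData.leftTerm, (tensorAlgebraData_isAlg ε X).mul_deg p.1 1 0 (by omega)]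
    simp

theorem tensorAlgebraData_sum_rightTerm_zero (i k : ℕ) :
    ∑ p ∈ Finset.HasAntidiagonal.antidiagonal i,
      (tensorAlgebraData ε X).rightTerm i 1 p.2 k 0 = 0 :=
  Finset.sum_eq_zero fun p _ => by
    rw [GradedBialgData.rightTerm, (tensorAlgebraData_isAlg ε X).mul_deg p.2 1 0 (by omega)]
    simp

theorem tensorAlgebraData_sum_leftTerm (i k l : ℕ) :
    ∑ p ∈ Finset.HasAntidiagonal.antidiagonal i,
      (tensorAlgebraData ε X).leftTerm ε id i 1 p.1 (k + 1) l =
      tmul X i 1 (i + 1) ≫ tcomulL ε X i k l := by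
  rw [Finset.sum_eq_single (k, l), tensorAlgebraData_leftTerm]
  · intro p hp hpk
    rw [Finset.HasAntidiagonal.mem_antidiagonal] at hp
    by_cases h1 : p.1 = k
    · rw [GradedBialgData.leftTerm, (tensorAlgebraData_isCoalg X).comul_deg i p.1 l (fun h => hpk
        (Prod.ext h1 (by dsimp only; omega)))]
      simp
    · rw [GradedBialgData.leftTerm, (tensorAlgebraData_isAlg ε X).mul_deg p.1 1 (k + 1) (by omega)]
      simp
  · intro hp
    rw [Finset.HasAntidiagonal.mem_antidiagonal] at hp
    rw [GradedBialgData.leftTerm, (tensorAlgebraData_isCoalg X).comul_deg i k l hp]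
    simp

theorem tensorAlgebraData_sum_rightTerm (i k l : ℕ) :
    ∑ p ∈ Finset.HasAntidiagonal.antidiagonal i,
      (tensorAlgebraData ε X).rightTerm i 1 p.2 k (l + 1) =
      tmul X i 1 (i + 1) ≫ tcomulR ε X i k l := by
  rw [Finset.sum_eq_single (k, l), tensorAlgebraData_rightTerm]
  · intro p hp hpk
    rw [Finset.HasAntidiagonal.mem_antidiagonal] at hp
    by_cases h1 : p.2 = l
    · rw [GradedBialgData.rightTerm, (tensorAlgebraData_isCoalg X).comul_deg i k p.2 (fun h => hpk
        (Prod.ext (by dsimp only; omega) h1))]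
      simp
    · rw [GradedBialgData.rightTerm, (tensorAlgebraData_isAlg ε X).mul_deg p.2 1 (l + 1) (by omega)]
      simp
  · intro hp
    rw [Finset.HasAntidiagonal.mem_antidiagonal] at hp
    rw [GradedBialgData.rightTerm, (tensorAlgebraData_isCoalg X).comul_deg i k l hp]
    simp

theorem nat_mem_antidiagonal_one (q : ℕ × ℕ) :
    q ∈ Finset.HasAntidiagonal.antidiagonal 1 ↔ q = (1, 0) ∨ q = (0, 1) := by
  rw [Finset.HasAntidiagonal.mem_antidiagonal, Prod.ext_iff, Prod.ext_iff]
  dsimp only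
  omega

/-- The recursion defining `tcomul` is exactly the formula for `Δ(w x)` with a primitive letter `x`.
-/
theorem tensorAlgebraData_mulComul_one (i : ℕ) :
    (tensorAlgebraData ε X).MulComul ε id i 1 (i + 1) := by
  refine (tensorAlgebraData_isAlg ε X).mulComul_of_primitive (tensorAlgebraData_isCoalg X)
    (Category.comp_id _) rfl one_ne_zero nat_mem_antidiagonal_one fun k l => ?_
  change tmul X i 1 (i + 1) ≫ tcomul ε X (i + 1) k l = _
  rcases k with _ | k <;> rcases l with _ | l
  · rw [tensorAlgebraData_sum_leftTerm_zero, tensorAlgebraData_sum_rightTerm_zero,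
      tcomul_succ_zero_zero, comp_zero, add_zero]
  · rw [tensorAlgebraData_sum_leftTerm_zero, tensorAlgebraData_sum_rightTerm, zero_add,
      tcomul_succ_zero_succ]
  · rw [tensorAlgebraData_sum_leftTerm, tensorAlgebraData_sum_rightTerm_zero, add_zero,
      tcomul_succ_succ_zero]
  · rw [tensorAlgebraData_sum_leftTerm, tensorAlgebraData_sum_rightTerm, tcomul_succ_succ_succ,
      Preadditive.comp_add]
    exact add_comm _ _

theorem tensorAlgebraData_isBialg [RigidCategory C] (X : C) :
    (tensorAlgebraData ε X).IsBialg ε id where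
  __ := tensorAlgebraData_isAlg ε X
  __ := tensorAlgebraData_isCoalg X
  mul_comul i j n hn := by
    subst hn
    induction j with
    | zero =>
      have : Epi ((tensorAlgebraData ε X).one 0) := inferInstanceAs (Epi (𝟙 (𝟙_ C)))
      exact (tensorAlgebraData_isAlg ε X).mulComul_zero (tensorAlgebraData_isCoalg X)
        (by change 𝟙 _ ≫ (λ_ (𝟙_ C)).inv = (λ_ (𝟙_ C)).inv ≫ (𝟙 (𝟙_ C) ⊗ₘ 𝟙 (𝟙_ C)); simp) rfl
        (fun q => by simp [Prod.ext_iff]) i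
    | succ j ih =>
      intro u v
      have : IsIso ((tensorAlgebraData ε X).mul j 1 (j + 1)) :=
        inferInstanceAs (IsIso (tmul X j 1 (j + 1)))
      -- A word of length `j + 1` is a shorter word times a letter, so the induction hypothesis and
      -- two instances of multiplication by a letter suffice.
      rw [← cancel_epi (tpow X i ◁ (tensorAlgebraData ε X).mul j 1 (j + 1))]
      exact (tensorAlgebraData_isAlg ε X).mulComul_assoc (fun _ _ => rfl) rfl rfl ih
        (tensorAlgebraData_mulComul_one _) (tensorAlgebraData_mulComul_one _) u v
  one_comul := by
    change 𝟙 _ ≫ (λ_ (𝟙_ C)).inv = (λ_ (𝟙_ C)).inv ≫ (𝟙 (𝟙_ C) ⊗ₘ 𝟙 (𝟙_ C)); simp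
  mul_counit := by
    change tmul X 0 0 0 ≫ 𝟙 (𝟙_ C) = (𝟙 (𝟙_ C) ⊗ₘ 𝟙 (𝟙_ C)) ≫ (λ_ (𝟙_ C)).hom
    rw [one_tmul]
    change (λ_ (𝟙_ C)).hom ≫ 𝟙 (𝟙_ C) = _
    simp
  one_counit := Category.comp_id _

theorem tcomulR_natural (f : X ⟶ Y) {n i j : ℕ}
    (h : tpowMap f n ≫ tcomul ε Y n i j = tcomul ε X n i j ≫ (tpowMap f i ⊗ₘ tpowMap f j)) :
    tpowMap f (n + 1) ≫ tcomulR ε Y n i j =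
      tcomulR ε X n i j ≫ (tpowMap f i ⊗ₘ tpowMap f (j + 1)) :=
  insR_natural f h

theorem tcomulL_natural (f : X ⟶ Y) {n i j : ℕ}
    (h : tpowMap f n ≫ tcomul ε Y n i j = tcomul ε X n i j ≫ (tpowMap f i ⊗ₘ tpowMap f j)) :
    tpowMap f (n + 1) ≫ tcomulL ε Y n i j =
      tcomulL ε X n i j ≫ (tpowMap f (i + 1) ⊗ₘ tpowMap f j) := by
  have h1 := congrArg (fun g => (ε ^ j) • g) (insL_natural f h)
  exact ((Preadditive.comp_zsmul _ _ _).trans h1).trans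
    (Preadditive.zsmul_comp _ _ _).symm

theorem tcomul_natural (f : X ⟶ Y) (n i j : ℕ) :
    tpowMap f n ≫ tcomul ε Y n i j = tcomul ε X n i j ≫ (tpowMap f i ⊗ₘ tpowMap f j) := by
  induction n generalizing i j with
  | zero =>
    by_cases h : i = 0 ∧ j = 0
    · obtain ⟨rfl, rfl⟩ := h
      change 𝟙 _ ≫ (λ_ (𝟙_ C)).inv = (λ_ (𝟙_ C)).inv ≫ (𝟙 (𝟙_ C) ⊗ₘ 𝟙 (𝟙_ C))
      simp
    · rw [tcomul_deg X 0 i j (by omega), tcomul_deg Y 0 i j (by omega), zero_comp, comp_zero]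
  | succ n ih =>
    rcases i with _ | i <;> rcases j with _ | j
    · rw [tcomul_succ_zero_zero, tcomul_succ_zero_zero, zero_comp, comp_zero]
    · exact tcomulR_natural f (ih _ _)
    · rw [tcomul_succ_succ_zero, tcomul_succ_succ_zero]
      exact tcomulL_natural f (ih _ _)
    · rw [tcomul_succ_succ_succ, tcomul_succ_succ_succ, Preadditive.comp_add,
        Preadditive.add_comp, tcomulR_natural f (ih _ _), tcomulL_natural f (ih _ _)]

theorem tpowMap_isHom (f : X ⟶ Y) :
    (tensorAlgebraData ε X).IsHom (tensorAlgebraData ε Y) (tpowMap f) where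
  mul i j k := tmul_natural f i j k
  comul k i j := (tcomul_natural f k i j).symm
  one i := by
    cases i with
    | zero => exact Category.comp_id _
    | succ i => exact zero_comp
  counit i := by
    cases i with
    | zero => exact Category.comp_id _
    | succ i => exact comp_zero

instance tpowMap_epi [RigidCategory C] (f : X ⟶ Y) [Epi f] (n : ℕ) : Epi (tpowMap f n) := by
  induction n with
  | zero => exact inferInstanceAs (Epi (𝟙 (𝟙_ C)))
  | succ n ih => exact inferInstanceAs (Epi (tpowMap f n ⊗ₘ f))

end TensorAlgebra

/-! ### Commutativity up to sign, and coproducts of ideal elements -/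

namespace GradedBialgData

section Comm

variable {C : Type u} [Category.{v} C] [Abelian C] [MonoidalCategory C] [MonoidalPreadditive C]
  [SymmetricCategory C]
variable {ι : Type} [AddCommMonoid ι] {A B : ι → C} {H : GradedBialgData A} {ε : ℤ} {deg : ι → ℕ}

/-- Elements of degrees `i` and `j` commute up to the sign given by `ε` and `deg`. -/
def Comm (ε : ℤ) (deg : ι → ℕ) (H : GradedBialgData A) (i j : ι) : Prop :=
  ∀ n, H.mul i j n = (ε ^ (deg i * deg j)) • ((β_ _ _).hom ≫ H.mul j i n)

theorem Comm.symm (hε : ε * ε = 1) {i j : ι} (h : H.Comm ε deg i j) : H.Comm ε deg j i := by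
  intro n
  rw [h n, Preadditive.comp_zsmul, SymmetricCategory.symmetry_assoc, smul_smul,
    mul_comm (deg j), ← mul_pow, hε, one_pow, one_smul]

/-- In terms of elements, `a(bx) = (ab)x = ±(ba)x = ±b(ax) = ±b(xa) = ±(bx)a`, and the two exponents
of `ε` add up to `deg a (deg b + deg x)`. -/
theorem IsAlg.comm_assoc (h : H.IsAlg) (hdeg : ∀ i j, deg (i + j) = deg i + deg j) {a b x w : ι}
    (hw : b + x = w) (h1 : H.Comm ε deg a b) (h2 : H.Comm ε deg a x) (n : ι) :
    A a ◁ H.mul b x w ≫ H.mul a w n =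
      A a ◁ H.mul b x w ≫ ((ε ^ (deg a * deg w)) • ((β_ _ _).hom ≫ H.mul w a n)) := by
  rw [h.assoc_inv (a := a + b) rfl hw, h1, zsmul_whiskerRight, comp_whiskerRight,
    Preadditive.zsmul_comp, Category.assoc, h.assoc (add_comm b a) (b := a + x) rfl, h2,
    whiskerLeft_zsmul, whiskerLeft_comp, Preadditive.zsmul_comp, Category.assoc,
    h.assoc_inv hw (add_comm x a), Preadditive.comp_zsmul, Preadditive.comp_zsmul,
    Preadditive.comp_zsmul, Preadditive.comp_zsmul, Preadditive.comp_zsmul, smul_smul,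
    BraidedCategory.braiding_naturality_right_assoc, BraidedCategory.braiding_tensor_right_hom]
  simp only [Category.assoc]
  rw [← hw, hdeg, mul_add, pow_add]

end Comm

section Nat

variable {C : Type u} [Category.{v} C] [Abelian C] [MonoidalCategory C] [MonoidalPreadditive C]
  [SymmetricCategory C] [RigidCategory C] {A : ℕ → C} {H : GradedBialgData A} {ε : ℤ}

theorem IsAlg.comm_zero (h : H.IsAlg) [Epi (H.one 0)] (i : ℕ) : H.Comm ε id i 0 := by
  intro n
  by_cases hn : i = n
  · subst hn
    rw [← cancel_epi (A i ◁ H.one 0), h.mul_one]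
    simp [BraidedCategory.braiding_naturality_right_assoc, h.one_mul]
  · rw [h.mul_deg i 0 n (by omega), h.mul_deg 0 i n (by omega)]
    simp

/-- Degree one generates. Commutativity spreads from `(1, 1)` to all `(1, i)`, and after exchanging
the factors, which uses `ε * ε = 1`, to all `(i, j)`. -/
theorem IsAlg.comm_of_degree_one (h : H.IsAlg) (hε : ε * ε = 1) [Epi (H.one 0)]
    [∀ i, Epi (H.mul i 1 (i + 1))] (h1 : H.Comm ε id 1 1) (i j : ℕ) : H.Comm ε id i j := by
  have h2 : ∀ i, H.Comm ε id 1 i := by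
    intro i
    induction i with
    | zero => exact h.comm_zero 1
    | succ i ih =>
      intro n
      rw [← cancel_epi (A 1 ◁ H.mul i 1 (i + 1))]
      exact h.comm_assoc (fun _ _ => rfl) rfl ih h1 n
  induction j with
  | zero => exact h.comm_zero i
  | succ j ih =>
    intro n
    rw [← cancel_epi (A i ◁ H.mul j 1 (j + 1))]
    exact h.comm_assoc (fun _ _ => rfl) rfl ih ((h2 i).symm hε) n

end Nat

section Biideal

variable {C : Type u} [Category.{v} C] [Abelian C] [MonoidalCategory C] [MonoidalPreadditive C]
  [BraidedCategory C]
variable {ι : Type} [AddCommMonoid ι] [Finset.HasAntidiagonal ι] {A B : ι → C}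
  {H : GradedBialgData A} {ε : ℤ} {deg : ι → ℕ}

theorem pairMul_comp {q : ∀ i, A i ⟶ B i} {μ : ∀ i j k, B i ⊗ B j ⟶ B k}
    (hμ : ∀ i j k, (q i ⊗ₘ q j) ≫ μ i j k = H.mul i j k ≫ q k) (i i' j j' k k' : ι) :
    H.pairMul ε deg i i' j j' k k' ≫ (q k ⊗ₘ q k') = ((q i ⊗ₘ q i') ⊗ₘ (q j ⊗ₘ q j')) ≫
      ((ε ^ (deg i' * deg j)) • (tensorμ _ _ _ _ ≫ (μ i j k ⊗ₘ μ i' j' k'))) := by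
  rw [pairMul, Preadditive.zsmul_comp, Preadditive.comp_zsmul, tensorμ_natural_assoc,
    tensorHom_comp_tensorHom, Category.assoc, tensorHom_comp_tensorHom, hμ, hμ]

/-- Since `Δ(xy) = Δ(x)Δ(y)`, once `Δ(x)` dies in the tensor square of the quotient so does `Δ(xy)`.
Only a product `μ` on the quotient is needed, not a coproduct. -/
theorem IsBialg.comul_mul_right_eq_zero (h : H.IsBialg ε deg) {q : ∀ i, A i ⟶ B i}
    {μ : ∀ i j k, B i ⊗ B j ⟶ B k}
    (hμ : ∀ i j k, (q i ⊗ₘ q j) ≫ μ i j k = H.mul i j k ≫ q k) {E : C} {m j n : ι}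
    (hn : m + j = n) (x : E ⟶ A m) (hx : ∀ u v, x ≫ H.comul m u v ≫ (q u ⊗ₘ q v) = 0) (u v : ι) :
    x ▷ A j ≫ H.mul m j n ≫ H.comul n u v ≫ (q u ⊗ₘ q v) = 0 := by
  rw [reassoc_of% h.mul_comul m j n hn u v]
  simp only [Preadditive.sum_comp, Preadditive.comp_sum, Category.assoc]
  refine Finset.sum_eq_zero fun r _ => Finset.sum_eq_zero fun s _ => ?_
  rw [pairMul_comp hμ, ← tensorHom_id, tensorHom_comp_tensorHom_assoc,
    tensorHom_comp_tensorHom_assoc, Category.assoc, hx]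
  simp

theorem IsBialg.comul_mul_left_eq_zero (h : H.IsBialg ε deg) {q : ∀ i, A i ⟶ B i}
    {μ : ∀ i j k, B i ⊗ B j ⟶ B k}
    (hμ : ∀ i j k, (q i ⊗ₘ q j) ≫ μ i j k = H.mul i j k ≫ q k) {E : C} {m i n : ι}
    (hn : i + m = n) (x : E ⟶ A m) (hx : ∀ u v, x ≫ H.comul m u v ≫ (q u ⊗ₘ q v) = 0) (u v : ι) :
    A i ◁ x ≫ H.mul i m n ≫ H.comul n u v ≫ (q u ⊗ₘ q v) = 0 := by
  rw [reassoc_of% h.mul_comul i m n hn u v]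
  simp only [Preadditive.sum_comp, Preadditive.comp_sum, Category.assoc]
  refine Finset.sum_eq_zero fun r _ => Finset.sum_eq_zero fun s _ => ?_
  rw [pairMul_comp hμ, ← id_tensorHom, tensorHom_comp_tensorHom_assoc,
    tensorHom_comp_tensorHom_assoc, Category.assoc, Category.assoc, hx]
  simp

end Biideal

end GradedBialgData

/-! ### Quotients of the tensor algebra -/

section QuotientsOfTensorAlgebra

variable {C : Type u} [Category.{v} C] [Abelian C] [MonoidalCategory C] [MonoidalPreadditive C]
  [BraidedCategory C] [RigidCategory C] {X : C} {ε : ℤ} {P : ℕ → C} {H : GradedBialgData P}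
  {π : ∀ n, tpow X n ⟶ P n} [∀ n, Epi (π n)]

namespace GradedBialgData

theorem IsHom.isBialg_of_tensorAlgebra (h : (tensorAlgebraData ε X).IsHom H π) :
    H.IsBialg ε id :=
  (tensorAlgebraData_isBialg X).of_epi π h

theorem IsHom.one_zero_eq (h : (tensorAlgebraData ε X).IsHom H π) : H.one 0 = π 0 :=
  (h.one 0).symm.trans (Category.id_comp _)

theorem IsHom.counit_one (h : (tensorAlgebraData ε X).IsHom H π) :
    H.counit 0 ≫ H.one 0 = 𝟙 _ := by
  rw [← cancel_epi (π 0), ← Category.assoc, h.counit, h.one_zero_eq, Category.comp_id]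
  exact Category.id_comp _

theorem IsHom.isHopf_of_tensorAlgebra (h : (tensorAlgebraData ε X).IsHom H π) :
    H.IsHopf ε id :=
  h.isBialg_of_tensorAlgebra.isHopf h.counit_one (fun _ _ => rfl) (fun _ h => h)

theorem IsHom.epi_one (h : (tensorAlgebraData ε X).IsHom H π) : Epi (H.one 0) := by
  rw [h.one_zero_eq]; exact inferInstanceAs (Epi (π 0))

theorem IsHom.isIso_one (h : (tensorAlgebraData ε X).IsHom H π) : IsIso (H.one 0) :=
  ⟨H.counit 0, h.isBialg_of_tensorAlgebra.one_counit, h.counit_one⟩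

theorem IsHom.epi_mul_one (h : (tensorAlgebraData ε X).IsHom H π) (i : ℕ) :
    Epi (H.mul i 1 (i + 1)) := by
  have h1 := h.mul i 1 (i + 1)
  have : Epi ((π i ⊗ₘ π 1) ≫ H.mul i 1 (i + 1)) := by
    rw [← h1]
    exact epi_comp' (inferInstanceAs (Epi (tmul X i 1 (i + 1)))) inferInstance
  exact epi_of_epi (π i ⊗ₘ π 1) _

/-- A quotient of a tensor algebra is generated in degree one: `P i ⊗ P 1 ⟶ P (i + 1)` is epi, so a
vanishing component forces the next one to vanish. -/
theorem IsHom.hasStandardStart (h : (tensorAlgebraData ε X).IsHom H π) {V : C} (j : V ⟶ P 1)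
    [IsIso j] : HasStandardStart H j where
  zero := h.isIso_one
  one := inferInstance
  succ i hi := by
    have := h.epi_mul_one i
    exact IsZero.of_epi_eq_zero (H.mul i 1 (i + 1)) (((tensorRight (P 1)).map_isZero hi).eq_of_src _ _)

end GradedBialgData

end QuotientsOfTensorAlgebra

/-! ### Quadratic algebras: their ideals -/

section Quadratic

variable {C : Type u} [Category.{v} C] [Abelian C] [MonoidalCategory C] [MonoidalPreadditive C]

theorem isIso_cokernel_π_of_eq_zero {A B : C} {f : A ⟶ B} (h : f = 0) :
    IsIso (cokernel.π f) := by
  subst h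
  infer_instance

instance quadπ_epi {X K : C} (κ : K ⟶ X ⊗ X) (n : ℕ) : Epi (quadπ κ n) :=
  inferInstanceAs (Epi (cokernel.π _))

theorem isIso_quadπ {X K : C} (κ : K ⟶ X ⊗ X) (n : ℕ) (hn : quadIdeal κ n = ⊥) :
    IsIso (quadπ κ n) := by
  have : (quadIdeal κ n).arrow = 0 := by
    rw [hn]; exact Subobject.bot_arrow
  rw [quadπ]
  exact isIso_cokernel_π_of_eq_zero this

theorem relMap_eq_zero {X K : C} (κ : K ⟶ X ⊗ X) {i j n : ℕ} (h : i + 2 + j ≠ n) :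
    relMap κ i j n = 0 := by
  rw [relMap, tmul_deg X _ _ _ h, comp_zero]

/-- A relation between two words, multiplied by a further word on the right, is the same relation
with a longer right-hand word, so it still dies. `tmul_relMap` is the mirror image. -/
theorem relMap_tmul {X K : C} (κ : K ⟶ X ⊗ X) (i j n l m : ℕ) :
    relMap κ i j n ▷ tpow X l ≫ tmul X n l m ≫ quadπ κ m = 0 := by
  by_cases h : i + 2 + j = n
  · rw [relMap, comp_whiskerRight, Category.assoc,
      reassoc_of% tmul_assoc X (k := l) (n := m) h (rfl : j + l = j + l),
      associator_naturality_left_assoc, ← whisker_exchange_assoc]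
    have := relMap_comp_quadπ κ i (j + l) m
    rw [relMap, Category.assoc] at this
    rw [this, comp_zero, comp_zero]
  · simp [relMap_eq_zero κ h]

theorem tmul_relMap {X K : C} (κ : K ⟶ X ⊗ X) (i j n l m : ℕ) :
    tpow X l ◁ relMap κ i j n ≫ tmul X l n m ≫ quadπ κ m = 0 := by
  by_cases h : i + 2 + j = n
  · have ha : ∀ {i j k a b n : ℕ}, i + j = a → j + k = b →
        tpow X i ◁ tmul X j k b ≫ tmul X i b n =
          (α_ _ _ _).inv ≫ tmul X i j a ▷ tpow X k ≫ tmul X a k n := fun ha hb => by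
      rw [tmul_assoc X ha hb, Iso.inv_hom_id_assoc]
    rw [relMap, whiskerLeft_comp, Category.assoc,
      reassoc_of% ha (i := l) (n := m) (rfl : l + (i + 2) = l + (i + 2)) h,
      associator_inv_naturality_middle_assoc, ← comp_whiskerRight_assoc, whiskerLeft_comp,
      Category.assoc, ha (n := l + (i + 2)) (rfl : l + i = l + i) rfl,
      associator_inv_naturality_right_assoc, whisker_exchange_assoc]
    have := relMap_comp_quadπ κ (l + i) j m
    rw [relMap, Category.assoc] at this
    rw [comp_whiskerRight, comp_whiskerRight, Category.assoc, Category.assoc]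
    erw [this]
    simp
  · simp [relMap_eq_zero κ h]

end Quadratic

/-! ### Quadratic algebras: bialgebra structure, commutativity and functoriality -/

section Quadratic

variable {C : Type u} [Category.{v} C] [Abelian C] [MonoidalCategory C] [MonoidalPreadditive C]

theorem relMap_zero_zero {X K : C} (κ : K ⟶ X ⊗ X) :
    ∃ e : (tpow X 0 ⊗ K) ⊗ tpow X 0 ≅ K, relMap κ 0 0 2 = e.hom ≫ κ ≫ toTpowTwo X := by
  refine ⟨ρ_ (𝟙_ C ⊗ K) ≪≫ λ_ K, ?_⟩
  have h1 : tmul X (0 + 2) 0 2 = (ρ_ (tpow X 2)).hom := tmul_zero X 2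
  have h2 : tmul X 0 2 (0 + 2) = (λ_ (tpow X 2)).hom := one_tmul X 2
  rw [relMap, h1, h2]
  change (𝟙_ C ◁ (κ ≫ toTpowTwo X) ≫ (λ_ (tpow X 2)).hom) ▷ 𝟙_ C ≫ (ρ_ (tpow X 2)).hom =
    ((ρ_ (𝟙_ C ⊗ K)).hom ≫ (λ_ K).hom) ≫ κ ≫ toTpowTwo X
  rw [leftUnitor_naturality, rightUnitor_naturality, Category.assoc]

theorem toTpowTwo_quadπ {X K : C} (κ : K ⟶ X ⊗ X) : κ ≫ toTpowTwo X ≫ quadπ κ 2 = 0 := by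
  have h := relMap_comp_quadπ κ 0 0 2
  obtain ⟨e, he⟩ := relMap_zero_zero κ
  rw [he, Category.assoc, Category.assoc] at h
  rwa [← cancel_epi e.hom, comp_zero]

theorem leftUnitor_inv_tensorHom_eq_zero {E A B D : C} {x : E ⟶ A} {q : A ⟶ B} (h : x ≫ q = 0)
    (r : 𝟙_ C ⟶ D) : x ≫ (λ_ A).inv ≫ (r ⊗ₘ q) = 0 := by
  rw [MonoidalCategory.tensorHom_def', ← leftUnitor_inv_naturality_assoc, reassoc_of% h, zero_comp]

theorem rightUnitor_inv_tensorHom_eq_zero {E A B D : C} {x : E ⟶ A} {q : A ⟶ B} (h : x ≫ q = 0)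
    (r : 𝟙_ C ⟶ D) : x ≫ (ρ_ A).inv ≫ (q ⊗ₘ r) = 0 := by
  rw [MonoidalCategory.tensorHom_def, ← rightUnitor_inv_naturality_assoc, reassoc_of% h, zero_comp]

variable [BraidedCategory C] {ε : ℤ}

/-- This is `Δ(xy) = x ⊗ y + ε y ⊗ x` in bidegree `(1, 1)`. Relations killed by `1 + εc` are
therefore primitive. -/
theorem toTpowTwo_tcomul (X : C) : toTpowTwo X ≫ tcomul ε X 2 1 1 =
    (𝟙 _ + ε • (β_ X X).hom) ≫ (toTpowOne X ⊗ₘ toTpowOne X) := by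
  have hR : toTpowTwo X ≫ tcomulR ε X 1 1 0 = toTpowOne X ⊗ₘ toTpowOne X := by
    rw [tcomulR, tcomul_zero_right]
    change (λ_ X).inv ▷ X ≫ (ρ_ (𝟙_ C ⊗ X)).inv ▷ X ≫ (α_ _ _ _).hom =
      (λ_ X).inv ⊗ₘ (λ_ X).inv
    monoidal
  have hL : toTpowTwo X ≫ insL X (tcomul ε X 1 0 1) =
      (β_ X X).hom ≫ (toTpowOne X ⊗ₘ toTpowOne X) := by
    rw [tcomul_zero_left]
    have h1 := insL_natural (d := (λ_ X).inv) (d' := (λ_ (𝟙_ C ⊗ X)).inv) (t := (λ_ X).inv)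
      (a := 𝟙 _) (b := (λ_ X).inv) (𝟙 X) (by simp)
    rw [tensorHom_id] at h1
    refine h1.trans ?_
    simp only [insL]
    change _ = (β_ X X).hom ≫ ((λ_ X).inv ⊗ₘ (λ_ X).inv)
    monoidal
  rw [Preadditive.add_comp, Category.id_comp, Preadditive.zsmul_comp]
  change _ ≫ (tcomulR ε X 1 1 0 + tcomulL ε X 1 0 1) = _
  rw [Preadditive.comp_add, hR, tcomulL, pow_one]
  exact congrArg _ ((Preadditive.comp_zsmul _ _ _).trans (congrArg _ hL))

variable [RigidCategory C]

/-- A quadratic algebra whose relations are primitive inherits the bialgebra structure of the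
tensor algebra. -/
theorem exists_quadAlg_isHom {X K : C} (κ : K ⟶ X ⊗ X) (hκ : κ ≫ (𝟙 _ + ε • (β_ X X).hom) = 0) :
    ∃ H : GradedBialgData (quadAlg κ), (tensorAlgebraData ε X).IsHom H (quadπ κ) := by
  have hB := tensorAlgebraData_isBialg (ε := ε) X
  refine GradedBialgData.exists_quotient _ (quadπ κ) (fun n => (quadIdeal κ n).arrow)
    (fun n _ h hh => ⟨cokernel.desc _ h hh, cokernel.π_desc _ _ _⟩) (fun i j k => ?_)
    (fun i j k => ?_) (fun hmul μ hμ n u v => ?_) (fun n => ?_)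
  -- The ideal is a sum of images. Transposing the other tensor factor reduces the claim to the maps
  -- `relMap` that span it.
  · obtain ⟨D, h', hh'⟩ := exists_whiskerRight_test (tmul X i j k ≫ quadπ κ k)
    refine (hh' _).2 (quadIdeal_arrow_comp κ h' fun a b => ?_)
    rw [← hh', relMap_tmul]
  · obtain ⟨D, h', hh'⟩ := exists_whiskerLeft_test (tmul X i j k ≫ quadπ κ k)
    refine (hh' _).2 (quadIdeal_arrow_comp κ h' fun a b => ?_)
    rw [← hh', tmul_relMap]
  · refine quadIdeal_arrow_comp κ _ fun i j => ?_
    by_cases hn : i + 2 + j = n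
    -- For the relation itself, the components `(0, 2)` and `(2, 0)` die because the relation is
    -- zero in the quotient, and `(1, 1)` dies by `hκ`.
    · have hr : ∀ u v, (κ ≫ toTpowTwo X) ≫ tcomul ε X 2 u v ≫ (quadπ κ u ⊗ₘ quadπ κ v) = 0 := by
        intro u v
        have hκ2 : (κ ≫ toTpowTwo X) ≫ quadπ κ 2 = 0 := by
          rw [Category.assoc, toTpowTwo_quadπ]
        by_cases huv : u + v = 2
        · obtain ⟨rfl, rfl⟩ | ⟨rfl, rfl⟩ | ⟨rfl, rfl⟩ :
              (u = 0 ∧ v = 2) ∨ (u = 1 ∧ v = 1) ∨ (u = 2 ∧ v = 0) := by omega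
          · rw [tcomul_zero_left]
            exact leftUnitor_inv_tensorHom_eq_zero hκ2 _
          · rw [Category.assoc, reassoc_of% toTpowTwo_tcomul, reassoc_of% hκ, zero_comp]
          · rw [tcomul_zero_right]
            exact rightUnitor_inv_tensorHom_eq_zero hκ2 _
        · rw [tcomul_deg X _ _ _ huv]; simp
      -- Multiply the relation by a word on the left, then by one on the right.
      have h1 := fun u v => hB.comul_mul_left_eq_zero (n := i + 2) hμ rfl _ hr (i := i) u v
      have h2 := hB.comul_mul_right_eq_zero hμ (j := j) hn
        (tpow X i ◁ (κ ≫ toTpowTwo X) ≫ tmul X i 2 (i + 2))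
        (fun u v => by rw [Category.assoc]; exact h1 u v) u v
      rw [relMap, Category.assoc]
      exact h2
    · rw [relMap_eq_zero κ hn, zero_comp]
  · refine quadIdeal_arrow_comp κ _ fun i j => ?_
    by_cases hn : i + 2 + j = n
    · rw [hB.counit_deg n (by omega), comp_zero]
    · rw [relMap_eq_zero κ hn, zero_comp]

/-- In a quadratic algebra with the relations `x y - ε y x`, generators commute up to `ε`. -/
theorem GradedBialgData.IsHom.comm_one_of_quad {X K : C} {κ : K ⟶ X ⊗ X}
    {H : GradedBialgData (quadAlg κ)} (h : (tensorAlgebraData ε X).IsHom H (quadπ κ))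
    (hκ : ∃ r, r ≫ κ = 𝟙 _ - ε • (β_ X X).hom) (n : ℕ) :
    H.mul 1 1 n = (ε ^ (1 * 1)) • ((β_ _ _).hom ≫ H.mul 1 1 n) := by
  by_cases hn : n = 2
  · subst hn
    obtain ⟨r, hr⟩ := hκ
    have h1 : (toTpowOne X ⊗ₘ toTpowOne X) ≫ tmul X 1 1 2 = toTpowTwo X := by
      rw [tmul_one_eq_whiskerLeft]
      change ((λ_ X).inv ⊗ₘ (λ_ X).inv) ≫ (𝟙_ C ⊗ X) ◁ (λ_ X).hom = (λ_ X).inv ▷ X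
      monoidal
    have h2 : (toTpowOne X ⊗ₘ toTpowOne X) ≫ (quadπ κ 1 ⊗ₘ quadπ κ 1) ≫ H.mul 1 1 2 =
        toTpowTwo X ≫ quadπ κ 2 := by
      rw [← h.mul, ← h1, Category.assoc]; rfl
    have : IsIso (toTpowOne X) := inferInstanceAs (IsIso (λ_ X).symm.hom)
    rw [← cancel_epi ((toTpowOne X ⊗ₘ toTpowOne X) ≫ (quadπ κ 1 ⊗ₘ quadπ κ 1)),
      Preadditive.comp_zsmul, Category.assoc, Category.assoc, h2,
      BraidedCategory.braiding_naturality_assoc, BraidedCategory.braiding_naturality_assoc, h2,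
      mul_one, pow_one, ← sub_eq_zero, ← Preadditive.zsmul_comp]
    have h3 : (𝟙 _ - ε • (β_ X X).hom) ≫ toTpowTwo X ≫ quadπ κ 2 = 0 := by
      rw [← hr, Category.assoc, toTpowTwo_quadπ, comp_zero]
    rwa [Preadditive.sub_comp, Category.id_comp] at h3
  · rw [h.isBialg_of_tensorAlgebra.mul_deg 1 1 n (by omega), comp_zero, smul_zero]

theorem quadπ_quadMap {X Y K L : C} (κ : K ⟶ X ⊗ X) (l : L ⟶ Y ⊗ Y) (f : X ⟶ Y)
    (h : ∃ k : K ⟶ L, k ≫ l = κ ≫ (f ⊗ₘ f)) (n : ℕ) :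
    quadπ κ n ≫ quadMap κ l f h n = tpowMap f n ≫ quadπ l n :=
  cokernel.π_desc _ _ _

theorem quadMap_isHom {X Y K L : C} {κ : K ⟶ X ⊗ X} {l : L ⟶ Y ⊗ Y} (f : X ⟶ Y)
    (h : ∃ k : K ⟶ L, k ≫ l = κ ≫ (f ⊗ₘ f)) {H : GradedBialgData (quadAlg κ)}
    {H' : GradedBialgData (quadAlg l)} (hH : (tensorAlgebraData ε X).IsHom H (quadπ κ))
    (hH' : (tensorAlgebraData ε Y).IsHom H' (quadπ l)) : H.IsHom H' (quadMap κ l f h) :=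
  ((tpowMap_isHom f).comp hH').of_epi hH (quadπ_quadMap κ l f h)

/-- A map out of a quadratic algebra of `Y` vanishing on the kernel of `TY ⟶ TZ` factors through
the quadratic algebra of `Z`, if all relations of the latter come from relations of the former. -/
theorem exists_quadMap_desc {Y Z K L : C} (κ : K ⟶ Y ⊗ Y) (l : L ⟶ Z ⊗ Z) (g : Y ⟶ Z) [Epi g]
    (h : ∃ k : K ⟶ L, Epi k ∧ k ≫ l = κ ≫ (g ⊗ₘ g)) (h' : ∃ k : K ⟶ L, k ≫ l = κ ≫ (g ⊗ₘ g))
    {n : ℕ} {D : C} (x : quadAlg κ n ⟶ D)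
    (hx : ∃ y, tpowMap g n ≫ y = quadπ κ n ≫ x) : ∃ y, quadMap κ l g h' n ≫ y = x := by
  obtain ⟨y, hy⟩ := hx
  obtain ⟨k, _, hk⟩ := h
  -- The map `y` must kill the relations of `Z`. Since `k` and the powers of `g` are epi, it is
  -- enough to test this on relations of `Y`, which die in `quadAlg κ n`.
  obtain ⟨z, hz⟩ : ∃ z : quadAlg l n ⟶ D, quadπ l n ≫ z = y := by
    refine ⟨cokernel.desc _ y (quadIdeal_arrow_comp l y fun i j => ?_), cokernel.π_desc _ _ _⟩
    rw [← cancel_epi ((tpowMap g i ⊗ₘ k) ⊗ₘ tpowMap g j), ← Category.assoc,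
      ← relMap_natural κ l g k hk, Category.assoc, hy, ← Category.assoc, relMap_comp_quadπ,
      zero_comp, comp_zero]
  refine ⟨z, ?_⟩
  rw [← cancel_epi (quadπ κ n), ← Category.assoc, quadπ_quadMap, Category.assoc, hz, hy]

end Quadratic

/-! ### The filtration of the tensor powers -/

section Filtration

variable {C : Type u} [Category.{v} C] [Abelian C] [MonoidalCategory C] {X Y : C}

theorem arrow_comp_eq_zero_iff_le {A D : C} (S : Subobject A) (h : A ⟶ D) :
    S.arrow ≫ h = 0 ↔ S ≤ kernelSubobject h := by
  constructor
  · intro hh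
    refine Subobject.le_of_comm (factorThruKernelSubobject h S.arrow hh) (by simp)
  · intro hle
    rw [← Subobject.ofLE_arrow hle, Category.assoc, kernelSubobject_arrow_comp, comp_zero]

/-- The filtration is a supremum of images of words, so maps out of it are controlled word by word.
It is used almost only through this criterion and its recursive form below. -/
theorem tpowFilt_arrow_comp_iff (f : X ⟶ Y) (i n : ℕ) {D : C} (h : tpow Y n ⟶ D) :
    (tpowFilt f i n).arrow ≫ h = 0 ↔
      ∀ s : Finset ℕ, s ⊆ Finset.range n → i ≤ s.card → wordMap f s n ≫ h = 0 := by
  rw [arrow_comp_eq_zero_iff_le, tpowFilt, Finset.sup_le_iff]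
  simp only [Finset.mem_filter, Finset.mem_powerset, and_imp]
  refine forall_congr' fun s => imp_congr_right fun _ => imp_congr_right fun _ => ?_
  rw [← arrow_comp_eq_zero_iff_le]
  constructor
  · intro hh
    rw [← imageSubobject_arrow_comp (wordMap f s n), Category.assoc, hh, comp_zero]
  · intro hh
    rw [← cancel_epi (factorThruImageSubobject (wordMap f s n)), ← Category.assoc,
      imageSubobject_arrow_comp, hh, comp_zero]

/-- Needed to add or remove position `n` in `s` without changing the first `n` letters, which are
then equal but not definitionally so. -/
theorem wordMap_congr (f : X ⟶ Y) {s t : Finset ℕ} : ∀ {n : ℕ}, (∀ m < n, m ∈ s ↔ m ∈ t) →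
    ∃ r : word X Y s n ⟶ word X Y t n, r ≫ wordMap f t n = wordMap f s n
  | 0, _ => ⟨𝟙 _, Category.id_comp _⟩
  | n + 1, h => by
    obtain ⟨r, hr⟩ := wordMap_congr f (n := n) fun m hm => h m (by omega)
    have hb : decide (n ∈ s) = decide (n ∈ t) := by simp [h n (by omega)]
    have : ∃ l : letter X Y (decide (n ∈ s)) ⟶ letter X Y (decide (n ∈ t)),
        l ≫ letterMap f (decide (n ∈ t)) = letterMap f (decide (n ∈ s)) := by
      rw [hb]; exact ⟨𝟙 _, Category.id_comp _⟩
    obtain ⟨l, hl⟩ := this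
    exact ⟨r ⊗ₘ l, by
      change (r ⊗ₘ l) ≫ (wordMap f t n ⊗ₘ letterMap f (decide (n ∈ t))) =
        wordMap f s n ⊗ₘ letterMap f (decide (n ∈ s))
      rw [tensorHom_comp_tensorHom, hr, hl]⟩

/-- The identification of `Y^{⊗n} ⊗ Y` with `Y^{⊗(n+1)}`. -/
def tsnoc (Y : C) (n : ℕ) : tpow Y n ⊗ Y ⟶ tpow Y (n + 1) := 𝟙 _

instance (Y : C) (n : ℕ) : IsIso (tsnoc Y n) := inferInstanceAs (IsIso (𝟙 _))

theorem wordMap_succ_of_mem (f : X ⟶ Y) {s : Finset ℕ} {n : ℕ} (hn : n ∈ s) {D : C}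
    (h : tpow Y (n + 1) ⟶ D) :
    wordMap f s (n + 1) ≫ h = 0 ↔ (wordMap f s n ⊗ₘ f) ≫ tsnoc Y n ≫ h = 0 := by
  have e : tsnoc Y n ≫ h = h := Category.id_comp h
  rw [e]
  change (wordMap f s n ⊗ₘ letterMap f (decide (n ∈ s))) ≫ h = 0 ↔ _
  have hb : decide (n ∈ s) = true := by simpa using hn
  rw [hb]
  rfl

theorem wordMap_succ_of_notMem (f : X ⟶ Y) {s : Finset ℕ} {n : ℕ} (hn : n ∉ s) {D : C}
    (h : tpow Y (n + 1) ⟶ D) :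
    wordMap f s (n + 1) ≫ h = 0 ↔ wordMap f s n ▷ Y ≫ tsnoc Y n ≫ h = 0 := by
  have e : tsnoc Y n ≫ h = h := Category.id_comp h
  rw [e]
  change (wordMap f s n ⊗ₘ letterMap f (decide (n ∈ s))) ≫ h = 0 ↔ _
  have hb : decide (n ∈ s) = false := by simpa using hn
  rw [hb, ← tensorHom_id]
  rfl

theorem tsnoc_tpowMap {Z : C} (g : Y ⟶ Z) (n : ℕ) :
    tsnoc Y n ≫ tpowMap g (n + 1) = (tpowMap g n ⊗ₘ g) ≫ tsnoc Z n :=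
  (Category.id_comp _).trans (Category.comp_id _).symm

variable [MonoidalPreadditive C]

theorem whiskerLeft_tsnoc_tmul (Y : C) (m n k : ℕ) :
    tpow Y m ◁ tsnoc Y n ≫ tmul Y m (n + 1) (k + 1) =
      (α_ _ _ _).inv ≫ tmul Y m n k ▷ Y ≫ tsnoc Y k := by
  rw [tmul_succ]
  have e1 : tmul Y m n k ▷ Y ≫ tsnoc Y k = tmul Y m n k ▷ Y := Category.comp_id _
  have e2 : tpow Y m ◁ tsnoc Y n = 𝟙 _ := whiskerLeft_id _ _
  rw [e1, e2]
  exact Category.id_comp _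

theorem tsnoc_tcomulR [BraidedCategory C] (ε : ℤ) (Y : C) (n i j : ℕ) :
    tsnoc Y n ≫ tcomulR ε Y n i j = insR Y (tcomul ε Y n i j) ≫ _ ◁ tsnoc Y j := by
  have e2 : tpow Y i ◁ tsnoc Y j = 𝟙 _ := whiskerLeft_id _ _
  rw [e2]
  exact (Category.id_comp _).trans (Category.comp_id _).symm

theorem tsnoc_tcomulL [BraidedCategory C] (ε : ℤ) (Y : C) (n i j : ℕ) :
    tsnoc Y n ≫ tcomulL ε Y n i j = ε ^ j • (insL Y (tcomul ε Y n i j) ≫ tsnoc Y i ▷ _) := by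
  have e2 : tsnoc Y i ▷ tpow Y j = 𝟙 _ := id_whiskerRight _ _
  rw [e2]
  exact (Category.id_comp _).trans (congrArg _ (Category.comp_id _)).symm

variable [RigidCategory C]

/-- `Fⁱ(Y^{⊗(n+1)})` is spanned by `Fⁱ(Y^{⊗n}) ⊗ Y` and `Fⁱ⁻¹(Y^{⊗n}) ⊗ X`. -/
theorem tpowFilt_succ_arrow_comp_iff (f : X ⟶ Y) (i n : ℕ) {D : C} (h : tpow Y (n + 1) ⟶ D) :
    (tpowFilt f i (n + 1)).arrow ≫ h = 0 ↔ (tpowFilt f i n).arrow ▷ Y ≫ tsnoc Y n ≫ h = 0 ∧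
      ((tpowFilt f (i - 1) n).arrow ⊗ₘ f) ≫ tsnoc Y n ≫ h = 0 := by
  -- Moving the last tensor factor into the target makes both conditions statements about maps out
  -- of `tpow Y n`, where the criterion on words applies.
  obtain ⟨D₁, h₁, hh₁⟩ := exists_whiskerRight_test (tsnoc Y n ≫ h)
  obtain ⟨D₂, h₂, hh₂⟩ := exists_whiskerRight_test (tpow Y n ◁ f ≫ tsnoc Y n ≫ h)
  simp only [← MonoidalCategory.tensorHom_def_assoc] at hh₂
  rw [hh₁, hh₂, tpowFilt_arrow_comp_iff, tpowFilt_arrow_comp_iff, tpowFilt_arrow_comp_iff]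
  simp only [← hh₁, ← hh₂]
  constructor
  · intro H
    refine ⟨fun s hs hi => ?_, fun s hs hi => ?_⟩
    · have hn : n ∉ s := fun hn => by simpa using hs hn
      rw [← wordMap_succ_of_notMem f hn]
      exact H s (hs.trans (Finset.range_subset_range.2 (Nat.le_succ n))) hi
    · have hn : n ∉ s := fun hn => by simpa using hs hn
      -- Adding `n` to `s` puts `X` in the last position. For `i = 0` the truncated `i - 1` is again
      -- zero, which imposes no condition on `s`.
      obtain ⟨r, hr⟩ := wordMap_congr f (s := s) (t := insert n s) (n := n) fun m hm => by
        simp [hm.ne]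
      have h1 := H (insert n s) (Finset.insert_subset (by simp)
        (hs.trans (Finset.range_subset_range.2 (Nat.le_succ n))))
        (by rw [Finset.card_insert_of_notMem hn]; omega)
      rw [wordMap_succ_of_mem f (Finset.mem_insert_self _ _)] at h1
      rw [← hr, ← Category.id_comp f, ← tensorHom_comp_tensorHom, Category.assoc,
        Category.id_comp, h1, comp_zero]
  · rintro ⟨H1, H2⟩ s hs hi
    by_cases hn : n ∈ s
    · rw [wordMap_succ_of_mem f hn]
      obtain ⟨r, hr⟩ := wordMap_congr f (s := s) (t := s.erase n) (n := n) fun m hm => by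
        simp [hm.ne]
      have h1 := H2 (s.erase n) (fun m hm => by
        have := Finset.mem_range.1 (hs (Finset.mem_of_mem_erase hm))
        have := Finset.ne_of_mem_erase hm
        exact Finset.mem_range.2 (by omega)) (by rw [Finset.card_erase_of_mem hn]; omega)
      rw [← hr, ← Category.id_comp f, ← tensorHom_comp_tensorHom, Category.assoc,
        Category.id_comp, h1, comp_zero]
    · rw [wordMap_succ_of_notMem f hn]
      refine H1 s (fun m hm => ?_) hi
      have := Finset.mem_range.1 (hs hm)
      have : m ≠ n := fun h => hn (h ▸ hm)
      exact Finset.mem_range.2 (by omega)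

instance tpowFilt_zero_epi (f : X ⟶ Y) (n : ℕ) : Epi (tpowFilt f 0 n).arrow := by
  induction n with
  | zero =>
    refine Preadditive.epi_of_cancel_zero _ fun h hh => ?_
    rw [tpowFilt_arrow_comp_iff] at hh
    have h1 := hh ∅ (by simp) (by simp)
    exact (Category.id_comp h).symm.trans h1
  | succ n ih =>
    refine Preadditive.epi_of_cancel_zero _ fun h hh => ?_
    have := ((tpowFilt_succ_arrow_comp_iff f 0 n h).1 hh).1
    rwa [← cancel_epi (tsnoc Y n), ← cancel_epi ((tpowFilt f 0 n).arrow ▷ Y), comp_zero,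
      comp_zero]

theorem tpowFilt_arrow_eq_zero (f : X ⟶ Y) {i n : ℕ} (h : n < i) : (tpowFilt f i n).arrow = 0 := by
  rw [← Category.comp_id (tpowFilt f i n).arrow, tpowFilt_arrow_comp_iff]
  intro s hs hi
  have := Finset.card_le_card hs
  rw [Finset.card_range] at this
  omega

theorem tpowFilt_le (f : X ⟶ Y) {i j : ℕ} (h : i ≤ j) (n : ℕ) : tpowFilt f j n ≤ tpowFilt f i n :=
  antitone_nat_of_succ_le (f := fun i => tpowFilt f i n) (fun i => tpowFilt_succ_le f i n) h

/-- Identifies `Fⁿ(Y^{⊗n})` with the image of `X^{⊗n}`: in the recursion the summand `Fⁿ⁺¹(Y^{⊗n}) ⊗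
Y` is zero and only `Fⁿ(Y^{⊗n}) ⊗ X` survives. -/
theorem tpowFilt_self_arrow_comp_iff (f : X ⟶ Y) (n : ℕ) {D : C} (h : tpow Y n ⟶ D) :
    (tpowFilt f n n).arrow ≫ h = 0 ↔ tpowMap f n ≫ h = 0 := by
  induction n generalizing D with
  | zero =>
    have e : tpowMap f 0 ≫ h = h := Category.id_comp h
    refine ⟨fun h1 => e.trans ((cancel_epi (tpowFilt f 0 0).arrow).1 (h1.trans comp_zero.symm)),
      fun h1 => ?_⟩
    have h2 : h = 0 := e.symm.trans h1
    rw [h2, comp_zero]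
  | succ n ih =>
    rw [tpowFilt_succ_arrow_comp_iff f (n + 1) n h, tpowFilt_arrow_eq_zero f (Nat.lt_succ_self n),
      ← cancel_epi (tsnoc X n) (g := tpowMap f (n + 1) ≫ h), ← Category.assoc (tsnoc X n),
      tsnoc_tpowMap, Category.assoc, comp_zero]
    obtain ⟨D₂, h₂, hh₂⟩ := exists_whiskerRight_test (tpow Y n ◁ f ≫ tsnoc Y n ≫ h)
    simp only [← MonoidalCategory.tensorHom_def_assoc] at hh₂
    rw [hh₂, Nat.add_sub_cancel, ih, ← hh₂]
    simp only [MonoidalPreadditive.zero_whiskerRight, zero_comp, true_and]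

/-- The quotient map of `Y^{⊗n}` by `Fⁱ`. -/
def tpowFiltπ (f : X ⟶ Y) (i n : ℕ) : tpow Y n ⟶ cokernel (tpowFilt f i n).arrow := cokernel.π _

instance (f : X ⟶ Y) (i n : ℕ) : Epi (tpowFiltπ f i n) := inferInstanceAs (Epi (cokernel.π _))

theorem tpowFilt_arrow_comp_π (f : X ⟶ Y) {i j : ℕ} (h : i ≤ j) (n : ℕ) :
    (tpowFilt f j n).arrow ≫ tpowFiltπ f i n = 0 := by
  rw [← Subobject.ofLE_arrow (tpowFilt_le f h n), Category.assoc, tpowFiltπ, cokernel.condition,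
    comp_zero]

theorem tpowFiltπ_zero (f : X ⟶ Y) (n : ℕ) : tpowFiltπ f 0 n = 0 := by
  rw [← cancel_epi (tpowFilt f 0 n).arrow, tpowFilt_arrow_comp_π f le_rfl, comp_zero]

theorem exists_desc_whiskerRight {A B D K M : C} (q : A ⟶ B) [Epi q] (i : K ⟶ A)
    (hd : ∀ {D : C} (h : A ⟶ D), i ≫ h = 0 → ∃ h', q ≫ h' = h)
    (h : A ⊗ M ⟶ D) (h1 : i ▷ M ≫ h = 0) : ∃ h' : B ⊗ M ⟶ D, q ▷ M ≫ h' = h := by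
  obtain ⟨h', hh⟩ := exists_desc_tensor q (𝟙 M) i (0 : M ⟶ M) hd
    (fun h _ => ⟨h, Category.id_comp h⟩) h h1 (by simp)
  exact ⟨h', by rwa [tensorHom_id] at hh⟩

theorem exists_desc_tpowFiltπ (f : X ⟶ Y) {i n : ℕ} {D : C} (h : tpow Y n ⟶ D)
    (hh : (tpowFilt f i n).arrow ≫ h = 0) : ∃ h', tpowFiltπ f i n ≫ h' = h :=
  ⟨cokernel.desc _ h hh, cokernel.π_desc _ _ _⟩

/-- Appending a letter of `Y` preserves the filtration, so it acts on the quotients. By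
`exists_tpowFiltπ_mul'` a letter of `X` raises the filtration by one. -/
theorem exists_tpowFiltπ_mul (f : X ⟶ Y) (i n : ℕ) :
    ∃ r, tpowFiltπ f i n ▷ Y ≫ r = tsnoc Y n ≫ tpowFiltπ f i (n + 1) :=
  exists_desc_whiskerRight _ (tpowFilt f i n).arrow (exists_desc_tpowFiltπ f) _
    ((tpowFilt_succ_arrow_comp_iff f i n _).1 (tpowFilt_arrow_comp_π f le_rfl (n + 1))).1

theorem exists_tpowFiltπ_mul' (f : X ⟶ Y) (i n : ℕ) :
    ∃ r, tpowFiltπ f (i - 1) n ▷ X ≫ r = tpow Y n ◁ f ≫ tsnoc Y n ≫ tpowFiltπ f i (n + 1) :=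
  exists_desc_whiskerRight _ (tpowFilt f (i - 1) n).arrow (exists_desc_tpowFiltπ f) _ (by
      rw [← MonoidalCategory.tensorHom_def_assoc]
      exact ((tpowFilt_succ_arrow_comp_iff f i n _).1 (tpowFilt_arrow_comp_π f le_rfl (n + 1))).2)

/-- The filtration is multiplicative. -/
theorem tpowFilt_tmul (f : X ⟶ Y) {a b c : ℕ} (hc : c ≤ a + b) (m n k : ℕ) :
    ((tpowFilt f a m).arrow ⊗ₘ (tpowFilt f b n).arrow) ≫ tmul Y m n k ≫ tpowFiltπ f c k = 0 := by
  induction n generalizing b c k with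
  | zero =>
    by_cases hk : m = k
    · subst hk
      rcases b with _ | b
      · obtain ⟨r, h1⟩ : ∃ r, (tpowFilt f a m).arrow ▷ tpow Y 0 ≫ tmul Y m 0 m =
            r ≫ (tpowFilt f a m).arrow := ⟨(ρ_ _).hom, by
          rw [tmul_zero]
          exact rightUnitor_naturality _⟩
        rw [MonoidalCategory.tensorHom_def', Category.assoc, reassoc_of% h1,
          tpowFilt_arrow_comp_π f (by omega)]
        simp
      · rw [tpowFilt_arrow_eq_zero f (Nat.succ_pos b)]
        simp
    · rw [tmul_deg Y m 0 k (by omega)]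
      simp
  | succ n ih =>
    rcases k with _ | k
    · rw [tmul_deg Y m (n + 1) 0 (by omega)]
      simp
    -- Transposing the left factor leaves a condition on `Fᵇ(Y^{⊗(n+1)})`, to which the recursion on
    -- the last letter applies.
    · obtain ⟨D, h, hh⟩ := exists_whiskerLeft_test
        ((tpowFilt f a m).arrow ▷ tpow Y (n + 1) ≫ tmul Y m (n + 1) (k + 1) ≫
          tpowFiltπ f c (k + 1))
      rw [MonoidalCategory.tensorHom_def', Category.assoc, hh]
      have key : ∀ {E : C} (x : E ⟶ tpow Y n ⊗ Y),
          _ ◁ (x ≫ tsnoc Y n) ≫ (tpowFilt f a m).arrow ▷ tpow Y (n + 1) ≫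
            tmul Y m (n + 1) (k + 1) ≫ tpowFiltπ f c (k + 1) =
          _ ◁ x ≫ (tpowFilt f a m).arrow ▷ (tpow Y n ⊗ Y) ≫ (α_ _ _ _).inv ≫
            tmul Y m n k ▷ Y ≫ tsnoc Y k ≫ tpowFiltπ f c (k + 1) := fun x => by
        rw [whiskerLeft_comp, Category.assoc, whisker_exchange_assoc,
          reassoc_of% whiskerLeft_tsnoc_tmul]
      refine (tpowFilt_succ_arrow_comp_iff f b n h).2 ⟨?_, ?_⟩
      · rw [← Category.assoc, ← hh, key]
        obtain ⟨r, hr⟩ := exists_tpowFiltπ_mul f c k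
        rw [← hr]
        have h2 := congrArg (fun x => x ▷ Y) (ih hc k)
        simp only [MonoidalPreadditive.zero_whiskerRight, comp_whiskerRight] at h2
        rw [associator_inv_naturality_left_assoc,
          associator_inv_naturality_middle_assoc, ← comp_whiskerRight_assoc,
          ← MonoidalCategory.tensorHom_def', reassoc_of% h2, zero_comp, comp_zero]
      · rw [← Category.assoc, ← hh, key]
        -- The last letter is in `X`: the induction hypothesis is used with `b - 1` and `c - 1`, and
        -- the letter raises `c - 1` back to `c`.
        obtain ⟨r, hr⟩ := exists_tpowFiltπ_mul' f c k
        have h2 := congrArg (fun x => x ▷ X) (ih (b := b - 1) (c := c - 1) (by omega) k)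
        simp only [MonoidalPreadditive.zero_whiskerRight, comp_whiskerRight] at h2
        rw [← MonoidalCategory.tensorHom_def'_assoc, associator_inv_naturality_assoc,
          MonoidalCategory.tensorHom_def (_ ⊗ₘ _) f, Category.assoc, whisker_exchange_assoc,
          ← hr, reassoc_of% h2, zero_comp, comp_zero]

theorem insR_comp_eq_zero {E A D A' D' D'' W : C} {d : E ⟶ A ⊗ D} {x : A ⟶ A'} {y : D ⟶ D'}
    (h : d ≫ (x ⊗ₘ y) = 0) {s : D ⊗ W ⟶ D''} (hs : ∃ r, y ▷ W ≫ r = s) :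
    insR W d ≫ (x ⊗ₘ s) = 0 := by
  obtain ⟨r, rfl⟩ := hs
  have h1 := insR_natural (t := (0 : E ⟶ E)) (d := d) (d' := 0) (a := x) (b := y) (𝟙 W)
    (by rw [h, zero_comp])
  rw [← Category.comp_id x, ← tensorHom_comp_tensorHom, ← tensorHom_id y, ← Category.assoc, ← h1,
    MonoidalPreadditive.zero_tensor, zero_comp, zero_comp]

theorem insL_comp_eq_zero [BraidedCategory C] {E A D A' D' A'' W : C} {d : E ⟶ A ⊗ D}
    {x : A ⟶ A'} {y : D ⟶ D'}
    (h : d ≫ (x ⊗ₘ y) = 0) {s : A ⊗ W ⟶ A''} (hs : ∃ r, x ▷ W ≫ r = s) :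
    insL W d ≫ (s ⊗ₘ y) = 0 := by
  obtain ⟨r, rfl⟩ := hs
  have h1 := insL_natural (t := (0 : E ⟶ E)) (d := d) (d' := 0) (a := x) (b := y) (𝟙 W)
    (by rw [h, zero_comp])
  rw [← Category.comp_id y, ← tensorHom_comp_tensorHom, ← tensorHom_id x, ← Category.assoc, ← h1,
    MonoidalPreadditive.zero_tensor, zero_comp, zero_comp]

section

variable [BraidedCategory C] {ε : ℤ} (f : X ⟶ Y) {a b c n i j : ℕ}

/-- The condition `a + b ≤ c + 1` encodes `Δ(Fᶜ) ⊆ ∑ Fᵘ ⊗ Fᵛ` over `u + v = c` without sums of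
subobjects: it forces `u ≥ a` or `v ≥ b`, so every summand dies in the product of the quotients by
`Fᵃ` and `Fᵇ`. -/
theorem tpowFilt_tcomulR
    (ih : ∀ {a b c : ℕ}, a + b ≤ c + 1 →
      (tpowFilt f c n).arrow ≫ tcomul ε Y n i j ≫ (tpowFiltπ f a i ⊗ₘ tpowFiltπ f b j) = 0)
    (hc : a + b ≤ c + 1) (hb : b ≠ 0) :
    (tpowFilt f c (n + 1)).arrow ≫ tcomulR ε Y n i j ≫
      (tpowFiltπ f a i ⊗ₘ tpowFiltπ f b (j + 1)) = 0 := by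
  have h0 : tsnoc Y n ≫ tcomulR ε Y n i j ≫ (tpowFiltπ f a i ⊗ₘ tpowFiltπ f b (j + 1)) =
      insR Y (tcomul ε Y n i j) ≫ (tpowFiltπ f a i ⊗ₘ (tsnoc Y j ≫ tpowFiltπ f b (j + 1))) := by
    rw [reassoc_of% tsnoc_tcomulR, ← id_tensorHom, tensorHom_comp_tensorHom, Category.id_comp]
  refine (tpowFilt_succ_arrow_comp_iff f c n _).2 ⟨?_, ?_⟩
  · have h1 := insR_natural (t := (tpowFilt f c n).arrow) (d' := tcomul ε Y n i j)
      (d := (tpowFilt f c n).arrow ≫ tcomul ε Y n i j) (a := 𝟙 _) (b := 𝟙 _) (𝟙 Y) (by simp)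
    rw [id_tensorHom_id, id_tensorHom_id, Category.comp_id, tensorHom_id] at h1
    rw [h0, reassoc_of% h1]
    exact insR_comp_eq_zero (by rw [Category.assoc]; exact ih hc) (exists_tpowFiltπ_mul f b j)
  · have h1 := insR_natural (t := (tpowFilt f (c - 1) n).arrow) (d' := tcomul ε Y n i j)
      (d := (tpowFilt f (c - 1) n).arrow ≫ tcomul ε Y n i j) (a := 𝟙 _) (b := 𝟙 _) f (by simp)
    rw [h0, reassoc_of% h1, tensorHom_comp_tensorHom, Category.id_comp, id_tensorHom]
    -- The letter lies in `X` and joins the second factor, so `c` and `b` both drop by one; this is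
    -- where `b ≠ 0` enters.
    exact insR_comp_eq_zero (by rw [Category.assoc]; exact ih (a := a) (by omega))
      (exists_tpowFiltπ_mul' f b j)

theorem tpowFilt_tcomulL
    (ih : ∀ {a b c : ℕ}, a + b ≤ c + 1 →
      (tpowFilt f c n).arrow ≫ tcomul ε Y n i j ≫ (tpowFiltπ f a i ⊗ₘ tpowFiltπ f b j) = 0)
    (hc : a + b ≤ c + 1) (ha : a ≠ 0) :
    (tpowFilt f c (n + 1)).arrow ≫ tcomulL ε Y n i j ≫
      (tpowFiltπ f a (i + 1) ⊗ₘ tpowFiltπ f b j) = 0 := by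
  have h0 : tsnoc Y n ≫ tcomulL ε Y n i j ≫ (tpowFiltπ f a (i + 1) ⊗ₘ tpowFiltπ f b j) =
      ε ^ j • (insL Y (tcomul ε Y n i j) ≫
        ((tsnoc Y i ≫ tpowFiltπ f a (i + 1)) ⊗ₘ tpowFiltπ f b j)) := by
    rw [reassoc_of% tsnoc_tcomulL, Preadditive.zsmul_comp, Category.assoc, ← tensorHom_id,
      tensorHom_comp_tensorHom, Category.id_comp]
  refine (tpowFilt_succ_arrow_comp_iff f c n _).2 ⟨?_, ?_⟩
  · have h1 := insL_natural (t := (tpowFilt f c n).arrow) (d' := tcomul ε Y n i j)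
      (d := (tpowFilt f c n).arrow ≫ tcomul ε Y n i j) (a := 𝟙 _) (b := 𝟙 _) (𝟙 Y) (by simp)
    rw [id_tensorHom_id, id_tensorHom_id, Category.comp_id, tensorHom_id] at h1
    rw [h0, Preadditive.comp_zsmul, reassoc_of% h1, insL_comp_eq_zero
      (by rw [Category.assoc]; exact ih hc) (exists_tpowFiltπ_mul f a i), smul_zero]
  · have h1 := insL_natural (t := (tpowFilt f (c - 1) n).arrow) (d' := tcomul ε Y n i j)
      (d := (tpowFilt f (c - 1) n).arrow ≫ tcomul ε Y n i j) (a := 𝟙 _) (b := 𝟙 _) f (by simp)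
    rw [h0, Preadditive.comp_zsmul, reassoc_of% h1, id_tensorHom, tensorHom_comp_tensorHom,
      Category.id_comp, insL_comp_eq_zero
      (by rw [Category.assoc]; exact ih (b := b) (by omega)) (exists_tpowFiltπ_mul' f a i),
      smul_zero]

/-- The comultiplication is compatible with the filtration. -/
theorem tpowFilt_tcomul (hc : a + b ≤ c + 1) :
    (tpowFilt f c n).arrow ≫ tcomul ε Y n i j ≫ (tpowFiltπ f a i ⊗ₘ tpowFiltπ f b j) = 0 := by
  induction n generalizing a b c i j with
  | zero =>
    rcases Nat.eq_zero_or_pos a with rfl | ha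
    · rw [tpowFiltπ_zero]; simp
    rcases Nat.eq_zero_or_pos b with rfl | hb
    · rw [tpowFiltπ_zero]; simp
    rw [tpowFilt_arrow_eq_zero f (i := c) (n := 0) (by omega), zero_comp]
  | succ n ih =>
    rcases Nat.eq_zero_or_pos a with rfl | ha
    · rw [tpowFiltπ_zero]; simp
    rcases Nat.eq_zero_or_pos b with rfl | hb
    · rw [tpowFiltπ_zero]; simp
    rcases i with _ | i <;> rcases j with _ | j
    · rw [tcomul_succ_zero_zero, zero_comp, comp_zero]
    · exact tpowFilt_tcomulR f ih hc hb.ne'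
    · rw [tcomul_succ_succ_zero]
      exact tpowFilt_tcomulL f ih hc ha.ne'
    · rw [tcomul_succ_succ_succ, Preadditive.add_comp, Preadditive.comp_add,
        tpowFilt_tcomulR f ih hc hb.ne', tpowFilt_tcomulL f ih hc ha.ne', add_zero]

end

/-- The kernel of `Y^{⊗n} ⟶ Z^{⊗n}` is the first step of the filtration. -/
theorem exists_tpowMap_desc {Z : C} {f : X ⟶ Y} {g : Y ⟶ Z} [Epi g]
    (hd : ∀ {D : C} (h : Y ⟶ D), f ≫ h = 0 → ∃ h', g ≫ h' = h) (n : ℕ) {D : C}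
    (h : tpow Y n ⟶ D) (hh : (tpowFilt f 1 n).arrow ≫ h = 0) : ∃ h', tpowMap g n ≫ h' = h := by
  induction n generalizing D with
  | zero => exact ⟨h, Category.id_comp _⟩
  | succ n ih =>
    obtain ⟨h1, h2⟩ := (tpowFilt_succ_arrow_comp_iff f 1 n h).1 hh
    -- For `i = 1` the second part of the recursion involves `F⁰`, which is everything. So `h` kills
    -- `F¹ ⊗ Y` and `Y^{⊗n} ⊗ X`, the two parts of the kernel.
    have h3 : tpow Y n ◁ f ≫ tsnoc Y n ≫ h = 0 := by
      rw [MonoidalCategory.tensorHom_def, Category.assoc] at h2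
      exact (cancel_epi ((tpowFilt f 0 n).arrow ▷ X)).1 (h2.trans comp_zero.symm)
    obtain ⟨h', hh'⟩ := exists_desc_tensor (tpowMap g n) g (tpowFilt f 1 n).arrow f
      (fun h hh => ih h hh) hd _ h1 h3
    refine ⟨inv (tsnoc Z n) ≫ h', ?_⟩
    rw [← cancel_epi (tsnoc Y n), ← hh', reassoc_of% tsnoc_tpowMap, IsIso.hom_inv_id_assoc]

theorem tpowFilt_one_arrow_comp_tpowMap {Z : C} {f : X ⟶ Y} {g : Y ⟶ Z} (w : f ≫ g = 0) (n : ℕ) :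
    (tpowFilt f 1 n).arrow ≫ tpowMap g n = 0 := by
  induction n with
  | zero => rw [tpowFilt_arrow_eq_zero f Nat.one_pos, zero_comp]
  | succ n ih =>
    refine (tpowFilt_succ_arrow_comp_iff f 1 n _).2 ⟨?_, ?_⟩
    · rw [tsnoc_tpowMap, ← tensorHom_id, tensorHom_comp_tensorHom_assoc, ih,
        MonoidalPreadditive.zero_tensor, zero_comp]
    · rw [tsnoc_tpowMap, tensorHom_comp_tensorHom_assoc, w, MonoidalPreadditive.tensor_zero,
        zero_comp]

end Filtration

theorem exists_imageSubobject_fac {C : Type u} [Category.{v} C] [Abelian C] {A B : C} (g : A ⟶ B) :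
    ∃ e : A ⟶ (imageSubobject g : C), Epi e ∧ e ≫ (imageSubobject g).arrow = g :=
  ⟨factorThruImageSubobject g, inferInstance, imageSubobject_arrow_comp g⟩

/-! ### The filtration induced on a quotient bialgebra -/

section InducedFiltration

variable {C : Type u} [Category.{v} C] [Abelian C] [MonoidalCategory C] [MonoidalPreadditive C]
  [RigidCategory C] [BraidedCategory C] {X Y : C} {f : X ⟶ Y} {P : ℕ → C}
  {π : ∀ n, tpow Y n ⟶ P n}

theorem exists_tpowFilt_quotFilt (i n : ℕ) :
    ∃ e : (tpowFilt f i n : C) ⟶ quotFilt f π i n, Epi e ∧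
      e ≫ (quotFilt f π i n).arrow = (tpowFilt f i n).arrow ≫ π n :=
  exists_imageSubobject_fac _

theorem quotFilt_arrow_comp_iff (i n : ℕ) {D : C} (h : P n ⟶ D) :
    (quotFilt f π i n).arrow ≫ h = 0 ↔ (tpowFilt f i n).arrow ≫ π n ≫ h = 0 := by
  obtain ⟨e, _, he⟩ := exists_tpowFilt_quotFilt (f := f) (π := π) i n
  rw [← cancel_epi e, comp_zero, reassoc_of% he]

theorem quotFilt_le {i j : ℕ} (h : i ≤ j) (n : ℕ) : quotFilt f π j n ≤ quotFilt f π i n :=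
  antitone_nat_of_succ_le (f := fun i => quotFilt f π i n) (fun i => quotFilt_succ_le f π i n) h

instance quotFilt_zero_epi [∀ n, Epi (π n)] (n : ℕ) : Epi (quotFilt f π 0 n).arrow := by
  refine Preadditive.epi_of_cancel_zero _ fun h hh => ?_
  rw [quotFilt_arrow_comp_iff] at hh
  rwa [← cancel_epi (π n), ← cancel_epi (tpowFilt f 0 n).arrow, comp_zero, comp_zero]

instance quotFilt_zero_isIso [∀ n, Epi (π n)] (n : ℕ) : IsIso (quotFilt f π 0 n).arrow :=
  isIso_of_mono_of_epi _

theorem quotFilt_arrow_eq_zero {i n : ℕ} (h : n < i) : (quotFilt f π i n).arrow = 0 := by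
  rw [← Category.comp_id (quotFilt f π i n).arrow, quotFilt_arrow_comp_iff,
    tpowFilt_arrow_eq_zero f h, zero_comp]

variable (f π) in
/-- The quotient map of `P n` by `Fⁱ`. -/
def filtπ (i n : ℕ) : P n ⟶ cokernel (quotFilt f π i n).arrow := cokernel.π _

theorem quotFilt_arrow_comp_π {i j : ℕ} (h : i ≤ j) (n : ℕ) :
    (quotFilt f π j n).arrow ≫ filtπ f π i n = 0 := by
  rw [← Subobject.ofLE_arrow (quotFilt_le h n), Category.assoc, filtπ, cokernel.condition,
    comp_zero]

theorem exists_desc_filtπ {i n : ℕ} {D : C} (h : P n ⟶ D)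
    (hh : (quotFilt f π i n).arrow ≫ h = 0) : ∃ h', filtπ f π i n ≫ h' = h :=
  ⟨cokernel.desc _ h hh, cokernel.π_desc _ _ _⟩

theorem exists_lift_quotFilt {i n : ℕ} {E : C} (x : E ⟶ P n) (hx : x ≫ filtπ f π i n = 0) :
    ∃ y, y ≫ (quotFilt f π i n).arrow = x :=
  ⟨Abelian.monoLift (quotFilt f π i n).arrow x hx, Abelian.monoLift_comp _ _ _⟩

theorem filtπ_mono {i n : ℕ} (h : n < i) : Mono (filtπ f π i n) := by
  refine Preadditive.mono_of_cancel_zero _ fun x hx => ?_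
  obtain ⟨y, rfl⟩ := exists_lift_quotFilt x hx
  rw [quotFilt_arrow_eq_zero h, comp_zero]

theorem exists_tpowFiltπ_filtπ (i n : ℕ) : ∃ r, tpowFiltπ f i n ≫ r = π n ≫ filtπ f π i n :=
  exists_desc_tpowFiltπ f _ ((quotFilt_arrow_comp_iff i n _).1 (quotFilt_arrow_comp_π le_rfl n))

theorem tensorHom_desc_eq_zero {E A A' B B' D D' : C} {d : E ⟶ A ⊗ A'} {q : A ⟶ B} {q' : A' ⟶ B'}
    (h : d ≫ (q ⊗ₘ q') = 0) {s : A ⟶ D} {s' : A' ⟶ D'} (hs : ∃ r, q ≫ r = s)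
    (hs' : ∃ r, q' ≫ r = s') : d ≫ (s ⊗ₘ s') = 0 := by
  obtain ⟨r, rfl⟩ := hs
  obtain ⟨r', rfl⟩ := hs'
  rw [← tensorHom_comp_tensorHom, reassoc_of% h, zero_comp]

variable {ε : ℤ} {H : GradedBialgData P}

theorem quotFilt_mul (h : (tensorAlgebraData ε Y).IsHom H π) {a b c : ℕ} (hc : c ≤ a + b)
    (m n k : ℕ) :
    ((quotFilt f π a m).arrow ⊗ₘ (quotFilt f π b n).arrow) ≫ H.mul m n k ≫ filtπ f π c k = 0 := by
  obtain ⟨e, _, he⟩ := exists_tpowFilt_quotFilt (f := f) (π := π) a m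
  obtain ⟨e', _, he'⟩ := exists_tpowFilt_quotFilt (f := f) (π := π) b n
  obtain ⟨r, hr⟩ := exists_tpowFiltπ_filtπ (f := f) (π := π) c k
  have h1 : tmul Y m n k ≫ π k = (π m ⊗ₘ π n) ≫ H.mul m n k := h.mul m n k
  rw [← cancel_epi (e ⊗ₘ e'), tensorHom_comp_tensorHom_assoc, he, he', ← tensorHom_comp_tensorHom,
    Category.assoc, ← reassoc_of% h1, ← hr, reassoc_of% tpowFilt_tmul f hc m n k, zero_comp,
    comp_zero]

theorem quotFilt_comul (h : (tensorAlgebraData ε Y).IsHom H π) {a b c : ℕ} (hc : a + b ≤ c + 1)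
    (n i j : ℕ) :
    (quotFilt f π c n).arrow ≫ H.comul n i j ≫ (filtπ f π a i ⊗ₘ filtπ f π b j) = 0 := by
  have h1 : tcomul ε Y n i j ≫ (π i ⊗ₘ π j) = π n ≫ H.comul n i j := h.comul n i j
  rw [quotFilt_arrow_comp_iff, ← reassoc_of% h1, tensorHom_comp_tensorHom]
  have h2 := tpowFilt_tcomul (ε := ε) f (n := n) (i := i) (j := j) hc
  rw [← Category.assoc] at h2 ⊢
  exact tensorHom_desc_eq_zero h2 (exists_tpowFiltπ_filtπ a i) (exists_tpowFiltπ_filtπ b j)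

theorem whiskerLeft_toTpowOne_tmul (Y : C) (n : ℕ) :
    tpow Y n ◁ toTpowOne Y ≫ tmul Y n 1 (n + 1) = tsnoc Y n := by
  rw [tmul_one_eq_whiskerLeft]
  refine (whiskerLeft_comp _ _ _).symm.trans ((congrArg (fun x => tpow Y n ◁ x) ?_).trans
    (whiskerLeft_id _ _))
  exact Iso.inv_hom_id _

theorem toTpowOne_tpowMap (f : X ⟶ Y) : toTpowOne X ≫ tpowMap f 1 = f ≫ toTpowOne Y := by
  change (λ_ X).inv ≫ (𝟙 (𝟙_ C) ⊗ₘ f) = f ≫ (λ_ Y).inv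
  simp

/-- `Fⁱ(P (n + 1))` is spanned by `Fⁱ(P n) P 1` and `Fⁱ⁻¹(P n) F¹(P 1)`. -/
theorem quotFilt_arrow_comp_eq_zero [∀ n, Epi (π n)] (h : (tensorAlgebraData ε Y).IsHom H π)
    {i n k : ℕ} (hk : n + 1 = k) {D : C} (x : P k ⟶ D)
    (h1 : (quotFilt f π i n).arrow ▷ P 1 ≫ H.mul n 1 k ≫ x = 0)
    (h2 : i ≠ 0 →
      ((quotFilt f π (i - 1) n).arrow ⊗ₘ (quotFilt f π 1 1).arrow) ≫ H.mul n 1 k ≫ x = 0) :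
    (quotFilt f π i k).arrow ≫ x = 0 := by
  subst hk
  -- At `i = 0` the truncated `i - 1` is `0`, and the second condition follows from the first.
  replace h2 : ((quotFilt f π (i - 1) n).arrow ⊗ₘ (quotFilt f π 1 1).arrow) ≫
      H.mul n 1 (n + 1) ≫ x = 0 := by
    rcases Nat.eq_zero_or_pos i with rfl | hi
    · rw [MonoidalCategory.tensorHom_def', Category.assoc, h1, comp_zero]
    · exact h2 hi.ne'
  have hm : tmul Y n 1 (n + 1) ≫ π (n + 1) = (π n ⊗ₘ π 1) ≫ H.mul n 1 (n + 1) := h.mul _ _ _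
  have hs : tsnoc Y n ≫ π (n + 1) = (π n ⊗ₘ (toTpowOne Y ≫ π 1)) ≫ H.mul n 1 (n + 1) := by
    rw [← whiskerLeft_toTpowOne_tmul, Category.assoc, hm, ← id_tensorHom,
      tensorHom_comp_tensorHom_assoc, Category.id_comp]
  rw [quotFilt_arrow_comp_iff, tpowFilt_succ_arrow_comp_iff, reassoc_of% hs]
  constructor
  · obtain ⟨e, _, he⟩ := exists_tpowFilt_quotFilt (f := f) (π := π) i n
    rw [← tensorHom_id, tensorHom_comp_tensorHom_assoc, ← he, Category.id_comp,
      ← Category.comp_id (toTpowOne Y ≫ π 1), ← tensorHom_comp_tensorHom, Category.assoc,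
      tensorHom_id, h1, comp_zero]
  · obtain ⟨e, _, he⟩ := exists_tpowFilt_quotFilt (f := f) (π := π) (i - 1) n
    obtain ⟨e', he'⟩ : ∃ e', e' ≫ (quotFilt f π 1 1).arrow = f ≫ toTpowOne Y ≫ π 1 := by
      refine exists_lift_quotFilt _ ?_
      have h3 := (tpowFilt_self_arrow_comp_iff f 1 _).1
        ((quotFilt_arrow_comp_iff (f := f) (π := π) 1 1 _).1 (quotFilt_arrow_comp_π le_rfl 1))
      rw [Category.assoc, Category.assoc, ← reassoc_of% toTpowOne_tpowMap, h3, comp_zero]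
    rw [tensorHom_comp_tensorHom_assoc, ← he, ← he', ← tensorHom_comp_tensorHom, Category.assoc,
      h2, comp_zero]

end InducedFiltration

/-! ### A graded bialgebra spread over bidegrees -/

namespace GradedBialgData

variable {C : Type u} [Category.{v} C] [Abelian C] [MonoidalCategory C] [MonoidalPreadditive C]
  {P : ℕ → C}

/-- A graded structure placed in all bidegrees with the given total degree. -/
def regrade (H : GradedBialgData P) : GradedBialgData fun a : ℕ × ℕ => P (a.1 + a.2) where
  mul a b c := if a + b = c then H.mul (a.1 + a.2) (b.1 + b.2) (c.1 + c.2) else 0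
  comul c a b := if a + b = c then H.comul (c.1 + c.2) (a.1 + a.2) (b.1 + b.2) else 0
  one a := H.one (a.1 + a.2)
  counit a := H.counit (a.1 + a.2)

variable {H : GradedBialgData P}

theorem regrade_mul {a b c : ℕ × ℕ} (h : a + b = c) :
    H.regrade.mul a b c = H.mul (a.1 + a.2) (b.1 + b.2) (c.1 + c.2) := if_pos h

theorem regrade_mul_deg {a b c : ℕ × ℕ} (h : a + b ≠ c) : H.regrade.mul a b c = 0 := if_neg h

theorem regrade_comul {a b c : ℕ × ℕ} (h : a + b = c) :
    H.regrade.comul c a b = H.comul (c.1 + c.2) (a.1 + a.2) (b.1 + b.2) := if_pos h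

theorem regrade_comul_deg {a b c : ℕ × ℕ} (h : a + b ≠ c) : H.regrade.comul c a b = 0 := if_neg h

theorem bidegree_add (a b : ℕ × ℕ) : a.1 + a.2 + (b.1 + b.2) = (a + b).1 + (a + b).2 := by
  rw [Prod.fst_add, Prod.snd_add]; omega

theorem bidegree_ne_zero {a : ℕ × ℕ} (h : a ≠ 0) : a.1 + a.2 ≠ 0 := fun h0 =>
  h (Prod.ext (by simp; omega) (by simp; omega))

/-- With `P (i + j)` placed in bidegree `(i, j)`, the pieces `Fⁱ` form a subalgebra and the `P/Fⁱ⁺¹`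
a quotient coalgebra of one bigraded structure, so the transfer lemmas apply. -/
theorem IsAlg.regrade (h : H.IsAlg) : H.regrade.IsAlg where
  mul_deg a b c hc := regrade_mul_deg hc
  one_deg a ha := h.one_deg _ (bidegree_ne_zero ha)
  mul_assoc a b c d := by
    by_cases hd : a + b + c = d
    · rw [regrade_mul rfl, regrade_mul rfl, regrade_mul hd, regrade_mul (by rw [← hd, add_assoc])]
      exact h.assoc (bidegree_add a b) (bidegree_add b c)
    · rw [regrade_mul_deg hd, regrade_mul_deg (a := a) (b := b + c) (by rwa [← add_assoc])]
      simp
  one_mul a := by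
    rw [regrade_mul (zero_add a)]
    exact h.one_mul _
  mul_one a := by
    rw [regrade_mul (add_zero a)]
    exact h.mul_one _

theorem IsCoalg.regrade (h : H.IsCoalg) : H.regrade.IsCoalg where
  comul_deg a b c hc := regrade_comul_deg hc
  counit_deg a ha := h.counit_deg _ (bidegree_ne_zero ha)
  comul_assoc d a b c := by
    by_cases hd : a + b + c = d
    · rw [regrade_comul rfl, regrade_comul rfl, regrade_comul hd,
        regrade_comul (by rw [← hd, add_assoc])]
      exact h.coassoc (bidegree_add a b) (bidegree_add b c)
    · rw [regrade_comul_deg hd, regrade_comul_deg (a := a) (b := b + c) (by rwa [← add_assoc])]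
      simp
  counit_comul a := by
    rw [regrade_comul (zero_add a)]
    exact h.counit_comul _
  comul_counit a := by
    rw [regrade_comul (add_zero a)]
    exact h.comul_counit _

end GradedBialgData

/-! ### The associated graded algebra and coalgebra -/

section AssociatedGraded

variable {C : Type u} [Category.{v} C] [Abelian C] [MonoidalCategory C] [MonoidalPreadditive C]
  [RigidCategory C] [BraidedCategory C] {X Y : C} {f : X ⟶ Y} {P : ℕ → C}
  {π : ∀ n, tpow Y n ⟶ P n}

instance (a : ℕ × ℕ) : Epi (grProj f π a) := inferInstanceAs (Epi (cokernel.π _))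

instance (a : ℕ × ℕ) : Epi (quotModProj f π a) := inferInstanceAs (Epi (cokernel.π _))

theorem grProj_grIncl (a : ℕ × ℕ) : grProj f π a ≫ grIncl f π a =
    (quotFilt f π a.1 (a.1 + a.2)).arrow ≫ quotModProj f π a := cokernel.π_desc _ _ _

theorem exists_desc_grProj {a : ℕ × ℕ} {D : C} (h : (quotFilt f π a.1 (a.1 + a.2) : C) ⟶ D)
    (hh : Subobject.ofLE _ _ (quotFilt_succ_le f π a.1 (a.1 + a.2)) ≫ h = 0) :
    ∃ h', grProj f π a ≫ h' = h :=
  ⟨cokernel.desc _ h hh, cokernel.π_desc _ _ _⟩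

/-- An element of `Fⁱ` that dies in `P/Fⁱ⁺¹` lies in `Fⁱ⁺¹`. The pullback along `grProj` supplies
representatives in `Fⁱ`. -/
instance grIncl_mono (a : ℕ × ℕ) : Mono (grIncl f π a) := by
  refine Preadditive.mono_of_cancel_zero _ fun {E} x hx => ?_
  have hc := pullback.condition (f := x) (g := grProj f π a)
  have h1 : (pullback.snd x (grProj f π a) ≫ (quotFilt f π a.1 (a.1 + a.2)).arrow) ≫
      quotModProj f π a = 0 := by
    rw [Category.assoc, ← grProj_grIncl, ← reassoc_of% hc, hx, comp_zero]
  obtain ⟨y, hy⟩ := exists_lift_quotFilt (i := a.1 + 1) _ h1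
  have h2 : y ≫ Subobject.ofLE _ _ (quotFilt_succ_le f π a.1 (a.1 + a.2)) =
      pullback.snd x (grProj f π a) := by
    rw [← cancel_mono (quotFilt f π a.1 (a.1 + a.2)).arrow, Category.assoc, Subobject.ofLE_arrow,
      hy]
  have h3 : Subobject.ofLE _ _ (quotFilt_succ_le f π a.1 (a.1 + a.2)) ≫ grProj f π a = 0 :=
    cokernel.condition _
  rw [← h2, Category.assoc, h3, comp_zero] at hc
  rwa [← cancel_epi (pullback.fst x (grProj f π a)), comp_zero]

theorem exists_quotModProj_filtπ (a : ℕ × ℕ) :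
    ∃ r, quotModProj f π a ≫ r = filtπ f π a.1 (a.1 + a.2) :=
  exists_desc_filtπ _ (quotFilt_arrow_comp_π (Nat.le_succ _) _)

/-- The piece `Fⁱ/Fⁱ⁺¹` is the kernel of `P/Fⁱ⁺¹ ⟶ P/Fⁱ`: lift to `P` on a pullback, see that the
lift lies in `Fⁱ`, and descend by a diagonal filling. -/
theorem exists_lift_grIncl {a : ℕ × ℕ} {D : C} {r : quotMod f π a ⟶ D} {s : D ⟶ _}
    (hr : quotModProj f π a ≫ r ≫ s = filtπ f π a.1 (a.1 + a.2)) {E : C} (h : E ⟶ quotMod f π a)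
    (hh : h ≫ r = 0) : ∃ h', h' ≫ grIncl f π a = h := by
  have hc := pullback.condition (f := h) (g := quotModProj f π a)
  obtain ⟨y, hy⟩ := exists_lift_quotFilt (f := f) (π := π) (i := a.1) (n := a.1 + a.2)
    (pullback.snd h (quotModProj f π a))
    (by rw [← hr, ← reassoc_of% hc, reassoc_of% hh, zero_comp, comp_zero])
  obtain ⟨l, -, hl⟩ := exists_diagonal (pullback.fst h (quotModProj f π a)) (grIncl f π a)
    (y ≫ grProj f π a) h (by rw [Category.assoc, grProj_grIncl, reassoc_of% hy, hc])
  exact ⟨l, hl⟩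

variable {ε : ℤ} {H : GradedBialgData P} [∀ n, Epi (π n)]

open GradedBialgData

/-- The filtration is a graded subalgebra. -/
theorem exists_filtAlg (h : (tensorAlgebraData ε Y).IsHom H π) :
    ∃ F : GradedBialgData fun a : ℕ × ℕ => (quotFilt f π a.1 (a.1 + a.2) : C), F.IsAlg ∧
      (∀ a b c, F.mul a b c ≫ (quotFilt f π c.1 (c.1 + c.2)).arrow =
        ((quotFilt f π a.1 (a.1 + a.2)).arrow ⊗ₘ (quotFilt f π b.1 (b.1 + b.2)).arrow) ≫
          H.regrade.mul a b c) ∧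
      (∀ a, F.one a ≫ (quotFilt f π a.1 (a.1 + a.2)).arrow = H.one (a.1 + a.2)) := by
  have h1 : ∀ a b c : ℕ × ℕ, ∃ μ, μ ≫ (quotFilt f π c.1 (c.1 + c.2)).arrow =
      ((quotFilt f π a.1 (a.1 + a.2)).arrow ⊗ₘ (quotFilt f π b.1 (b.1 + b.2)).arrow) ≫
        H.regrade.mul a b c := fun a b c => by
    by_cases hc : a + b = c
    · rw [regrade_mul hc]
      refine exists_lift_quotFilt _ ?_
      rw [Category.assoc, quotFilt_mul h (by rw [← hc, Prod.fst_add])]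
    · exact ⟨0, by rw [regrade_mul_deg hc, comp_zero, zero_comp]⟩
  have h2 : ∀ a : ℕ × ℕ, ∃ o, o ≫ (quotFilt f π a.1 (a.1 + a.2)).arrow = H.one (a.1 + a.2) :=
    fun a => by
    by_cases ha : a = 0
    · subst ha
      have := quotFilt_zero_isIso (f := f) (π := π) 0
      exact ⟨H.one 0 ≫ inv (quotFilt f π 0 0).arrow, (Category.assoc _ _ _).trans
        ((congrArg _ (IsIso.inv_hom_id _)).trans (Category.comp_id _))⟩
    · exact ⟨0, by rw [h.isBialg_of_tensorAlgebra.one_deg _ (bidegree_ne_zero ha), zero_comp]⟩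
  choose μ hμ using h1
  choose o ho using h2
  -- Only the algebra part matters here; the coalgebra maps are placeholders.
  exact ⟨⟨μ, fun _ _ _ => 0, o, fun _ => 0⟩, h.isBialg_of_tensorAlgebra.toIsAlg.regrade.of_mono
    (fun a => (quotFilt f π a.1 (a.1 + a.2)).arrow) hμ ho, hμ, ho⟩

/-- The quotients by the steps of the filtration form a graded coalgebra. -/
theorem exists_quotCoalg (h : (tensorAlgebraData ε Y).IsHom H π) :
    ∃ Q : GradedBialgData (quotMod f π), Q.IsCoalg ∧
      (∀ c a b, H.regrade.comul c a b ≫ (quotModProj f π a ⊗ₘ quotModProj f π b) =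
        quotModProj f π c ≫ Q.comul c a b) ∧
      (∀ a, quotModProj f π a ≫ Q.counit a = H.counit (a.1 + a.2)) := by
  have h1 : ∀ c a b : ℕ × ℕ, ∃ δ, quotModProj f π c ≫ δ =
      H.regrade.comul c a b ≫ (quotModProj f π a ⊗ₘ quotModProj f π b) := fun c a b => by
    by_cases hc : a + b = c
    · rw [regrade_comul hc]
      refine exists_desc_filtπ _ (quotFilt_comul h ?_ _ _ _)
      rw [← hc, Prod.fst_add]; omega
    · exact ⟨0, by rw [regrade_comul_deg hc, comp_zero, zero_comp]⟩
  have h2 : ∀ a : ℕ × ℕ, ∃ o, quotModProj f π a ≫ o = H.counit (a.1 + a.2) := fun a => by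
    refine exists_desc_filtπ _ ?_
    by_cases ha : a.1 + a.2 = 0
    · rw [quotFilt_arrow_eq_zero (by omega), zero_comp]
    · rw [h.isBialg_of_tensorAlgebra.counit_deg _ ha, comp_zero]
  choose δ hδ using h1
  choose o ho using h2
  exact ⟨⟨fun _ _ _ => 0, δ, fun _ => 0, o⟩,
    h.isBialg_of_tensorAlgebra.toIsCoalg.regrade.of_epi (quotModProj f π)
    (fun c a b => (hδ c a b).symm) ho, fun c a b => (hδ c a b).symm, ho⟩

/-- The product descends along `grProj` from the algebra of the `Fⁱ`, and the coproduct restricts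
along `grIncl` from the coalgebra of the `P/Fⁱ⁺¹`. Each half inherits its axioms from its own
source; compatibility of the two halves is a separate matter (`gr_isBialg`). -/
theorem exists_gr (h : (tensorAlgebraData ε Y).IsHom H π) :
    ∃ G : GradedBialgData (grObj f π), IsInducedOnGr f π H G ∧ G.IsAlg ∧ G.IsCoalg := by
  obtain ⟨F, hF, hFmul, hFone⟩ := exists_filtAlg (f := f) h
  obtain ⟨Q, hQ, hQcomul, hQcounit⟩ := exists_quotCoalg (f := f) h
  have h1 : ∀ a b c, ∃ μ, (grProj f π a ⊗ₘ grProj f π b) ≫ μ = F.mul a b c ≫ grProj f π c := by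
    intro a b c
    refine exists_desc_tensor _ _ (Subobject.ofLE _ _ (quotFilt_succ_le f π a.1 (a.1 + a.2)))
      (Subobject.ofLE _ _ (quotFilt_succ_le f π b.1 (b.1 + b.2))) exists_desc_grProj
      exists_desc_grProj _ ?_ ?_
    · rw [← cancel_mono (grIncl f π c), Category.assoc, Category.assoc, grProj_grIncl,
        reassoc_of% hFmul, ← tensorHom_id, tensorHom_comp_tensorHom_assoc, Subobject.ofLE_arrow,
        zero_comp]
      by_cases hc : a + b = c
      · rw [regrade_mul hc, Category.id_comp]
        exact quotFilt_mul h (by rw [← hc, Prod.fst_add]; omega) _ _ _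
      · rw [regrade_mul_deg hc, zero_comp, comp_zero]
    · rw [← cancel_mono (grIncl f π c), Category.assoc, Category.assoc, grProj_grIncl,
        reassoc_of% hFmul, ← id_tensorHom, tensorHom_comp_tensorHom_assoc, Subobject.ofLE_arrow,
        zero_comp]
      by_cases hc : a + b = c
      · rw [regrade_mul hc, Category.id_comp]
        exact quotFilt_mul h (by rw [← hc, Prod.fst_add]; omega) _ _ _
      · rw [regrade_mul_deg hc, zero_comp, comp_zero]
  have h2 : ∀ c a b, ∃ δ, δ ≫ (grIncl f π a ⊗ₘ grIncl f π b) = grIncl f π c ≫ Q.comul c a b := by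
    intro c a b
    obtain ⟨r, hr⟩ := exists_quotModProj_filtπ (f := f) (π := π) a
    obtain ⟨r', hr'⟩ := exists_quotModProj_filtπ (f := f) (π := π) b
    refine exists_lift_tensor _ r _ r' (fun x hx => exists_lift_grIncl (s := 𝟙 _)
      (by rw [Category.comp_id, hr]) x hx) (fun x hx => exists_lift_grIncl (s := 𝟙 _)
      (by rw [Category.comp_id, hr']) x hx) _ ?_ ?_
    · rw [← cancel_epi (grProj f π c), Category.assoc, reassoc_of% grProj_grIncl,
        ← reassoc_of% hQcomul, ← tensorHom_id, tensorHom_comp_tensorHom, hr, comp_zero,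
        Category.comp_id]
      by_cases hc : a + b = c
      · rw [regrade_comul hc]
        exact quotFilt_comul h (by rw [← hc, Prod.fst_add]; omega) _ _ _
      · rw [regrade_comul_deg hc, zero_comp, comp_zero]
    · rw [← cancel_epi (grProj f π c), Category.assoc, reassoc_of% grProj_grIncl,
        ← reassoc_of% hQcomul, ← id_tensorHom, tensorHom_comp_tensorHom, hr', comp_zero,
        Category.comp_id]
      by_cases hc : a + b = c
      · rw [regrade_comul hc]
        exact quotFilt_comul h (by rw [← hc, Prod.fst_add]; omega) _ _ _
      · rw [regrade_comul_deg hc, zero_comp, comp_zero]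
  choose μ hμ using h1
  choose δ hδ using h2
  refine ⟨⟨μ, δ, fun a => F.one a ≫ grProj f π a, fun a => grIncl f π a ≫ Q.counit a⟩,
    ⟨fun a b c hc => ?_, fun c a b hc => ?_, fun a => ?_, fun a => ?_⟩,
    hF.of_epi (grProj f π) (fun a b c => (hμ a b c).symm) (fun a => rfl),
    hQ.of_mono (grIncl f π) hδ (fun a => rfl)⟩
  · rw [reassoc_of% hμ, grProj_grIncl, reassoc_of% hFmul, regrade_mul hc]
  · rw [hδ, reassoc_of% grProj_grIncl, ← hQcomul, regrade_comul hc]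
  · rw [Category.assoc, grProj_grIncl, reassoc_of% hFone]
  · rw [reassoc_of% grProj_grIncl, hQcounit]

end AssociatedGraded

theorem zsmul_hom_eq_zero {C : Type u} [Category.{v} C] [Preadditive C] {A B : C} (n : ℤ)
    {x : A ⟶ B} (h : x = 0) : n • x = 0 := by rw [h, smul_zero]

/-! ### Insertion followed by a product -/

section InsertionProducts

variable {C : Type u} [Category.{v} C] [Abelian C] [MonoidalCategory C] [MonoidalPreadditive C]
  {T A D E M T' X' Q Q' : C}

theorem tensorHom_insR_comp {t : T' ⟶ T} {d : T ⟶ A ⊗ D} {X : C} {x : X' ⟶ X} {m : D ⊗ X ⟶ M}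
    {q : M ⟶ Q} {q' : A ⟶ Q'} :
    (t ⊗ₘ x) ≫ insR X d ≫ A ◁ m ≫ (q' ⊗ₘ q) =
      insR X' (t ≫ d) ≫ (q' ⊗ₘ (D ◁ x ≫ m ≫ q)) := by
  have h1 := insR_natural (t := t) (d' := d) (d := t ≫ d) (a := 𝟙 _) (b := 𝟙 _) x (by simp)
  rw [reassoc_of% h1, ← id_tensorHom, tensorHom_comp_tensorHom, tensorHom_comp_tensorHom,
    id_tensorHom, Category.id_comp, Category.id_comp]

theorem insR_comp {d : T ⟶ A ⊗ D} {a : A ⟶ Q'} {b : D ⟶ Q} {X : C} {s : Q ⊗ X ⟶ M} :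
    insR X d ≫ (a ⊗ₘ (b ▷ X ≫ s)) = insR X (d ≫ (a ⊗ₘ b)) ≫ _ ◁ s := by
  have h1 := insR_natural (t := 𝟙 T) (d' := d ≫ (a ⊗ₘ b)) (d := d) (a := a) (b := b) (𝟙 X)
    (by simp)
  rw [id_tensorHom_id, Category.id_comp, tensorHom_id] at h1
  rw [h1, Category.assoc, ← id_tensorHom _ s, tensorHom_comp_tensorHom, Category.comp_id]

variable [BraidedCategory C]

theorem tensorHom_insL_comp {t : T' ⟶ T} {d : T ⟶ A ⊗ D} {X : C} {x : X' ⟶ X} {m : A ⊗ X ⟶ M}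
    {q : M ⟶ Q} {q' : D ⟶ Q'} :
    (t ⊗ₘ x) ≫ insL X d ≫ m ▷ D ≫ (q ⊗ₘ q') =
      insL X' (t ≫ d) ≫ ((A ◁ x ≫ m ≫ q) ⊗ₘ q') := by
  have h1 := insL_natural (t := t) (d' := d) (d := t ≫ d) (a := 𝟙 _) (b := 𝟙 _) x (by simp)
  rw [reassoc_of% h1, ← tensorHom_id, tensorHom_comp_tensorHom, tensorHom_comp_tensorHom,
    id_tensorHom, Category.id_comp, Category.id_comp]

theorem insL_comp {d : T ⟶ A ⊗ D} {a : A ⟶ Q} {b : D ⟶ Q'} {X : C} {s : Q ⊗ X ⟶ M} :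
    insL X d ≫ ((a ▷ X ≫ s) ⊗ₘ b) = insL X (d ≫ (a ⊗ₘ b)) ≫ s ▷ _ := by
  have h1 := insL_natural (t := 𝟙 T) (d' := d ≫ (a ⊗ₘ b)) (d := d) (a := a) (b := b) (𝟙 X)
    (by simp)
  rw [id_tensorHom_id, Category.id_comp, tensorHom_id] at h1
  rw [h1, Category.assoc, ← tensorHom_id s, tensorHom_comp_tensorHom, Category.comp_id]

end InsertionProducts

/-! ### The two terms of the coproduct of a product with a primitive generator -/

namespace GradedBialgData

variable {C : Type u} [Category.{v} C] [Abelian C] [MonoidalCategory C] [MonoidalPreadditive C]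
  [BraidedCategory C]
variable {ι : Type} [AddCommMonoid ι] {A : ι → C} {ε : ℤ} {deg : ι → ℕ} {H : GradedBialgData A}

theorem leftTerm_eq_insL (i e p k l : ι) : H.leftTerm ε deg i e p k l =
    ε ^ (deg l * deg e) • (insL (A e) (H.comul i p l) ≫ H.mul p e k ▷ A l) := by
  rw [leftTerm, insL]
  simp only [Category.assoc]

theorem rightTerm_eq_insR (i e p k l : ι) : H.rightTerm i e p k l =
    insR (A e) (H.comul i k p) ≫ A k ◁ H.mul p e l := by
  rw [rightTerm, insR, Category.assoc]

theorem IsAlg.leftTerm_eq_zero (h : H.IsAlg) {i e p k l : ι} (hp : p + e ≠ k) :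
    H.leftTerm ε deg i e p k l = 0 := by
  rw [leftTerm, h.mul_deg _ _ _ hp]; simp

theorem IsAlg.rightTerm_eq_zero (h : H.IsAlg) {i e p k l : ι} (hp : p + e ≠ l) :
    H.rightTerm i e p k l = 0 := by
  rw [rightTerm, h.mul_deg _ _ _ hp]; simp

theorem IsCoalg.leftTerm_eq_zero (h : H.IsCoalg) {i e p k l : ι} (hp : p + l ≠ i) :
    H.leftTerm ε deg i e p k l = 0 := by
  rw [leftTerm, h.comul_deg _ _ _ hp]; simp

theorem IsCoalg.rightTerm_eq_zero (h : H.IsCoalg) {i e p k l : ι} (hp : k + p ≠ i) :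
    H.rightTerm i e p k l = 0 := by
  rw [rightTerm, h.comul_deg _ _ _ hp]; simp

variable [Finset.HasAntidiagonal ι] [IsCancelAdd ι]

theorem IsAlg.sum_leftTerm (h : H.IsAlg) {i e p k l : ι} (hk : p + e = k) (hi : p + l = i) :
    ∑ q ∈ Finset.HasAntidiagonal.antidiagonal i, H.leftTerm ε deg i e q.1 k l =
      H.leftTerm ε deg i e p k l := by
  refine Finset.sum_eq_single (p, l) (fun q hq hqp => h.leftTerm_eq_zero fun hc => hqp ?_)
    fun hp => absurd (Finset.HasAntidiagonal.mem_antidiagonal.2 hi) hp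
  have h1 : q.1 = p := add_right_cancel (hc.trans hk.symm)
  have h2 := (Finset.HasAntidiagonal.mem_antidiagonal.1 hq).trans hi.symm
  rw [h1] at h2
  exact Prod.ext h1 (add_left_cancel h2)

theorem IsAlg.sum_rightTerm (h : H.IsAlg) {i e p k l : ι} (hl : p + e = l) (hi : k + p = i) :
    ∑ q ∈ Finset.HasAntidiagonal.antidiagonal i, H.rightTerm i e q.2 k l =
      H.rightTerm i e p k l := by
  refine Finset.sum_eq_single (k, p) (fun q hq hqp => h.rightTerm_eq_zero fun hc => hqp ?_)
    fun hp => absurd (Finset.HasAntidiagonal.mem_antidiagonal.2 hi) hp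
  have h1 : q.2 = p := add_right_cancel (hc.trans hl.symm)
  have h2 := (Finset.HasAntidiagonal.mem_antidiagonal.1 hq).trans hi.symm
  rw [h1] at h2
  exact Prod.ext (add_right_cancel h2) h1

end GradedBialgData

/-! ### Generation in total degree one and comparison of coproduct terms -/

section GrBialgebra

variable {C : Type u} [Category.{v} C] [Abelian C] [MonoidalCategory C] [MonoidalPreadditive C]
  [RigidCategory C] [BraidedCategory C] {X Y : C} {f : X ⟶ Y} {P : ℕ → C}
  {π : ∀ n, tpow Y n ⟶ P n} {ε : ℤ} {H : GradedBialgData P} [∀ n, Epi (π n)]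
  {G : GradedBialgData (grObj f π)}

open GradedBialgData

theorem exists_filt_mul (h : (tensorAlgebraData ε Y).IsHom H π) (hG : IsInducedOnGr f π H G)
    {a b c : ℕ × ℕ} (hc : a + b = c) :
    ∃ μ, μ ≫ (quotFilt f π c.1 (c.1 + c.2)).arrow =
        ((quotFilt f π a.1 (a.1 + a.2)).arrow ⊗ₘ (quotFilt f π b.1 (b.1 + b.2)).arrow) ≫
          H.mul (a.1 + a.2) (b.1 + b.2) (c.1 + c.2) ∧
      μ ≫ grProj f π c = (grProj f π a ⊗ₘ grProj f π b) ≫ G.mul a b c := by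
  obtain ⟨F, -, hF, -⟩ := exists_filtAlg (f := f) h
  have h1 := hF a b c
  rw [regrade_mul hc] at h1
  refine ⟨F.mul a b c, h1, ?_⟩
  rw [← cancel_mono (grIncl f π c), Category.assoc, Category.assoc, hG.mul a b c hc, grProj_grIncl,
    reassoc_of% h1]

theorem exists_filt_one (h : (tensorAlgebraData ε Y).IsHom H π) (hG : IsInducedOnGr f π H G)
    (a : ℕ × ℕ) : ∃ o, o ≫ (quotFilt f π a.1 (a.1 + a.2)).arrow = H.one (a.1 + a.2) ∧
      o ≫ grProj f π a = G.one a := by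
  obtain ⟨F, -, -, hF⟩ := exists_filtAlg (f := f) h
  refine ⟨F.one a, hF a, ?_⟩
  rw [← cancel_mono (grIncl f π a), Category.assoc, hG.one, grProj_grIncl, reassoc_of% hF]

/-- The associated graded algebra is generated in total degree one. -/
theorem gr_eq_zero_of_mul_comp (h : (tensorAlgebraData ε Y).IsHom H π)
    (hG : IsInducedOnGr f π H G) {c : ℕ × ℕ} (hc : c ≠ 0) {D : C} (x : grObj f π c ⟶ D)
    (hx : ∀ b e : ℕ × ℕ, e = (1, 0) ∨ e = (0, 1) → b + e = c → G.mul b e c ≫ x = 0) : x = 0 := by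
  -- The criterion for `Fⁱ(P (n + 1))` concerns maps defined on all of `P (n + 1)`, so the map is
  -- extended there after enlarging its target.
  obtain ⟨D', z, x', _, hz⟩ := exists_extension (quotFilt f π c.1 (c.1 + c.2)).arrow
    (grProj f π c ≫ x)
  have key : ∀ b e : ℕ × ℕ, e = (1, 0) ∨ e = (0, 1) → b + e = c →
      ((quotFilt f π b.1 (b.1 + b.2)).arrow ⊗ₘ (quotFilt f π e.1 (e.1 + e.2)).arrow) ≫
        H.mul (b.1 + b.2) (e.1 + e.2) (c.1 + c.2) ≫ x' = 0 := fun b e he hbe => by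
    obtain ⟨μ, h1, h2⟩ := exists_filt_mul h hG hbe
    rw [← reassoc_of% h1, ← hz, Category.assoc, reassoc_of% h2, reassoc_of% hx b e he hbe,
      zero_comp, comp_zero]
  rw [← cancel_mono z, ← cancel_epi (grProj f π c), ← Category.assoc, hz, zero_comp, comp_zero]
  have h0 := bidegree_ne_zero hc
  obtain ⟨i, j⟩ := c
  refine quotFilt_arrow_comp_eq_zero h (n := i + j - 1) (by dsimp only at h0 ⊢; omega) _ ?_ ?_
  -- For `j = 0` the part `Fⁱ(P (i - 1)) ⊗ P 1` is zero; otherwise it is the product with a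
  -- generator of bidegree `(0, 1)`.
  · rcases j with _ | j
    · rw [quotFilt_arrow_eq_zero (by dsimp only at h0 ⊢; omega)]
      simp
    · have := key (i, j) (0, 1) (Or.inr rfl) rfl
      rw [MonoidalCategory.tensorHom_def', Category.assoc] at this
      exact (cancel_epi (_ ◁ (quotFilt f π 0 1).arrow)).1 (this.trans comp_zero.symm)
  · rcases i with _ | i
    · exact fun h => absurd rfl h
    · intro _
      have := key (i, j) (1, 0) (Or.inl rfl) rfl
      have e : i + 1 + j - 1 = i + j := by omega
      dsimp only
      rw [e]
      exact this

/-- The coproduct of `gr` is only known inside products of the `P/Fⁱ⁺¹`, so multiplication by a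
homogeneous piece of the filtration is needed there too. It is well defined because the product of
`F` in degree `p.1 + 1` with `F` in degree `e.1` lies in `F` in degree `k.1 + 1`. The resulting `ν`
computes both the product of `H` and that of `G`. -/
theorem exists_mixed_mul (h : (tensorAlgebraData ε Y).IsHom H π) (hG : IsInducedOnGr f π H G)
    {p e k : ℕ × ℕ} (hk : p + e = k) :
    ∃ ν, quotModProj f π p ▷ _ ≫ ν = P (p.1 + p.2) ◁ (quotFilt f π e.1 (e.1 + e.2)).arrow ≫
        H.mul (p.1 + p.2) (e.1 + e.2) (k.1 + k.2) ≫ quotModProj f π k ∧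
      grIncl f π p ▷ _ ≫ ν = grObj f π p ◁ grProj f π e ≫ G.mul p e k ≫ grIncl f π k := by
  obtain ⟨ν, hν⟩ := exists_desc_whiskerRight (quotModProj f π p)
    (quotFilt f π (p.1 + 1) (p.1 + p.2)).arrow exists_desc_filtπ
    (P (p.1 + p.2) ◁ (quotFilt f π e.1 (e.1 + e.2)).arrow ≫
        H.mul (p.1 + p.2) (e.1 + e.2) (k.1 + k.2) ≫ quotModProj f π k) (by
      rw [← MonoidalCategory.tensorHom_def_assoc]
      exact quotFilt_mul h (by rw [← hk, Prod.fst_add]; omega) _ _ _)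
  refine ⟨ν, hν, ?_⟩
  rw [← cancel_epi (grProj f π p ▷ _), ← comp_whiskerRight_assoc, grProj_grIncl,
    comp_whiskerRight_assoc, hν, ← MonoidalCategory.tensorHom_def_assoc,
    ← MonoidalCategory.tensorHom_def_assoc, hG.mul p e k hk]

/-- The total degree. -/
abbrev totalDeg (a : ℕ × ℕ) : ℕ := a.1 + a.2

theorem gr_leftTerm (h : (tensorAlgebraData ε Y).IsHom H π) (hG : IsInducedOnGr f π H G)
    {a e p k l : ℕ × ℕ} (hk : p + e = k) (ha : p + l = a) :
    (grProj f π a ⊗ₘ grProj f π e) ≫ G.leftTerm ε totalDeg a e p k l ≫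
        (grIncl f π k ⊗ₘ grIncl f π l) =
      ((quotFilt f π a.1 (a.1 + a.2)).arrow ⊗ₘ (quotFilt f π e.1 (e.1 + e.2)).arrow) ≫
        H.leftTerm ε id (a.1 + a.2) (e.1 + e.2) (p.1 + p.2) (k.1 + k.2) (l.1 + l.2) ≫
        (quotModProj f π k ⊗ₘ quotModProj f π l) := by
  obtain ⟨ν, h1, h2⟩ := exists_mixed_mul h hG hk
  rw [leftTerm_eq_insL, leftTerm_eq_insL, Preadditive.zsmul_comp, Preadditive.zsmul_comp,
    Preadditive.comp_zsmul, Preadditive.comp_zsmul, Category.assoc, Category.assoc,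
    tensorHom_insL_comp, tensorHom_insL_comp, ← h1, ← h2, insL_comp, insL_comp, Category.assoc,
    Category.assoc, hG.comul a p l ha]
  rfl

theorem gr_rightTerm (h : (tensorAlgebraData ε Y).IsHom H π) (hG : IsInducedOnGr f π H G)
    {a e p k l : ℕ × ℕ} (hl : p + e = l) (ha : k + p = a) :
    (grProj f π a ⊗ₘ grProj f π e) ≫ G.rightTerm a e p k l ≫
        (grIncl f π k ⊗ₘ grIncl f π l) =
      ((quotFilt f π a.1 (a.1 + a.2)).arrow ⊗ₘ (quotFilt f π e.1 (e.1 + e.2)).arrow) ≫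
        H.rightTerm (a.1 + a.2) (e.1 + e.2) (p.1 + p.2) (k.1 + k.2) (l.1 + l.2) ≫
        (quotModProj f π k ⊗ₘ quotModProj f π l) := by
  obtain ⟨ν, h1, h2⟩ := exists_mixed_mul h hG hl
  rw [rightTerm_eq_insR, rightTerm_eq_insR, Category.assoc, Category.assoc,
    tensorHom_insR_comp, tensorHom_insR_comp, ← h1, ← h2, insR_comp, insR_comp, Category.assoc,
    Category.assoc, hG.comul a k p ha]

theorem whiskerLeft_filt_mul_eq_zero (h : (tensorAlgebraData ε Y).IsHom H π) (p k : ℕ) :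
    P p ◁ (quotFilt f π 1 1).arrow ≫ H.mul p 1 k ≫ filtπ f π 1 k = 0 := by
  rw [← cancel_epi ((quotFilt f π 0 p).arrow ▷ _), ← MonoidalCategory.tensorHom_def_assoc,
    quotFilt_mul h (by omega), comp_zero]

/-- Since `Fᵐ(P p) = 0` for `p < m`, the quotient map by `Fᵐ` on the first factor is mono and can be
cancelled. -/
theorem filt_comul_left_eq_zero (h : (tensorAlgebraData ε Y).IsHom H π) {m p c b : ℕ}
    (hp : p < m) (hc : m + b ≤ c + 1) (n j : ℕ) :
    (quotFilt f π c n).arrow ≫ H.comul n p j ≫ (𝟙 _ ⊗ₘ filtπ f π b j) = 0 := by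
  have := filtπ_mono (f := f) (π := π) hp
  rw [← cancel_mono (filtπ f π m p ⊗ₘ 𝟙 _), Category.assoc, Category.assoc,
    tensorHom_comp_tensorHom, Category.id_comp, Category.comp_id, quotFilt_comul h hc, zero_comp]

theorem filt_comul_right_eq_zero (h : (tensorAlgebraData ε Y).IsHom H π) {m p c b : ℕ}
    (hp : p < m) (hc : b + m ≤ c + 1) (n j : ℕ) :
    (quotFilt f π c n).arrow ≫ H.comul n j p ≫ (filtπ f π b j ⊗ₘ 𝟙 _) = 0 := by
  have := filtπ_mono (f := f) (π := π) hp
  rw [← cancel_mono (𝟙 _ ⊗ₘ filtπ f π m p), Category.assoc, Category.assoc,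
    tensorHom_comp_tensorHom, Category.id_comp, Category.comp_id, quotFilt_comul h hc, zero_comp]

/-- These are the terms of `P` with no counterpart in `gr`. If the letter is in `X` and `k.1 = 0`,
the product with it lies in `F¹` and dies. If the letter has bidegree `(0, 1)` and `k.2 = 0`, then
`w'` has total degree below `k.1`, so it carries too little filtration, and `w''` lies in a step
that dies. -/
theorem filt_leftTerm_eq_zero (h : (tensorAlgebraData ε Y).IsHom H π) {a e k l : ℕ × ℕ}
    (he : e = (1, 0) ∧ k.1 = 0 ∨ e = (0, 1) ∧ k.2 = 0) (hkl : k + l = a + e) (p : ℕ) :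
    ((quotFilt f π a.1 (a.1 + a.2)).arrow ⊗ₘ (quotFilt f π e.1 (e.1 + e.2)).arrow) ≫
      H.leftTerm ε id (a.1 + a.2) (e.1 + e.2) p (k.1 + k.2) (l.1 + l.2) ≫
      (quotModProj f π k ⊗ₘ quotModProj f π l) = 0 := by
  by_cases hp : p + (e.1 + e.2) = k.1 + k.2
  swap
  · rw [h.isBialg_of_tensorAlgebra.toIsAlg.leftTerm_eq_zero hp, zero_comp, comp_zero]
  rw [leftTerm_eq_insL, Preadditive.zsmul_comp, Preadditive.comp_zsmul, Category.assoc,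
    tensorHom_insL_comp]
  obtain ⟨hk1, hk2⟩ := Prod.ext_iff.1 hkl
  rw [Prod.fst_add, Prod.fst_add] at hk1
  rw [Prod.snd_add, Prod.snd_add] at hk2
  obtain ⟨k1, k2⟩ := k
  obtain ⟨rfl, rfl⟩ | ⟨rfl, rfl⟩ := he
  · have h1 := whiskerLeft_filt_mul_eq_zero (f := f) h p (0 + k2)
    exact zsmul_hom_eq_zero _ ((congrArg _ ((congrArg (· ⊗ₘ _) h1).trans
      (MonoidalPreadditive.zero_tensor _))).trans comp_zero)
  · have h1 := filt_comul_left_eq_zero (f := f) h (m := k1) (p := p) (c := a.1) (b := l.1 + 1)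
      (by dsimp only at hp; omega) (by dsimp only at hk1; omega) (a.1 + a.2) (l.1 + l.2)
    rw [← Category.assoc] at h1
    exact zsmul_hom_eq_zero _
      (insL_comp_eq_zero h1 ⟨_, by rw [id_whiskerRight, Category.id_comp]⟩)

theorem filt_rightTerm_eq_zero (h : (tensorAlgebraData ε Y).IsHom H π) {a e k l : ℕ × ℕ}
    (he : e = (1, 0) ∧ l.1 = 0 ∨ e = (0, 1) ∧ l.2 = 0) (hkl : k + l = a + e) (p : ℕ) :
    ((quotFilt f π a.1 (a.1 + a.2)).arrow ⊗ₘ (quotFilt f π e.1 (e.1 + e.2)).arrow) ≫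
      H.rightTerm (a.1 + a.2) (e.1 + e.2) p (k.1 + k.2) (l.1 + l.2) ≫
      (quotModProj f π k ⊗ₘ quotModProj f π l) = 0 := by
  by_cases hp : p + (e.1 + e.2) = l.1 + l.2
  swap
  · rw [h.isBialg_of_tensorAlgebra.toIsAlg.rightTerm_eq_zero hp, zero_comp, comp_zero]
  rw [rightTerm_eq_insR, Category.assoc, tensorHom_insR_comp]
  obtain ⟨hk1, hk2⟩ := Prod.ext_iff.1 hkl
  rw [Prod.fst_add, Prod.fst_add] at hk1
  rw [Prod.snd_add, Prod.snd_add] at hk2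
  obtain ⟨l1, l2⟩ := l
  obtain ⟨rfl, rfl⟩ | ⟨rfl, rfl⟩ := he
  · have h1 := whiskerLeft_filt_mul_eq_zero (f := f) h p (0 + l2)
    refine (congrArg _ ((congrArg (_ ⊗ₘ ·) h1).trans
      (MonoidalPreadditive.tensor_zero _))).trans comp_zero
  · have h1 := filt_comul_right_eq_zero (f := f) h (m := l1) (p := p) (c := a.1) (b := k.1 + 1)
      (by dsimp only at hp; omega) (by dsimp only at hk1; omega) (a.1 + a.2) (k.1 + k.2)
    rw [← Category.assoc] at h1
    exact insR_comp_eq_zero h1 ⟨_, by rw [id_whiskerRight, Category.id_comp]⟩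

end GrBialgebra

/-! ### The Hopf algebra structure of the associated graded object -/

section GrBialgebra

variable {C : Type u} [Category.{v} C] [Abelian C] [MonoidalCategory C] [MonoidalPreadditive C]
  [RigidCategory C] [BraidedCategory C] {X Y : C} {f : X ⟶ Y} {P : ℕ → C}
  {π : ∀ n, tpow Y n ⟶ P n} {ε : ℤ} {H : GradedBialgData P} [∀ n, Epi (π n)]
  {G : GradedBialgData (grObj f π)}

open GradedBialgData

theorem degree_one_le_or {a e k l : ℕ × ℕ} (he : e = (1, 0) ∨ e = (0, 1)) (hkl : k + l = a + e) :
    (∃ p, p + e = k ∧ p + l = a) ∨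
      ((∀ p, p + e ≠ k) ∧ (e = (1, 0) ∧ k.1 = 0 ∨ e = (0, 1) ∧ k.2 = 0)) := by
  obtain ⟨k1, k2⟩ := k
  obtain ⟨l1, l2⟩ := l
  obtain ⟨a1, a2⟩ := a
  rcases he with rfl | rfl
  · simp only [Prod.mk_add_mk, Prod.mk.injEq] at hkl
    rcases k1 with _ | k1
    · refine Or.inr ⟨fun p hp => ?_, Or.inl ⟨rfl, rfl⟩⟩
      have := (Prod.ext_iff.1 hp).1
      simp at this
    · exact Or.inl ⟨(k1, k2), rfl, Prod.ext (by simp; omega) (by simp; omega)⟩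
  · simp only [Prod.mk_add_mk, Prod.mk.injEq] at hkl
    rcases k2 with _ | k2
    · refine Or.inr ⟨fun p hp => ?_, Or.inr ⟨rfl, rfl⟩⟩
      have := (Prod.ext_iff.1 hp).2
      simp at this
    · exact Or.inl ⟨(k1, k2), rfl, Prod.ext (by simp; omega) (by simp; omega)⟩

theorem gr_sum_leftTerm (h : (tensorAlgebraData ε Y).IsHom H π) (hG : IsInducedOnGr f π H G)
    (hA : G.IsAlg) {a e k l : ℕ × ℕ} (he : e = (1, 0) ∨ e = (0, 1)) (hkl : k + l = a + e) :
    (grProj f π a ⊗ₘ grProj f π e) ≫ (∑ p ∈ Finset.HasAntidiagonal.antidiagonal a,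
        G.leftTerm ε totalDeg a e p.1 k l) ≫ (grIncl f π k ⊗ₘ grIncl f π l) =
      ((quotFilt f π a.1 (a.1 + a.2)).arrow ⊗ₘ (quotFilt f π e.1 (e.1 + e.2)).arrow) ≫
        (∑ p ∈ Finset.HasAntidiagonal.antidiagonal (a.1 + a.2),
          H.leftTerm ε id (a.1 + a.2) (e.1 + e.2) p.1 (k.1 + k.2) (l.1 + l.2)) ≫
        (quotModProj f π k ⊗ₘ quotModProj f π l) := by
  rcases degree_one_le_or he hkl with ⟨p, hk, ha⟩ | ⟨hp, hke⟩
  · rw [hA.sum_leftTerm hk ha, h.isBialg_of_tensorAlgebra.toIsAlg.sum_leftTerm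
      (p := p.1 + p.2) (by rw [bidegree_add, hk]) (by rw [bidegree_add, ha]), gr_leftTerm h hG hk ha]
  · rw [Finset.sum_eq_zero fun p _ => hA.leftTerm_eq_zero (hp p.1), zero_comp, comp_zero]
    simp only [Preadditive.sum_comp, Preadditive.comp_sum]
    exact (Finset.sum_eq_zero fun p _ => filt_leftTerm_eq_zero h hke hkl p.1).symm

theorem gr_sum_rightTerm (h : (tensorAlgebraData ε Y).IsHom H π) (hG : IsInducedOnGr f π H G)
    (hA : G.IsAlg) {a e k l : ℕ × ℕ} (he : e = (1, 0) ∨ e = (0, 1)) (hkl : k + l = a + e) :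
    (grProj f π a ⊗ₘ grProj f π e) ≫ (∑ p ∈ Finset.HasAntidiagonal.antidiagonal a,
        G.rightTerm a e p.2 k l) ≫ (grIncl f π k ⊗ₘ grIncl f π l) =
      ((quotFilt f π a.1 (a.1 + a.2)).arrow ⊗ₘ (quotFilt f π e.1 (e.1 + e.2)).arrow) ≫
        (∑ p ∈ Finset.HasAntidiagonal.antidiagonal (a.1 + a.2),
          H.rightTerm (a.1 + a.2) (e.1 + e.2) p.2 (k.1 + k.2) (l.1 + l.2)) ≫
        (quotModProj f π k ⊗ₘ quotModProj f π l) := by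
  rcases degree_one_le_or he ((add_comm l k).trans hkl) with ⟨p, hl, ha⟩ | ⟨hp, hke⟩
  · replace ha : k + p = a := by rw [add_comm] at ha; rw [← add_right_cancel_iff (a := e), ← hkl,
      ← hl, add_assoc]
    rw [hA.sum_rightTerm hl ha, h.isBialg_of_tensorAlgebra.toIsAlg.sum_rightTerm
      (p := p.1 + p.2) (by rw [bidegree_add, hl]) (by rw [bidegree_add, ha]),
      gr_rightTerm h hG hl ha]
  · rw [Finset.sum_eq_zero fun p _ => hA.rightTerm_eq_zero (hp p.2), zero_comp, comp_zero]
    simp only [Preadditive.sum_comp, Preadditive.comp_sum]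
    exact (Finset.sum_eq_zero fun p _ => filt_rightTerm_eq_zero h hke hkl p.2).symm

theorem gr_isIso_one (h : (tensorAlgebraData ε Y).IsHom H π) (hG : IsInducedOnGr f π H G) :
    IsIso (G.one 0) := by
  have h1 := h.isIso_one
  have h2 : Mono (quotModProj f π 0) := filtπ_mono (f := f) (π := π) (i := 1) (n := 0) one_pos
  have h3 : IsIso (quotModProj f π 0) := isIso_of_mono_of_epi _
  have h4 : IsIso (H.one ((0 : ℕ × ℕ).1 + (0 : ℕ × ℕ).2) ≫ quotModProj f π 0) :=
    IsIso.comp_isIso' h1 h3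
  rw [← hG.one] at h4
  have h5 : Epi (grIncl f π 0) := epi_of_epi (G.one 0) _
  have h6 : IsIso (grIncl f π 0) := isIso_of_mono_of_epi _
  exact IsIso.of_isIso_comp_right _ (grIncl f π 0)

theorem gr_one_counit (h : (tensorAlgebraData ε Y).IsHom H π) (hG : IsInducedOnGr f π H G) :
    G.one 0 ≫ G.counit 0 = 𝟙 _ := by
  obtain ⟨o, h1, h2⟩ := exists_filt_one h hG 0
  rw [← h2, Category.assoc, hG.counit, reassoc_of% h1]
  exact h.isBialg_of_tensorAlgebra.one_counit

theorem gr_counit_one (h : (tensorAlgebraData ε Y).IsHom H π) (hG : IsInducedOnGr f π H G) :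
    G.counit 0 ≫ G.one 0 = 𝟙 _ := by
  have := gr_isIso_one h hG
  rw [← cancel_epi (G.one 0), ← Category.assoc, gr_one_counit h hG, Category.id_comp,
    Category.comp_id]

theorem gr_one_comul (h : (tensorAlgebraData ε Y).IsHom H π) (hG : IsInducedOnGr f π H G) :
    G.one 0 ≫ G.comul 0 0 0 = (λ_ (𝟙_ C)).inv ≫ (G.one 0 ⊗ₘ G.one 0) := by
  obtain ⟨o, h1, h2⟩ := exists_filt_one h hG 0
  rw [← cancel_mono (grIncl f π 0 ⊗ₘ grIncl f π 0), Category.assoc, Category.assoc,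
    tensorHom_comp_tensorHom, hG.one, ← h2, Category.assoc, hG.comul 0 0 0 (add_zero 0),
    reassoc_of% h1, ← tensorHom_comp_tensorHom]
  have := h.isBialg_of_tensorAlgebra.one_comul
  exact (Category.assoc _ _ _).symm.trans ((congrArg (· ≫ _) this).trans (Category.assoc _ _ _))

theorem gr_mul_counit (h : (tensorAlgebraData ε Y).IsHom H π) (hG : IsInducedOnGr f π H G) :
    G.mul 0 0 0 ≫ G.counit 0 = (G.counit 0 ⊗ₘ G.counit 0) ≫ (λ_ (𝟙_ C)).hom := by
  obtain ⟨μ, h1, h2⟩ := exists_filt_mul h hG (add_zero 0)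
  rw [← cancel_epi (grProj f π 0 ⊗ₘ grProj f π 0), ← reassoc_of% h2,
    tensorHom_comp_tensorHom_assoc, hG.counit, reassoc_of% h1, ← tensorHom_comp_tensorHom,
    Category.assoc]
  exact congrArg _ h.isBialg_of_tensorAlgebra.mul_counit

theorem antidiagonal_degree_one {e : ℕ × ℕ} (he : e = (1, 0) ∨ e = (0, 1))
    (q : (ℕ × ℕ) × (ℕ × ℕ)) :
    q ∈ Finset.HasAntidiagonal.antidiagonal e ↔ q = (e, 0) ∨ q = (0, e) := by
  obtain ⟨⟨a, b⟩, c, d⟩ := q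
  rw [Finset.HasAntidiagonal.mem_antidiagonal]
  rcases he with rfl | rfl <;>
  · simp only [Prod.mk_add_mk, Prod.mk.injEq, Prod.zero_eq_mk]
    omega

theorem gr_mulComul_one (h : (tensorAlgebraData ε Y).IsHom H π) (hG : IsInducedOnGr f π H G)
    (hA : G.IsAlg) (hc : G.IsCoalg) (a : ℕ × ℕ) {e n : ℕ × ℕ} (he : e = (1, 0) ∨ e = (0, 1))
    (hn : a + e = n) :
    G.MulComul ε totalDeg a e n := by
  have he0 : e ≠ 0 := by rcases he with rfl | rfl <;> simp
  have he1 : e.1 + e.2 = 1 := by rcases he with rfl | rfl <;> rfl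
  refine hA.mulComul_of_primitive hc (gr_counit_one h hG) rfl he0 (antidiagonal_degree_one he)
    fun k l => ?_
  by_cases hkl : k + l = n
  · obtain ⟨μ, h1, h2⟩ := exists_filt_mul h hG hn
    have hH := h.isBialg_of_tensorAlgebra
    have h3 : H.mul (a.1 + a.2) (e.1 + e.2) (n.1 + n.2) ≫
        H.comul (n.1 + n.2) (k.1 + k.2) (l.1 + l.2) =
        ∑ p ∈ Finset.HasAntidiagonal.antidiagonal (a.1 + a.2),
          H.leftTerm ε id (a.1 + a.2) (e.1 + e.2) p.1 (k.1 + k.2) (l.1 + l.2) +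
        ∑ p ∈ Finset.HasAntidiagonal.antidiagonal (a.1 + a.2),
          H.rightTerm (a.1 + a.2) (e.1 + e.2) p.2 (k.1 + k.2) (l.1 + l.2) := by
      rw [hH.mul_comul _ _ _ (by rw [bidegree_add, hn])]
      exact hH.sum_pairMul_of_primitive hH.toIsCoalg h.counit_one rfl (by omega)
        (by rw [he1]; exact nat_mem_antidiagonal_one) _ _ _
    -- Between `grProj` and `grIncl` every term can be computed in `P`, where the primitive formula
    -- is known; left and right terms are then compared separately.
    rw [← cancel_mono (grIncl f π k ⊗ₘ grIncl f π l), ← cancel_epi (grProj f π a ⊗ₘ grProj f π e),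
      Category.assoc, ← reassoc_of% h2, hG.comul n k l hkl, reassoc_of% h1, reassoc_of% h3,
      Preadditive.add_comp, Preadditive.add_comp, Preadditive.comp_add, Preadditive.comp_add,
      gr_sum_leftTerm h hG hA he (hkl.trans hn.symm),
      gr_sum_rightTerm h hG hA he (hkl.trans hn.symm)]
  · rw [hc.comul_deg _ _ _ hkl, comp_zero, Finset.sum_eq_zero, Finset.sum_eq_zero, add_zero]
    · intro q _
      by_cases hl : q.2 + e = l
      · exact hc.rightTerm_eq_zero fun hk => hkl (by rw [← hl, ← add_assoc, hk, hn])
      · exact hA.rightTerm_eq_zero hl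
    · intro q _
      by_cases hk : q.1 + e = k
      · exact hc.leftTerm_eq_zero fun hl => hkl (by rw [← hk, add_right_comm, hl, hn])
      · exact hA.leftTerm_eq_zero hk

theorem gr_isBialg (h : (tensorAlgebraData ε Y).IsHom H π) (hG : IsInducedOnGr f π H G)
    (hA : G.IsAlg) (hc : G.IsCoalg) : G.IsBialg ε totalDeg where
  __ := hA
  __ := hc
  one_comul := gr_one_comul h hG
  mul_counit := gr_mul_counit h hG
  one_counit := gr_one_counit h hG
  mul_comul a b c hc' := by
    have hdeg : ∀ a b, totalDeg (a + b) = totalDeg a + totalDeg b :=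
      fun a b => (bidegree_add a b).symm
    induction hm : totalDeg b generalizing a b c with
    | zero =>
      obtain rfl : b = 0 := by
        by_contra hb
        exact bidegree_ne_zero hb hm
      obtain rfl : a = c := by rw [← hc', add_zero]
      have := gr_isIso_one h hG
      exact hA.mulComul_zero hc (gr_one_comul h hG) rfl
        (fun q => by
          obtain ⟨⟨a, b⟩, c, d⟩ := q
          rw [Finset.HasAntidiagonal.mem_antidiagonal]
          simp only [Prod.mk_add_mk, Prod.mk.injEq, Prod.mk_eq_zero]
          omega) a
    | succ m ih =>
      intro u v
      rw [← sub_eq_zero]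
      -- The defect of multiplicativity, with the factor in bidegree `a` transposed, becomes a map
      -- `x` out of `gr` in bidegree `b`. To kill `x` it suffices to treat products `b' e` with a
      -- generator `e`.
      obtain ⟨D, x, hx⟩ := exists_whiskerLeft_test (G.mul a b c ≫ G.comul c u v -
        ∑ p ∈ Finset.HasAntidiagonal.antidiagonal a, ∑ q ∈ Finset.HasAntidiagonal.antidiagonal b,
          (G.comul a p.1 p.2 ⊗ₘ G.comul b q.1 q.2) ≫ G.pairMul ε totalDeg p.1 p.2 q.1 q.2 u v)
      have h0 := hx (𝟙 _)
      rw [whiskerLeft_id, Category.id_comp, Category.id_comp] at h0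
      rw [h0]
      refine gr_eq_zero_of_mul_comp h hG (c := b) (by rintro rfl; simp at hm) x
        fun b' e he hbe => ?_
      rw [← hx, Preadditive.comp_sub, sub_eq_zero]
      have he1 : totalDeg e = 1 := by rcases he with rfl | rfl <;> rfl
      have hb' : totalDeg b' = m := by
        rw [← hbe, hdeg, he1] at hm; omega
      exact hA.mulComul_assoc hdeg (m := a + b') rfl hbe (ih a b' _ rfl hb')
        (gr_mulComul_one h hG hA hc _ he (by rw [add_assoc, hbe, hc']))
        (gr_mulComul_one h hG hA hc _ he hbe) u v

theorem gr_isHopf (h : (tensorAlgebraData ε Y).IsHom H π) (hG : IsInducedOnGr f π H G)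
    (hA : G.IsAlg) (hc : G.IsCoalg) : G.IsHopf ε totalDeg :=
  (gr_isBialg h hG hA hc).isHopf (gr_counit_one h hG) (fun a b => (bidegree_add a b).symm)
    (fun a ha => by
      by_contra h0
      exact bidegree_ne_zero h0 ha)

end GrBialgebra

/-! ### Products of the two edges of a bigraded bialgebra -/

namespace GradedBialgData

section FourFactors

variable {C : Type u} [Category.{v} C] [Abelian C] [MonoidalCategory C] [MonoidalPreadditive C]
variable {ι : Type} [AddCommMonoid ι] {A : ι → C} {G : GradedBialgData A}

theorem IsAlg.tensorHom_mul (h : G.IsAlg) {x y z w a b s t n : ι} (ha : x + y = a) (hb : z + w = b)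
    (hs : y + z = s) (ht : s + w = t) :
    (G.mul x y a ⊗ₘ G.mul z w b) ≫ G.mul a b n = (α_ _ _ _).hom ≫
      A x ◁ ((α_ _ _ _).inv ≫ G.mul y z s ▷ A w ≫ G.mul s w t) ≫ G.mul x t n := by
  rw [MonoidalCategory.tensorHom_def', Category.assoc,
    h.assoc ha (b := t) (by rw [← hb, ← ht, ← hs, add_assoc]), associator_naturality_right_assoc,
    ← whiskerLeft_comp_assoc, h.assoc_inv hs hb]

variable [SymmetricCategory C] {ε : ℤ} {deg : ι → ℕ}

/-- Rebracket `(xy)(zw)` as `x((yz)w)`, exchange `y` and `z`, and bracket back to `(xz)(yw)`. -/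
theorem IsAlg.tensorHom_mul_comm (h : G.IsAlg) {x y z w a b c d n : ι} (ha : x + y = a)
    (hb : z + w = b) (hc : x + z = c) (hd : y + w = d) (hyz : G.Comm ε deg y z) :
    (G.mul x y a ⊗ₘ G.mul z w b) ≫ G.mul a b n =
      (ε ^ (deg y * deg z)) • (tensorμ _ _ _ _ ≫ (G.mul x z c ⊗ₘ G.mul y w d) ≫ G.mul c d n) := by
  rw [h.tensorHom_mul ha hb rfl rfl,
    h.tensorHom_mul hc hd (s := y + z) (add_comm _ _) rfl, hyz (y + z), zsmul_whiskerRight,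
    Preadditive.zsmul_comp, Preadditive.comp_zsmul, whiskerLeft_zsmul, Preadditive.zsmul_comp,
    Preadditive.comp_zsmul, tensorμ]
  congr 1
  simp

end FourFactors

variable {C : Type u} [Category.{v} C] [Abelian C] [MonoidalCategory C] [MonoidalPreadditive C]

/-- The part of a graded structure in degrees `s i`. -/
def pull {κ ι : Type} {A : ι → C} (G : GradedBialgData A) (s : κ → ι) :
    GradedBialgData fun i => A (s i) where
  mul i j k := G.mul (s i) (s j) (s k)
  comul k i j := G.comul (s k) (s i) (s j)
  one i := G.one (s i)
  counit i := G.counit (s i)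

variable [SymmetricCategory C] {ε : ℤ} {A : ℕ × ℕ → C} {G : GradedBialgData A} {R₀ R : ℕ → C}
  {K₀ : GradedBialgData R₀} {K : GradedBialgData R}
  {j : ∀ i, R₀ i ⟶ A (i, 0)} {l : ∀ i, R i ⟶ A (0, i)}

/-- Splittings of `(c.1, 0)` and `(0, c.2)` stay on their own edge, so fixing the target bidegrees
`a`, `b` leaves a single term of `Δ(x)Δ(y)`. -/
theorem IsBialg.mul_comul_edges (h : G.IsBialg ε totalDeg) {a b c : ℕ × ℕ} (hc : a + b = c) :
    G.mul (c.1, 0) (0, c.2) c ≫ G.comul c a b =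
      (G.comul (c.1, 0) (a.1, 0) (b.1, 0) ⊗ₘ G.comul (0, c.2) (0, a.2) (0, b.2)) ≫
        G.pairMul ε totalDeg (a.1, 0) (b.1, 0) (0, a.2) (0, b.2) a b := by
  subst hc
  rw [h.mul_comul _ _ _ (by ext <;> simp) a b, Finset.sum_eq_single ((a.1, 0), (b.1, 0)),
    Finset.sum_eq_single ((0, a.2), (0, b.2))]
  · rintro ⟨⟨q1, q2⟩, q3, q4⟩ hq hne
    rw [h.toIsAlg.pairMul_eq_zero, comp_zero]
    by_contra! hcon
    rw [Finset.HasAntidiagonal.mem_antidiagonal] at hq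
    obtain ⟨a1, a2⟩ := a
    obtain ⟨b1, b2⟩ := b
    simp only [Prod.mk_add_mk, Prod.mk.injEq, ne_eq, not_and] at hq hcon hne
    omega
  · intro hq
    rw [Finset.HasAntidiagonal.mem_antidiagonal] at hq
    simp at hq
  · rintro ⟨⟨p1, p2⟩, p3, p4⟩ hp hne
    refine Finset.sum_eq_zero ?_
    rintro ⟨⟨q1, q2⟩, q3, q4⟩ hq
    rw [h.toIsAlg.pairMul_eq_zero, comp_zero]
    by_contra! hcon
    rw [Finset.HasAntidiagonal.mem_antidiagonal] at hp hq
    obtain ⟨a1, a2⟩ := a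
    obtain ⟨b1, b2⟩ := b
    simp only [Prod.mk_add_mk, Prod.mk.injEq, ne_eq, not_and] at hp hq hcon hne
    omega
  · intro hq
    rw [Finset.HasAntidiagonal.mem_antidiagonal] at hq
    simp at hq

/-- The one surviving term is `(x ⊗ 1)(1 ⊗ y) = x ⊗ y`. Thus the product of the two edges is split
mono. -/
theorem IsBialg.mul_comul_edges_self (h : G.IsBialg ε totalDeg)
    (hconn : G.counit 0 ≫ G.one 0 = 𝟙 _) (a : ℕ × ℕ) :
    G.mul (a.1, 0) (0, a.2) a ≫ G.comul a (a.1, 0) (0, a.2) = 𝟙 _ := by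
  have h1 := h.toIsCoalg.comul_left_zero hconn (0, a.2)
  have h2 := h.toIsCoalg.comul_right_zero hconn (a.1, 0)
  have h3 := h.mul_comul_edges (a := (a.1, 0)) (b := (0, a.2)) (c := a) (by simp)
  refine h3.trans ((congrArg (fun x => (_ ⊗ₘ x) ≫ _) h1).trans
    ((h.toIsAlg.comul_one_pairMul_right (a.1, 0) (0, a.2) 0 (a.1, 0) (0, a.2) rfl).trans ?_))
  rw [rightTerm, h2, comp_whiskerRight, Category.assoc, associator_naturality_middle_assoc,
    ← whiskerLeft_comp, h.one_mul]
  simp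

/-- Products are respected because the middle factors commute up to sign, coproducts because only
one term survives in `mul_comul_edges`. The sign exponents match since an edge element has total
degree equal to its nonzero coordinate. -/
theorem IsBialg.tensor_isHom (h : G.IsBialg ε totalDeg)
    (hcomm : ∀ i i', G.Comm ε totalDeg (0, i) (i', 0)) (hK₀ : K₀.IsAlg) (hK₀' : K₀.IsCoalg)
    (hK : K.IsAlg) (hK' : K.IsCoalg)
    (hj : K₀.IsHom (G.pull fun i => (i, 0)) j) (hl : K.IsHom (G.pull fun i => (0, i)) l) :
    (K₀.tensor ε K).IsHom G fun a => (j a.1 ⊗ₘ l a.2) ≫ G.mul (a.1, 0) (0, a.2) a where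
  mul a b c := by
    by_cases hc : a + b = c
    · have h1 := h.toIsAlg.tensorHom_mul_comm (x := (a.1, 0)) (y := (0, a.2)) (z := (b.1, 0))
        (w := (0, b.2)) (a := a) (b := b) (c := (c.1, 0)) (d := (0, c.2)) (n := c) (by simp)
        (by simp) (by rw [← hc]; simp) (by rw [← hc]; simp) (hcomm _ _)
      have h2 := hj.mul a.1 b.1 c.1
      have h3 := hl.mul a.2 b.2 c.2
      have h4 : totalDeg (0, a.2) * totalDeg (b.1, 0) = a.2 * b.1 := by simp [totalDeg]
      rw [← tensorHom_comp_tensorHom, Category.assoc, h1, h4, Preadditive.comp_zsmul,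
        tensorμ_natural_assoc, tensorHom_comp_tensorHom_assoc]
      dsimp only [tensor]
      rw [Preadditive.zsmul_comp, Category.assoc, tensorHom_comp_tensorHom_assoc, h2, h3]
      rfl
    · rw [h.mul_deg _ _ _ hc, comp_zero]
      dsimp only [tensor]
      by_cases h1 : a.1 + b.1 = c.1
      · rw [hK.mul_deg a.2 b.2 c.2 fun h2 => hc (Prod.ext h1 h2)]
        simp
      · rw [hK₀.mul_deg _ _ _ h1]
        simp
  comul c a b := by
    by_cases hc : a + b = c
    · have h2 := hj.comul c.1 a.1 b.1
      have h3 := hl.comul c.2 a.2 b.2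
      have h4 : totalDeg (b.1, 0) * totalDeg (0, a.2) = b.1 * a.2 := by simp [totalDeg]
      rw [Category.assoc, h.mul_comul_edges hc, pairMul, h4, Preadditive.comp_zsmul,
        Preadditive.comp_zsmul, tensorHom_comp_tensorHom_assoc]
      dsimp only [tensor]
      rw [Preadditive.zsmul_comp, Category.assoc, ← tensorHom_comp_tensorHom,
        ← tensorμ_natural_assoc, tensorHom_comp_tensorHom_assoc, h2, h3]
      rfl
    · rw [h.comul_deg _ _ _ hc, comp_zero]
      dsimp only [tensor]
      by_cases h1 : a.1 + b.1 = c.1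
      · rw [hK'.comul_deg c.2 a.2 b.2 fun h2 => hc (Prod.ext h1 h2)]
        simp
      · rw [hK₀'.comul_deg _ _ _ h1]
        simp
  one a := by
    by_cases ha : a = 0
    · subst ha
      have h1 := hj.one 0
      have h2 := hl.one 0
      have h3 := h.one_mul 0
      dsimp only [tensor]
      rw [Category.assoc, tensorHom_comp_tensorHom_assoc]
      refine (congrArg (fun x => _ ≫ x ≫ _) (congrArg₂ (· ⊗ₘ ·) h1 h2)).trans ?_
      change (λ_ (𝟙_ C)).inv ≫ (G.one 0 ⊗ₘ G.one 0) ≫ G.mul 0 0 0 = G.one 0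
      rw [MonoidalCategory.tensorHom_def', Category.assoc, h3, leftUnitor_naturality,
        Iso.inv_hom_id_assoc]
    · rw [h.one_deg _ ha]
      dsimp only [tensor]
      by_cases h1 : a.1 = 0
      · rw [hK.one_deg a.2 fun h2 => ha (Prod.ext h1 h2)]
        simp
      · rw [hK₀.one_deg _ h1]
        simp
  counit a := by
    by_cases ha : a = 0
    · subst ha
      have h1 := hj.counit 0
      have h2 := hl.counit 0
      have h3 := h.mul_counit
      dsimp only [tensor]
      rw [Category.assoc]
      refine (congrArg (fun x => _ ≫ x) h3).trans ?_
      rw [← Category.assoc]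
      refine congrArg (fun x => x ≫ _) ?_
      refine (tensorHom_comp_tensorHom _ _ _ _).trans ?_
      exact congrArg₂ (· ⊗ₘ ·) h1 h2
    · rw [h.counit_deg _ ha, comp_zero]
      dsimp only [tensor]
      by_cases h1 : a.1 = 0
      · rw [hK'.counit_deg a.2 fun h2 => ha (Prod.ext h1 h2)]
        simp
      · rw [hK₀'.counit_deg _ h1]
        simp

end GradedBialgData

/-! ### The edges of the associated graded object and the isomorphism -/

section GrFactors

variable {C : Type u} [Category.{v} C] [Abelian C] [MonoidalCategory C] [MonoidalPreadditive C]
  [RigidCategory C] [SymmetricCategory C] {X Y : C} {f : X ⟶ Y} {P : ℕ → C}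
  {π : ∀ n, tpow Y n ⟶ P n} {ε : ℤ} {H : GradedBialgData P} [∀ n, Epi (π n)]
  {G : GradedBialgData (grObj f π)}

open GradedBialgData

theorem gr_comm (hG : IsInducedOnGr f π H G) (hA : G.IsAlg)
    (hcomm : ∀ i i', H.Comm ε id i i') (a b : ℕ × ℕ) : G.Comm ε totalDeg a b := by
  intro n
  by_cases hn : a + b = n
  · have h1 := hG.mul b a n ((add_comm b a).trans hn)
    rw [← cancel_epi (grProj f π a ⊗ₘ grProj f π b), ← cancel_mono (grIncl f π n),
      Category.assoc, hG.mul a b n hn, Preadditive.comp_zsmul, Preadditive.zsmul_comp,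
      BraidedCategory.braiding_naturality_assoc, Category.assoc, Category.assoc, h1, hcomm,
      Preadditive.zsmul_comp, Preadditive.comp_zsmul, Category.assoc,
      BraidedCategory.braiding_naturality_assoc]
    rfl
  · rw [hA.mul_deg _ _ _ hn, hA.mul_deg b a n (by rwa [add_comm]), comp_zero, smul_zero]

section Lifts

variable {E E' : C} {a b c : ℕ × ℕ} {y : E ⟶ quotFilt f π a.1 (a.1 + a.2)}
  {y' : E' ⟶ quotFilt f π b.1 (b.1 + b.2)} {u : E ⟶ P (a.1 + a.2)} {u' : E' ⟶ P (b.1 + b.2)}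
  {v : E ⟶ grObj f π a} {v' : E' ⟶ grObj f π b}

theorem gr_mul_of_lift (hG : IsInducedOnGr f π H G)
    (hu : y ≫ (quotFilt f π a.1 (a.1 + a.2)).arrow = u) (hv : y ≫ grProj f π a = v)
    (hu' : y' ≫ (quotFilt f π b.1 (b.1 + b.2)).arrow = u') (hv' : y' ≫ grProj f π b = v')
    (hc : a + b = c) :
    (v ⊗ₘ v') ≫ G.mul a b c ≫ grIncl f π c =
      (u ⊗ₘ u') ≫ H.mul (a.1 + a.2) (b.1 + b.2) (c.1 + c.2) ≫ quotModProj f π c := by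
  rw [← hu, ← hv, ← hu', ← hv', ← tensorHom_comp_tensorHom, Category.assoc, hG.mul a b c hc,
    tensorHom_comp_tensorHom_assoc]

theorem gr_comul_of_lift (hG : IsInducedOnGr f π H G)
    (hu : y ≫ (quotFilt f π a.1 (a.1 + a.2)).arrow = u) (hv : y ≫ grProj f π a = v)
    (hc : b + c = a) :
    v ≫ G.comul a b c ≫ (grIncl f π b ⊗ₘ grIncl f π c) =
      u ≫ H.comul (a.1 + a.2) (b.1 + b.2) (c.1 + c.2) ≫
        (quotModProj f π b ⊗ₘ quotModProj f π c) := by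
  rw [← hu, ← hv, Category.assoc, hG.comul a b c hc, Category.assoc]

theorem gr_counit_of_lift (hG : IsInducedOnGr f π H G)
    (hu : y ≫ (quotFilt f π a.1 (a.1 + a.2)).arrow = u) (hv : y ≫ grProj f π a = v) :
    v ≫ G.counit a = u ≫ H.counit (a.1 + a.2) := by
  rw [← hu, ← hv, Category.assoc, hG.counit, Category.assoc]

theorem grIncl_of_lift (hu : y ≫ (quotFilt f π a.1 (a.1 + a.2)).arrow = u)
    (hv : y ≫ grProj f π a = v) : v ≫ grIncl f π a = u ≫ quotModProj f π a := by
  rw [← hu, ← hv, Category.assoc, grProj_grIncl, Category.assoc]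

end Lifts

/-- The image of the tensor powers of `X` is the part of bidegrees `(i, 0)` of the associated
graded object. -/
theorem exists_image_isHom_gr (hG : IsInducedOnGr f π H G) (hA : G.IsAlg) (hc : G.IsCoalg)
    {R₀ : ℕ → C} {K₀ : GradedBialgData R₀} (hK : K₀.IsAlg) (hK' : K₀.IsCoalg)
    {m : ∀ i, R₀ i ⟶ P i} [∀ i, Mono (m i)] (hm : K₀.IsHom H m) {ξ : ∀ i, tpow X i ⟶ R₀ i}
    [∀ i, Epi (ξ i)] (hξ : ∀ i, ξ i ≫ m i = tpowMap f i ≫ π i) :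
    ∃ j : ∀ i, R₀ i ⟶ grObj f π (i, 0), (∀ i, IsIso (j i)) ∧
      K₀.IsHom (G.pull fun i => (i, 0)) j := by
  have h1 : ∀ i, ∃ y : R₀ i ⟶ quotFilt f π i (i + 0), y ≫ (quotFilt f π i (i + 0)).arrow = m i :=
    fun i => exists_lift_quotFilt _ (by
      rw [← cancel_epi (ξ i), comp_zero, reassoc_of% hξ]
      exact (tpowFilt_self_arrow_comp_iff f i _).1
        ((quotFilt_arrow_comp_iff i i _).1 (quotFilt_arrow_comp_π le_rfl i)))
  choose y hy using h1
  refine ⟨fun i => y i ≫ grProj f π (i, 0), fun i => ?_, ⟨fun i i' k => ?_, fun k i i' => ?_,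
    fun i => ?_, fun i => ?_⟩⟩
  · have e1 : (y i ≫ grProj f π (i, 0)) ≫ grIncl f π (i, 0) = m i ≫ quotModProj f π (i, 0) :=
      grIncl_of_lift (a := (i, 0)) (hy i) rfl
    -- In bidegree `(i, 0)` the quotient is by `Fⁱ⁺¹(P i) = 0`.
    have e2 : Mono (quotModProj f π (i, 0)) := filtπ_mono (f := f) (π := π) (Nat.lt_succ_self i)
    have e3 : Mono (m i ≫ quotModProj f π (i, 0)) := mono_comp' inferInstance e2
    have e4 : Mono (y i ≫ grProj f π (i, 0)) := by
      rw [← e1] at e3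
      exact mono_of_mono _ (grIncl f π (i, 0))
    -- `Fⁱ(P i)` is the image of `X^{⊗i}`, which factors through `R₀ i`.
    have e5 : Epi (y i) := by
      refine Preadditive.epi_of_cancel_zero _ fun {D} h hh => ?_
      obtain ⟨D', z, h', _, hz⟩ := exists_extension (quotFilt f π i (i + 0)).arrow h
      rw [← cancel_mono z, hz, zero_comp]
      refine (quotFilt_arrow_comp_iff i i _).2 ((tpowFilt_self_arrow_comp_iff f i _).2 ?_)
      rw [← reassoc_of% hξ]
      have e6 : m i ≫ h' = y i ≫ h ≫ z := by
        rw [hz, ← Category.assoc, hy i]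
      exact (congrArg _ e6).trans (by rw [reassoc_of% hh, zero_comp, comp_zero])
    have e6 : Epi (y i ≫ grProj f π (i, 0)) := epi_comp _ _
    exact isIso_of_mono_of_epi _
  · by_cases hk : i + i' = k
    · refine (cancel_mono (grIncl f π (k, 0))).1 ?_
      rw [Category.assoc]
      refine Eq.trans ?_ ((gr_mul_of_lift hG (a := (i, 0)) (b := (i', 0)) (c := (k, 0)) (hy i) rfl
        (hy i') rfl (by rw [← hk]; rfl)).symm.trans (Category.assoc _ _ _).symm)
      refine (congrArg _ (grIncl_of_lift (a := (k, 0)) (hy k) rfl)).trans ?_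
      have := hm.mul i i' k
      exact (Category.assoc _ _ _).symm.trans ((congrArg (· ≫ _) this).trans
        (Category.assoc _ _ _))
    · rw [hK.mul_deg _ _ _ hk, zero_comp]
      refine ((congrArg _ (hA.mul_deg (i, 0) (i', 0) (k, 0) fun h => hk ?_)).trans comp_zero).symm
      exact (Prod.ext_iff.1 h).1
  · by_cases hk : i + i' = k
    · refine (cancel_mono (grIncl f π (i, 0) ⊗ₘ grIncl f π (i', 0))).1 ?_
      rw [Category.assoc, Category.assoc]
      refine Eq.trans ?_ (gr_comul_of_lift hG (a := (k, 0)) (b := (i, 0)) (c := (i', 0)) (hy k) rfl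
        (by rw [← hk]; rfl)).symm
      refine (congrArg _ ((tensorHom_comp_tensorHom _ _ _ _).trans (congrArg₂ (· ⊗ₘ ·)
        (grIncl_of_lift (a := (i, 0)) (hy i) rfl) (grIncl_of_lift (a := (i', 0)) (hy i') rfl)))).trans ?_
      have := hm.comul k i i'
      refine (congrArg _ (tensorHom_comp_tensorHom _ _ _ _).symm).trans ?_
      exact (Category.assoc _ _ _).symm.trans ((congrArg (· ≫ _) this).trans
        (Category.assoc _ _ _))
    · rw [hK'.comul_deg _ _ _ hk, zero_comp]
      refine ((congrArg _ (hc.comul_deg (k, 0) (i, 0) (i', 0) fun h => hk ?_)).trans comp_zero).symm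
      exact (Prod.ext_iff.1 h).1
  · refine (cancel_mono (grIncl f π (i, 0))).1 ?_
    refine Eq.trans ?_ (hG.one (i, 0)).symm
    rw [Category.assoc]
    refine (congrArg _ (grIncl_of_lift (a := (i, 0)) (hy i) rfl)).trans ?_
    exact (Category.assoc _ _ _).symm.trans (congrArg (· ≫ _) (hm.one i))
  · exact (gr_counit_of_lift hG (a := (i, 0)) (hy i) rfl).trans (hm.counit i)

section Cast

variable {n n' i i' k k' : ℕ}

theorem mul_eqToHom (hi : i = i') (hj : k = k') (hn : n = n') :
    H.mul i k n ≫ eqToHom (congrArg P hn) =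
      (eqToHom (congrArg P hi) ⊗ₘ eqToHom (congrArg P hj)) ≫ H.mul i' k' n' := by
  subst hi hj hn; simp

theorem comul_eqToHom (hi : i = i') (hj : k = k') (hn : n = n') :
    H.comul n i k ≫ (eqToHom (congrArg P hi) ⊗ₘ eqToHom (congrArg P hj)) =
      eqToHom (congrArg P hn) ≫ H.comul n' i' k' := by
  subst hi hj hn; simp

theorem one_eqToHom (hn : n = n') : H.one n ≫ eqToHom (congrArg P hn) = H.one n' := by
  subst hn; simp

theorem eqToHom_counit (hn : n = n') : eqToHom (congrArg P hn) ≫ H.counit n' = H.counit n := by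
  subst hn; simp

theorem quotFilt_arrow_eqToHom_comp (hn : n = n') (s : ℕ) {D : C} (x : P n' ⟶ D)
    (hx : (quotFilt f π s n').arrow ≫ x = 0) :
    (quotFilt f π s n).arrow ≫ eqToHom (congrArg P hn) ≫ x = 0 := by
  subst hn; simpa using hx

end Cast

/-- The quotient by the first step of the filtration is the part of bidegrees `(0, i)` of the
associated graded object. -/
theorem exists_quotient_isHom_gr (hG : IsInducedOnGr f π H G) (hA : G.IsAlg) (hc : G.IsCoalg)
    {R : ℕ → C} {K : GradedBialgData R} (hK : K.IsAlg) (hK' : K.IsCoalg)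
    {ρ : ∀ i, P i ⟶ R i} [∀ i, Epi (ρ i)] (hρ : H.IsHom K ρ)
    (hρ₁ : ∀ i, (quotFilt f π 1 i).arrow ≫ ρ i = 0)
    (hd : ∀ (i : ℕ) {D : C} (h : P i ⟶ D), (quotFilt f π 1 i).arrow ≫ h = 0 → ∃ h', ρ i ≫ h' = h) :
    ∃ l : ∀ i, R i ⟶ grObj f π (0, i), (∀ i, IsIso (l i)) ∧
      K.IsHom (G.pull fun i => (0, i)) l := by
  -- Bidegree `(0, i)` has total degree `0 + i`, which is not definitionally `i`; `θ` carries the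
  -- structure across.
  let θ : ∀ i, P i ⟶ P (0 + i) := fun i => eqToHom (congrArg P (zero_add i).symm)
  have hθ : ∀ i, IsIso (θ i) := fun i => inferInstanceAs (IsIso (eqToHom _))
  have h1 : ∀ i, ∃ y : P i ⟶ quotFilt f π 0 (0 + i), y ≫ (quotFilt f π 0 (0 + i)).arrow = θ i :=
    fun i => ⟨θ i ≫ inv (quotFilt f π 0 (0 + i)).arrow, by simp⟩
  choose y hy using h1
  have h2 : ∀ i, ∃ l : R i ⟶ grObj f π (0, i), ρ i ≫ l = y i ≫ grProj f π (0, i) := by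
    intro i
    refine hd i _ ?_
    refine (cancel_mono (grIncl f π (0, i))).1 ?_
    rw [Category.assoc, zero_comp, grIncl_of_lift (a := (0, i)) (hy i) rfl]
    exact quotFilt_arrow_eqToHom_comp (zero_add i).symm 1 _ (quotFilt_arrow_comp_π le_rfl _)
  choose l hl using h2
  have hl' : ∀ i, ρ i ≫ l i ≫ grIncl f π (0, i) = θ i ≫ quotModProj f π (0, i) := fun i => by
    rw [reassoc_of% hl i]
    exact (Category.assoc _ _ _).symm.trans (grIncl_of_lift (a := (0, i)) (hy i) rfl)
  refine ⟨l, fun i => ?_, ⟨fun i i' k => ?_, fun k i i' => ?_, fun i => ?_, fun i => ?_⟩⟩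
  · have e1 : Epi (y i) := by
      have : y i = θ i ≫ inv (quotFilt f π 0 (0 + i)).arrow := by
        rw [← hy i, Category.assoc, IsIso.hom_inv_id, Category.comp_id]
      rw [this]; infer_instance
    have e2 : Epi (ρ i ≫ l i) := by rw [hl]; exact epi_comp _ _
    have e3 : Epi (l i) := epi_of_epi (ρ i) _
    -- Since `ρ` kills `F¹`, it factors through `P/F¹` and yields a retraction of `l i` followed by
    -- `grIncl`.
    obtain ⟨w, hw⟩ : ∃ w : quotMod f π (0, i) ⟶ R i, quotModProj f π (0, i) ≫ w = inv (θ i) ≫ ρ i :=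
      exists_desc_filtπ (f := f) (π := π) (i := 1) (n := 0 + i) (inv (θ i) ≫ ρ i) (by
        have := quotFilt_arrow_eqToHom_comp (f := f) (π := π) (zero_add i) 1 (ρ i) (hρ₁ i)
        simpa [θ] using this)
    have e4 : l i ≫ grIncl f π (0, i) ≫ w = 𝟙 _ := by
      rw [← cancel_epi (ρ i), reassoc_of% hl' i]
      refine (congrArg _ hw).trans ?_
      simp
    have e5 : Mono (l i ≫ grIncl f π (0, i) ≫ w) := by rw [e4]; infer_instance
    have e6 : Mono (l i) := mono_of_mono _ (grIncl f π (0, i) ≫ w)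
    exact isIso_of_mono_of_epi _
  · by_cases hk : i + i' = k
    · refine (cancel_epi (ρ i ⊗ₘ ρ i')).1 ((cancel_mono (grIncl f π (0, k))).1 ?_)
      rw [tensorHom_comp_tensorHom_assoc, Category.assoc, Category.assoc]
      refine Eq.trans ?_ ((gr_mul_of_lift hG (a := (0, i)) (b := (0, i')) (c := (0, k)) (hy i)
        (hl i).symm (hy i') (hl i').symm (by rw [← hk]; rfl)).symm.trans (Category.assoc _ _ _).symm)
      have h3 := hρ.mul i i' k
      rw [← reassoc_of% h3, hl']
      exact (Category.assoc _ _ _).symm.trans ((congrArg (· ≫ _) (mul_eqToHom (zero_add i).symm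
        (zero_add i').symm (zero_add k).symm)).trans (Category.assoc _ _ _))
    · rw [hK.mul_deg _ _ _ hk, zero_comp]
      refine ((congrArg _ (hA.mul_deg (0, i) (0, i') (0, k) fun h => hk ?_)).trans comp_zero).symm
      exact (Prod.ext_iff.1 h).2
  · by_cases hk : i + i' = k
    · refine (cancel_epi (ρ k)).1 ((cancel_mono (grIncl f π (0, i) ⊗ₘ grIncl f π (0, i'))).1 ?_)
      have h3 := hρ.comul k i i'
      rw [← reassoc_of% h3, Category.assoc, Category.assoc, Category.assoc,
        tensorHom_comp_tensorHom, tensorHom_comp_tensorHom, Category.assoc]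
      refine Eq.trans ?_ ((gr_comul_of_lift hG (a := (0, k)) (b := (0, i)) (c := (0, i')) (hy k)
        (hl k).symm (by rw [← hk]; rfl)).symm.trans (Category.assoc _ _ _))
      rw [hl', hl', ← tensorHom_comp_tensorHom]
      exact (Category.assoc _ _ _).symm.trans ((congrArg (· ≫ _) (comul_eqToHom (zero_add i).symm
        (zero_add i').symm (zero_add k).symm)).trans (Category.assoc _ _ _))
    · rw [hK'.comul_deg _ _ _ hk, zero_comp]
      refine ((congrArg _ (hc.comul_deg (0, k) (0, i) (0, i') fun h => hk ?_)).trans comp_zero).symm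
      exact (Prod.ext_iff.1 h).2
  · refine (cancel_mono (grIncl f π (0, i))).1 ?_
    refine Eq.trans ?_ (hG.one (0, i)).symm
    rw [← hρ.one, Category.assoc, Category.assoc, hl', ← Category.assoc,
      one_eqToHom (zero_add i).symm]
  · rw [← cancel_epi (ρ i), hρ.counit, ← Category.assoc]
    exact (gr_counit_of_lift hG (a := (0, i)) (hy i) (hl i).symm).trans
      (eqToHom_counit (zero_add i).symm)

/-- Induction on total degree. Write an element as `(xy)e` with `x`, `y` on the edges and `e` a
generator. If `e` has bidegree `(0, 1)` it is absorbed as `x(ye)`; if `(1, 0)`, commutativity moves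
it past `y` to give `±(xe)y`. -/
theorem gr_epi_mul_edges (h : (tensorAlgebraData ε Y).IsHom H π) (hG : IsInducedOnGr f π H G)
    (hA : G.IsAlg) (hcomm : ∀ a b, G.Comm ε totalDeg a b) (a : ℕ × ℕ) :
    Epi (G.mul (a.1, 0) (0, a.2) a) := by
  induction hm : totalDeg a generalizing a with
  | zero =>
    obtain rfl : a = 0 := by
      by_contra ha
      exact bidegree_ne_zero ha hm
    have h1 : Epi (grObj f π 0 ◁ G.one 0 ≫ G.mul 0 0 0) := by
      rw [hA.mul_one]; infer_instance
    exact epi_of_epi (grObj f π 0 ◁ G.one 0) _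
  | succ m ih =>
    refine Preadditive.epi_of_cancel_zero _ fun {D} x hx => ?_
    have hx' : ∀ t : ℕ × ℕ, t = (0, a.2) → ∀ s : ℕ × ℕ, s = (a.1, 0) → G.mul s t a ≫ x = 0 := by
      rintro _ rfl _ rfl; exact hx
    refine gr_eq_zero_of_mul_comp h hG (c := a) (by rintro rfl; simp at hm) x
      fun b e he hbe => ?_
    have hb : totalDeg b = m := by
      have h1 : totalDeg e = 1 := by rcases he with rfl | rfl <;> rfl
      have h2 := bidegree_add b e
      rw [hbe] at h2
      dsimp only [totalDeg] at *
      omega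
    have := ih b hb
    rw [← cancel_epi (G.mul (b.1, 0) (0, b.2) b ▷ grObj f π e), comp_zero, ← Category.assoc,
      hA.assoc (b := (0, b.2) + e) (by simp) rfl, Category.assoc, Category.assoc]
    rcases he with rfl | rfl
    · rw [hcomm, whiskerLeft_zsmul, Preadditive.zsmul_comp, Preadditive.comp_zsmul]
      refine zsmul_hom_eq_zero _ ?_
      have h1 := hA.assoc_inv (i := (b.1, 0)) (j := (1, 0)) (k := (0, b.2)) (a := (a.1, 0))
        (b := (0, b.2) + (1, 0)) (n := a) (by rw [← hbe]; rfl) (add_comm _ _)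
      rw [whiskerLeft_comp, Category.assoc, reassoc_of% h1, hx' _ (by rw [← hbe]; simp) _ rfl,
        comp_zero, comp_zero, comp_zero, comp_zero]
    · rw [hx' _ (by rw [← hbe]; simp) _ (by rw [← hbe]; simp), comp_zero, comp_zero]

theorem exists_gr_iso (h : (tensorAlgebraData ε Y).IsHom H π) (hG : IsInducedOnGr f π H G)
    (hA : G.IsAlg) (hc : G.IsCoalg) (hcomm : ∀ i i', H.Comm ε id i i')
    {R₀ : ℕ → C} {K₀ : GradedBialgData R₀} {m : ∀ i, R₀ i ⟶ P i} [∀ i, Mono (m i)]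
    (hm : K₀.IsHom H m) {ξ : ∀ i, tpow X i ⟶ R₀ i} [∀ i, Epi (ξ i)]
    (hξ : ∀ i, ξ i ≫ m i = tpowMap f i ≫ π i)
    {R : ℕ → C} {K : GradedBialgData R} {ρ : ∀ i, P i ⟶ R i} [∀ i, Epi (ρ i)] (hρ : H.IsHom K ρ)
    (hρ₁ : ∀ i, (quotFilt f π 1 i).arrow ≫ ρ i = 0)
    (hd : ∀ (i : ℕ) {D : C} (h : P i ⟶ D), (quotFilt f π 1 i).arrow ≫ h = 0 → ∃ h', ρ i ≫ h' = h) :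
    ∃ φ : ∀ a : ℕ × ℕ, grObj f π a ≅ R₀ a.1 ⊗ R a.2,
      G.IsHom (K₀.tensor ε K) fun a => (φ a).hom := by
  have hB := gr_isBialg h hG hA hc
  have hH := h.isBialg_of_tensorAlgebra
  have hK₀ := hH.toIsAlg.of_mono m hm.mul hm.one
  have hK₀' := hH.toIsCoalg.of_mono m hm.comul hm.counit
  have hK := hH.toIsAlg.of_epi ρ hρ.mul hρ.one
  have hK' := hH.toIsCoalg.of_epi ρ hρ.comul hρ.counit
  obtain ⟨j, hji, hj⟩ := exists_image_isHom_gr hG hA hc hK₀ hK₀' hm hξ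
  obtain ⟨l, hli, hl⟩ := exists_quotient_isHom_gr hG hA hc hK hK' hρ hρ₁ hd
  have hcomm' := gr_comm hG hA hcomm
  have h1 : ∀ a : ℕ × ℕ, IsIso (G.mul (a.1, 0) (0, a.2) a) := fun a => by
    have e1 := gr_epi_mul_edges h hG hA hcomm' a
    have e2 := hB.mul_comul_edges_self (gr_counit_one h hG) a
    have e3 : Mono (G.mul (a.1, 0) (0, a.2) a ≫ G.comul a (a.1, 0) (0, a.2)) := by
      rw [e2]; infer_instance
    have e4 := mono_of_mono (G.mul (a.1, 0) (0, a.2) a) (G.comul a (a.1, 0) (0, a.2))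
    exact isIso_of_mono_of_epi _
  have h2 : ∀ a : ℕ × ℕ, IsIso ((j a.1 ⊗ₘ l a.2) ≫ G.mul (a.1, 0) (0, a.2) a) := fun a =>
    IsIso.comp_isIso
  refine ⟨fun a => (asIso ((j a.1 ⊗ₘ l a.2) ≫ G.mul (a.1, 0) (0, a.2) a)).symm, ?_⟩
  exact IsHom.of_iso (hB.tensor_isHom (fun i i' => hcomm' _ _) hK₀ hK₀' hK hK' hj hl)

end GrFactors

/-! ### Application to quadratic algebras and the relations `Λ²`, `Γ²` -/

section QuadraticGr

variable {C : Type u} [Category.{v} C] [Abelian C] [MonoidalCategory C] [MonoidalPreadditive C]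
  [RigidCategory C] [SymmetricCategory C] {ε : ℤ}

open GradedBialgData

/-- The quotient of `P` by the first step of the filtration inherits its structure. -/
theorem exists_quotFilt_quotient {X Y : C} {f : X ⟶ Y} {P : ℕ → C} {π : ∀ n, tpow Y n ⟶ P n}
    [∀ n, Epi (π n)] {H : GradedBialgData P} (h : (tensorAlgebraData ε Y).IsHom H π)
    {R : ℕ → C} {ρ : ∀ i, P i ⟶ R i} [∀ i, Epi (ρ i)]
    (hρ₁ : ∀ i, (quotFilt f π 1 i).arrow ≫ ρ i = 0)
    (hd : ∀ (i : ℕ) {D : C} (h : P i ⟶ D), (quotFilt f π 1 i).arrow ≫ h = 0 → ∃ h', ρ i ≫ h' = h) :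
    ∃ K : GradedBialgData R, H.IsHom K ρ := by
  have hw : ∀ i, ∃ w, filtπ f π 1 i ≫ w = ρ i := fun i => exists_desc_filtπ _ (hρ₁ i)
  choose w hw using hw
  refine exists_quotient H ρ (fun i => (quotFilt f π 1 i).arrow) hd (fun i j k => ?_)
    (fun i j k => ?_) (fun _ _ _ k i j => ?_) (fun i => ?_)
  -- As `F⁰` is everything, `F¹` being an ideal is the case `F¹ F⁰ ⊆ F¹` of multiplicativity.
  · rw [← cancel_epi ((quotFilt f π 1 i : C) ◁ (quotFilt f π 0 j).arrow), comp_zero,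
      ← MonoidalCategory.tensorHom_def'_assoc, ← hw,
      reassoc_of% quotFilt_mul h (f := f) (a := 1) (b := 0) (c := 1) le_rfl i j k, zero_comp]
  · rw [← cancel_epi ((quotFilt f π 0 i).arrow ▷ (quotFilt f π 1 j : C)), comp_zero,
      ← MonoidalCategory.tensorHom_def_assoc, ← hw,
      reassoc_of% quotFilt_mul h (f := f) (a := 0) (b := 1) (c := 1) le_rfl i j k, zero_comp]
  · rw [← hw, ← hw, ← tensorHom_comp_tensorHom,
      reassoc_of% quotFilt_comul h (f := f) (a := 1) (b := 1) (c := 1) le_rfl k i j, zero_comp]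
  · cases i with
    | zero => rw [quotFilt_arrow_eq_zero Nat.one_pos, zero_comp]
    | succ i => rw [h.isBialg_of_tensorAlgebra.counit_deg _ (Nat.succ_ne_zero i), comp_zero]

theorem isIso_toTpowOne_quadπ {X K : C} (κ : K ⟶ X ⊗ X) : IsIso (toTpowOne X ≫ quadπ κ 1) := by
  have h1 := isIso_quadπ κ 1 rfl
  have h2 : IsIso (toTpowOne X) := inferInstanceAs (IsIso (λ_ X).inv)
  exact IsIso.comp_isIso

/-- The decomposition of the associated graded object of a quadratic algebra whose relations
include commutativity. -/
theorem exists_gr_quadAlg_iso {X Y K L : C} {f : X ⟶ Y} [Mono f] {κ : K ⟶ X ⊗ X} {l : L ⟶ Y ⊗ Y}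
    (h : ∃ k : K ⟶ L, k ≫ l = κ ≫ (f ⊗ₘ f)) (hε : ε * ε = 1) {HX : GradedBialgData (quadAlg κ)}
    {HY : GradedBialgData (quadAlg l)} (hX : (tensorAlgebraData ε X).IsHom HX (quadπ κ))
    (hY : (tensorAlgebraData ε Y).IsHom HY (quadπ l)) (hl : ∃ r, r ≫ l = 𝟙 _ - ε • (β_ Y Y).hom)
    {R : ℕ → C} {HR : GradedBialgData R} {ρ : ∀ i, quadAlg l i ⟶ R i} [∀ i, Epi (ρ i)]
    (hρ : HY.IsHom HR ρ) (hρ₁ : ∀ i, (quotFilt f (quadπ l) 1 i).arrow ≫ ρ i = 0)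
    (hd : ∀ (i : ℕ) {D : C} (h : quadAlg l i ⟶ D),
      (quotFilt f (quadπ l) 1 i).arrow ≫ h = 0 → ∃ h', ρ i ≫ h' = h) :
    ∃ (h₀ : GradedBialgData fun n => image (quadMap κ l f h n))
      (hG : GradedBialgData (grObj f (quadπ l))),
      (h₀.IsHopf ε id ∧ HX.IsHom h₀ (fun n => factorThruImage (quadMap κ l f h n)) ∧
        h₀.IsHom HY (fun n => image.ι (quadMap κ l f h n))) ∧
      (hG.IsHopf ε (fun a => a.1 + a.2) ∧ IsInducedOnGr f (quadπ l) HY hG) ∧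
      (∃ φ : ∀ a : ℕ × ℕ, grObj f (quadπ l) a ≅ image (quadMap κ l f h a.1) ⊗ R a.2,
        hG.IsHom (h₀.tensor ε HR) (fun a => (φ a).hom)) ∧
      HasStandardStart h₀ (toTpowOne X ≫ quadπ κ 1 ≫ factorThruImage (quadMap κ l f h 1)) := by
  obtain ⟨h₀, he, hm⟩ := IsHom.exists_image (H := HX) (L := HY)
    (e := fun n => factorThruImage (quadMap κ l f h n)) (m := fun n => image.ι (quadMap κ l f h n))
    (by simpa only [image.fac] using quadMap_isHom f h hX hY)
  have hξ : ∀ n, Epi (quadπ κ n ≫ factorThruImage (quadMap κ l f h n)) := fun n => epi_comp _ _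
  have h₀T := hX.comp he
  obtain ⟨G, hG, hA, hc⟩ := exists_gr (f := f) hY
  have hY1 := hY.epi_one
  have hY2 := hY.epi_mul_one
  refine ⟨h₀, G, ⟨h₀T.isHopf_of_tensorAlgebra, he, hm⟩, ⟨gr_isHopf hY hG hA hc, hG⟩, ?_, ?_⟩
  · exact exists_gr_iso hY hG hA hc (fun i i' => hY.isBialg_of_tensorAlgebra.comm_of_degree_one hε
      (fun n => hY.comm_one_of_quad hl n) i i') hm
      (ξ := fun n => quadπ κ n ≫ factorThruImage (quadMap κ l f h n))
      (fun n => by rw [Category.assoc, image.fac, quadπ_quadMap]) hρ hρ₁ hd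
  -- There are no relations in degree one, so up to isomorphism `quadMap` is `f` there. It is mono,
  -- and its image is `X`.
  · have h1 := isIso_toTpowOne_quadπ κ
    have h2 := isIso_toTpowOne_quadπ l
    have h3 : (toTpowOne X ≫ quadπ κ 1) ≫ quadMap κ l f h 1 = f ≫ toTpowOne Y ≫ quadπ l 1 := by
      rw [Category.assoc, quadπ_quadMap, ← Category.assoc, ← Category.assoc]
      congr 1
      change (λ_ X).inv ≫ (𝟙 (𝟙_ C) ⊗ₘ f) = f ≫ (λ_ Y).inv
      rw [id_tensorHom, leftUnitor_inv_naturality]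
    have h4 : Mono (quadMap κ l f h 1) := by
      rw [← IsIso.inv_hom_id_assoc (toTpowOne X ≫ quadπ κ 1) (quadMap κ l f h 1), h3]
      infer_instance
    have h5 : IsIso (factorThruImage (quadMap κ l f h 1)) := by
      have : Mono (factorThruImage (quadMap κ l f h 1) ≫ image.ι _) := by rwa [image.fac]
      have := mono_of_mono (factorThruImage (quadMap κ l f h 1)) (image.ι _)
      exact isIso_of_mono_of_epi _
    have h6 : IsIso (toTpowOne X ≫ quadπ κ 1 ≫ factorThruImage (quadMap κ l f h 1)) := by
      rw [← Category.assoc]; infer_instance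
    exact h₀T.hasStandardStart _

/-- Symmetry of the braiding gives `(1 - c)(1 + c) = 1 - c² = 0`. -/
theorem lambdaTwoι_comp (X : C) : lambdaTwoι X ≫ (𝟙 _ + (1 : ℤ) • (β_ X X).hom) = 0 := by
  rw [← cancel_epi (factorThruImage (oneSubBraid X)), comp_zero, lambdaTwoι, image.fac_assoc]
  simp [oneSubBraid, Preadditive.sub_comp, Preadditive.comp_add]

theorem exists_comp_lambdaTwoι (X : C) :
    ∃ r, r ≫ lambdaTwoι X = 𝟙 _ - (1 : ℤ) • (β_ X X).hom :=
  ⟨factorThruImage (oneSubBraid X), by rw [lambdaTwoι, image.fac, oneSubBraid, one_smul]⟩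

theorem gammaTwoι_comp (X : C) : gammaTwoι X ≫ (𝟙 _ + (-1 : ℤ) • (β_ X X).hom) = 0 := by
  have h : gammaTwoι X ≫ factorThruImage (oneSubBraid X) ≫ image.ι (oneSubBraid X) = 0 := by
    rw [gammaTwoι, kernel.condition_assoc, zero_comp]
  rw [image.fac] at h
  rwa [neg_smul, one_smul, ← sub_eq_add_neg]

/-- By `c² = 1` again, `1 + c` is killed by `1 - c` and so factors through its kernel. -/
theorem exists_comp_gammaTwoι (X : C) :
    ∃ r, r ≫ gammaTwoι X = 𝟙 _ - (-1 : ℤ) • (β_ X X).hom :=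
  ⟨kernel.lift _ (𝟙 _ - (-1 : ℤ) • (β_ X X).hom) (by
    rw [← cancel_mono (image.ι (oneSubBraid X)), Category.assoc, image.fac, zero_comp]
    simp [oneSubBraid, Preadditive.comp_sub, Preadditive.add_comp, add_comm]), kernel.lift_ι _ _ _⟩

/-- Images of a natural map are carried onto each other by an epimorphism. A kernel such as `Γ²`
admits no such argument, which is why the second factor for `∧` is a pushout instead of `∧Z`. -/
theorem exists_lambdaTwoι_epi {X Y : C} (g : X ⟶ Y) [Epi g] :
    ∃ k, Epi k ∧ k ≫ lambdaTwoι Y = lambdaTwoι X ≫ (g ⊗ₘ g) := by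
  obtain ⟨k, hk⟩ := lambdaTwoι_natural g
  refine ⟨k, ?_, hk⟩
  have hm : Mono (lambdaTwoι Y) := inferInstanceAs (Mono (image.ι _))
  have h : factorThruImage (oneSubBraid X) ≫ k = (g ⊗ₘ g) ≫ factorThruImage (oneSubBraid Y) := by
    rw [← cancel_mono (lambdaTwoι Y), Category.assoc, hk, Category.assoc, lambdaTwoι, lambdaTwoι,
      image.fac, image.fac_assoc, oneSubBraid_natural]
  have h1 : Epi (factorThruImage (oneSubBraid X) ≫ k) := by rw [h]; infer_instance
  exact epi_of_epi (factorThruImage (oneSubBraid X)) k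

end QuadraticGr

end

/-! ### The symmetric and the exterior algebra of an extension -/

theorem mainTheorem10 {k : Type*} [Field k] [IsAlgClosed k] (p : ℕ) [Fact p.Prime] [CharP k p]
    {C : Type u} [Category.{v} C] [Abelian C] [Linear k C] [MonoidalCategory C]
    [MonoidalPreadditive C] [MonoidalLinear k C] [SymmetricCategory C] [RigidCategory C]
    (hC : IsTensorCategory k C) (S : ShortComplex C) (hS : S.ShortExact) :
    -- the symmetric algebra
    (∃ (hX : GradedBialgData (symPow S.X₁)) (hY : GradedBialgData (symPow S.X₂))
      (hZ : GradedBialgData (symPow S.X₃)) (h₀ : GradedBialgData (symImage S.f))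
      (hG : GradedBialgData (grObj S.f (symπ S.X₂))),
      -- the Hopf algebra structures of `Sym X`, `Sym Y`, `Sym Z` as quotients of tensor algebras
      (hX.IsHopf 1 id ∧ (tensorAlgebraData 1 S.X₁).IsHom hX (symπ S.X₁)) ∧
      (hY.IsHopf 1 id ∧ (tensorAlgebraData 1 S.X₂).IsHom hY (symπ S.X₂)) ∧
      (hZ.IsHopf 1 id ∧ (tensorAlgebraData 1 S.X₃).IsHom hZ (symπ S.X₃)) ∧
      -- the one of `R₀`, the image of `Sym X ⟶ Sym Y`
      (h₀.IsHopf 1 id ∧ hX.IsHom h₀ (fun n => factorThruImage (symMap S.f n)) ∧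
        h₀.IsHom hY (fun n => image.ι (symMap S.f n))) ∧
      -- the bigraded one of `gr Sym Y`, induced by that of `Sym Y`
      (hG.IsHopf 1 (fun a => a.1 + a.2) ∧ IsInducedOnGr S.f (symπ S.X₂) hY hG) ∧
      -- `gr Sym Y ≅ R₀ ⊗ Sym Z`
      (∃ φ : ∀ a : ℕ × ℕ, grObj S.f (symπ S.X₂) a ≅ symImage S.f a.1 ⊗ symPow S.X₃ a.2,
        hG.IsHom (h₀.tensor 1 hZ) (fun a => (φ a).hom)) ∧
      HasStandardStart h₀
        (toTpowOne S.X₁ ≫ symπ S.X₁ 1 ≫ factorThruImage (symMap S.f 1)) ∧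
      HasStandardStart hZ (toTpowOne S.X₃ ≫ symπ S.X₃ 1)) ∧
    -- the exterior algebra, with the Koszul sign rule
    (∃ (hX : GradedBialgData (extPow S.X₁)) (hY : GradedBialgData (extPow S.X₂))
      (h₁ : GradedBialgData (extImage S.f)) (h₂ : GradedBialgData (extPushout S.g))
      (hG : GradedBialgData (grObj S.f (extπ S.X₂))),
      -- the Hopf algebra structures of `∧X`, `∧Y` as quotients of tensor algebras
      (hX.IsHopf (-1) id ∧ (tensorAlgebraData (-1) S.X₁).IsHom hX (extπ S.X₁)) ∧
      (hY.IsHopf (-1) id ∧ (tensorAlgebraData (-1) S.X₂).IsHom hY (extπ S.X₂)) ∧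
      -- the one of `R₁`, the image of `∧X ⟶ ∧Y`
      (h₁.IsHopf (-1) id ∧ hX.IsHom h₁ (fun n => factorThruImage (extMap S.f n)) ∧
        h₁.IsHom hY (fun n => image.ι (extMap S.f n))) ∧
      -- the one of `R₂`, the pushout of `TY ⟶ ∧Y` and `TY ⟶ TZ`
      (h₂.IsHopf (-1) id ∧
        hY.IsHom h₂ (fun n => pushout.inl (extπ S.X₂ n) (tpowMap S.g n)) ∧
        (tensorAlgebraData (-1) S.X₃).IsHom h₂
          (fun n => pushout.inr (extπ S.X₂ n) (tpowMap S.g n))) ∧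
      -- the bigraded one of `gr ∧Y`, induced by that of `∧Y`
      (hG.IsHopf (-1) (fun a => a.1 + a.2) ∧ IsInducedOnGr S.f (extπ S.X₂) hY hG) ∧
      -- `gr ∧Y ≅ R₁ ⊗ R₂`
      (∃ φ : ∀ a : ℕ × ℕ, grObj S.f (extπ S.X₂) a ≅ extImage S.f a.1 ⊗ extPushout S.g a.2,
        hG.IsHom (h₁.tensor (-1) h₂) (fun a => (φ a).hom)) ∧
      HasStandardStart h₁
        (toTpowOne S.X₁ ≫ extπ S.X₁ 1 ≫ factorThruImage (extMap S.f 1)) ∧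
      HasStandardStart h₂
        (toTpowOne S.X₃ ≫ pushout.inr (extπ S.X₂ 1) (tpowMap S.g 1))) := by
  have hf : Mono S.f := hS.mono_f
  have hg : Epi S.g := hS.epi_g
  have hd : ∀ {D : C} (h : S.X₂ ⟶ D), S.f ≫ h = 0 → ∃ h', S.g ≫ h' = h := fun h hh =>
    exists_desc_of_exact S.f S.g S.zero hS.exact h hh
  constructor
  · obtain ⟨hX, hXT⟩ := exists_quadAlg_isHom _ (lambdaTwoι_comp S.X₁)
    obtain ⟨hY, hYT⟩ := exists_quadAlg_isHom _ (lambdaTwoι_comp S.X₂)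
    obtain ⟨hZ, hZT⟩ := exists_quadAlg_isHom _ (lambdaTwoι_comp S.X₃)
    have hq : ∀ i, symπ S.X₂ i ≫ symMap S.g i = tpowMap S.g i ≫ symπ S.X₃ i := fun i =>
      quadπ_quadMap _ _ S.g (lambdaTwoι_natural S.g) i
    have hepi : ∀ i, Epi (symMap S.g i) := fun i => by
      have h1 : Epi (symπ S.X₂ i ≫ symMap S.g i) := by
        rw [hq]
        have := tpowMap_epi S.g i
        exact epi_comp _ _
      exact epi_of_epi (symπ S.X₂ i) _
    have hρ : hY.IsHom hZ (symMap S.g) := quadMap_isHom S.g (lambdaTwoι_natural S.g) hYT hZT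
    obtain ⟨h₀, hG, h1, h2, h3, h4⟩ := exists_gr_quadAlg_iso (lambdaTwoι_natural S.f)
      (one_mul 1) hXT hYT (exists_comp_lambdaTwoι S.X₂) hρ
      (fun i => (quotFilt_arrow_comp_iff 1 i _).2 (by
        rw [hq, ← Category.assoc, tpowFilt_one_arrow_comp_tpowMap S.zero, zero_comp]))
      -- `Sym Z` is exactly `Sym Y / F¹`: a map killing `F¹` descends to `TZ`, and it respects the
      -- relations of `Z` because these come from `Y`.
      (fun i D h hh => exists_quadMap_desc _ _ S.g (exists_lambdaTwoι_epi S.g) _ h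
        (exists_tpowMap_desc hd i _ ((quotFilt_arrow_comp_iff 1 i h).1 hh)))
    have h5 := isIso_toTpowOne_quadπ (lambdaTwoι S.X₃)
    exact ⟨hX, hY, hZ, h₀, hG, ⟨hXT.isHopf_of_tensorAlgebra, hXT⟩,
      ⟨hYT.isHopf_of_tensorAlgebra, hYT⟩, ⟨hZT.isHopf_of_tensorAlgebra, hZT⟩, h1, h2, h3, h4,
      hZT.hasStandardStart _⟩
  · obtain ⟨hX, hXT⟩ := exists_quadAlg_isHom _ (gammaTwoι_comp S.X₁)
    obtain ⟨hY, hYT⟩ := exists_quadAlg_isHom _ (gammaTwoι_comp S.X₂)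
    have hg' : ∀ i, Epi (tpowMap S.g i) := fun i => tpowMap_epi S.g i
    have hρ₁ : ∀ i, (quotFilt S.f (extπ S.X₂) 1 i).arrow ≫
        pushout.inl (extπ S.X₂ i) (tpowMap S.g i) = 0 := fun i =>
      (quotFilt_arrow_comp_iff 1 i _).2 (by
        rw [pushout.condition, ← Category.assoc, tpowFilt_one_arrow_comp_tpowMap S.zero, zero_comp])
    have hd' : ∀ (i : ℕ) {D : C} (h : extPow S.X₂ i ⟶ D),
        (quotFilt S.f (extπ S.X₂) 1 i).arrow ≫ h = 0 →
          ∃ h', pushout.inl (extπ S.X₂ i) (tpowMap S.g i) ≫ h' = h := fun i D h hh => by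
      -- A map on `∧Y` that kills `F¹` also defines a map on `TZ`; the two glue on the pushout.
      obtain ⟨y, hy⟩ := exists_tpowMap_desc hd i _ ((quotFilt_arrow_comp_iff 1 i h).1 hh)
      exact ⟨pushout.desc h y hy.symm, pushout.inl_desc _ _ _⟩
    obtain ⟨h₂, hρ⟩ := exists_quotFilt_quotient (f := S.f) hYT hρ₁ hd'
    obtain ⟨h₁, hG, h1, h2, h3, h4⟩ := exists_gr_quadAlg_iso (gammaTwoι_natural S.f)
      (by norm_num) hXT hYT (exists_comp_gammaTwoι S.X₂) hρ hρ₁ hd'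
    -- The bialgebra map from `TY` to `R₂` through `∧Y` is also the one through `TZ`. As `TY ⟶ TZ`
    -- is an epimorphic bialgebra map, the second leg respects the structures and `R₂` is a quotient
    -- of `TZ`.
    have hT : (tensorAlgebraData (-1) S.X₃).IsHom h₂
        (fun n => pushout.inr (extπ S.X₂ n) (tpowMap S.g n)) :=
      (hYT.comp hρ).of_epi (tpowMap_isHom S.g) fun i => pushout.condition.symm
    have h5 : IsIso (extπ S.X₂ 1) := isIso_quadπ _ 1 rfl
    have h6 : IsIso (toTpowOne S.X₃) := inferInstanceAs (IsIso (λ_ S.X₃).inv)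
    -- In degree one `extπ` is an isomorphism, and so is its pushout.
    have h7 : IsIso (pushout.inr (extπ S.X₂ 1) (tpowMap S.g 1)) := inferInstance
    exact ⟨hX, hY, h₁, h₂, hG, ⟨hXT.isHopf_of_tensorAlgebra, hXT⟩,
      ⟨hYT.isHopf_of_tensorAlgebra, hYT⟩, h1, ⟨hT.isHopf_of_tensorAlgebra, hρ, hT⟩, h2, h3, h4,
      hT.hasStandardStart _⟩
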